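/- Let $E$ be $\mathbb{R}$ or $\mathbb{C}$, $n=[E:\mathbb{R}]$, $|x|=\|x\|^{n}$ with $\|\cdot\|$ the usual absolute value, $K\le \mathrm{GL}_2(E)$ the standard maximal compact subgroup ($O(2)$ or $U(2)$), and $\psi(x)=e^{-2\pi i\,\mathrm{tr}_{E/\mathbb{R}}(x)}$. Let $dx$ be $n$ times Lebesgue measure on $E$, $dx^\times=dx/|x|$ on $E^\times$, and let $dk$ be the Haar measure of total mass one on $K$. Put $\mathrm{GL}_2(E)^1=\{g:|\det g|=1\}$ with the Haar measure $dg^1$ given by $$\int_{\mathrm{GL}_2(E)^1} f(g^1)\,dg^1=\int_{E^\times\times E\times K} f\left(|y|^{-1/(2n)}\begin{pmatrix} y&x\\&1\end{pmatrix}k\right)\frac{dy^\times}{|y|}\,dx\,dk .$$ For $r>0$ let $\delta_r$ be the distribution $f\mapsto\int_{\mathrm{GL}_2(E)^1}f(rg^1)\,dg^1$, supported on $\{|\det g|=r^{2n}\}$, and let $$\mathcal{F}(g)=e^{-\pi n\,\mathrm{tr}(g^*g)}|\det g|^{1/2}.$$ For $h=\begin{pmatrix}1&t\\&1\end{pmatrix}\begin{pmatrix}zm&\\&z\end{pmatrix}k$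 with $t\in E$, $m,z\in E^\times$, $k\in K$, define the distribution $$\mathbb{W}_h(g)=\frac{\psi(t)|m|^{1/2}}{2\pi^{2(n-1)}}\,(\mathcal{F}\delta_{|m|^{1/(2n)}})(z^{-1}g),$$ that is, $\mathbb{W}_h(\phi)=\frac{\psi(t)|m|^{1/2}}{2\pi^{2(n-1)}}\int_{\mathrm{GL}_2(E)^1}\mathcal{F}(rg^1)\,\phi(z r g^1)\,dg^1$ with $r=|m|^{1/(2n)}$. Let $\pi$ be an irreducible unitary representation of $\mathrm{GL}_2(E)$ on a Hilbert space $H$, generic and spherical (it has a nonzero $K$-fixed vector). Then $\pi$ is equivalent to a subrepresentation of the principal series of functions $f$ satisfying $f\left(\begin{pmatrix}a&x\\&b\end{pmatrix}g\right)=|a|^{\nu_1}|b|^{\nu_2}|a/b|^{1/2}f(g)$ for some $\nu_1,\nu_2\in\mathbb{C}$, and $L(s,\pi)=\Gamma_E(s+\nu_1)\Gamma_E(s+\nu_2)$, where $\Gamma_{\mathbb{R}}(s)=\pi^{-s/2}\Gamma(s/2)$ and $\Gamma_{\mathbb{C}}(s)=2(2\pi)^{-s}\Gamma(s)$. Let $\mathcal{W}(\pi,\psi)$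 be the Whittaker model of $\pi$, consisting of the functions $W(g)=\Lambda(\pi(g)w)$ with $w\in H$ a smooth vector and $\Lambda$ a nonzero continuous linear functional on the smooth vectors with $\Lambda\left(\pi\begin{pmatrix}1&x\\&1\end{pmatrix}v\right)=\psi(x)\Lambda(v)$. Let $W\in\mathcal{W}(\pi,\psi)$ be the spherical Whittaker newform: $W$ is right $K$-invariant and $$\int_{E^\times}W\begin{pmatrix}m&\\&1\end{pmatrix}|m|^{s-1/2}\,dm^\times=L(s,\pi),$$ with absolute convergence, for $\mathrm{Re}(s)$ large. Identify $W$ with the corresponding vector $w\in H$. Then for every $h\in \mathrm{GL}_2(E)$ as above the integral $\pi(\mathbb{W}_h)v=\int \mathbb{W}_h(g)\pi(g)v\,dg$ converges absolutely for all $v\in H$, the operator $\pi(\mathbb{W}_h)$ annihilates the orthogonal complement of the line spanned by $W$, and it acts on that line by the scalar $W(h)$. -/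

import Mathlib

open MeasureTheory
open scoped MatrixGroups ContDiff InnerProductSpace ENNReal

noncomputable section

namespace ArchWhittaker

/-! ### The archimedean local field `𝕜` (real or complex): absolute value, character, measures -/

section Field

variable (𝕜 : Type*) [RCLike 𝕜]

/-- The degree `[𝕜 : ℝ]`, equal to `1` or `2`. -/
def deg : ℕ := Module.finrank ℝ 𝕜

variable {𝕜}

/-- The normalized absolute value: `|x|` on the reals and `x * conj x` on the complex numbers. -/
def nabs (x : 𝕜) : ℝ := ‖x‖ ^ deg 𝕜

/-- The standard additive character `x ↦ exp (-2πi tr x)`, the trace being that of `𝕜 / ℝ`. -/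
def stdChar (x : 𝕜) : ℂ :=
  Complex.exp (-2 * Real.pi * Complex.I * (Algebra.trace ℝ 𝕜 x : ℝ))

variable (𝕜)

/-- The archimedean Gamma factor: `π^(-s/2) Γ(s/2)` over the reals and `2 (2π)^(-s) Γ(s)` over the
complex numbers. -/
def gammaFactor (s : ℂ) : ℂ :=
  if deg 𝕜 = 1 then Complex.Gammaℝ s else Complex.Gammaℂ s

variable [MeasurableSpace 𝕜] [BorelSpace 𝕜]

/-- The additive Haar measure: `[𝕜 : ℝ]` times Lebesgue measure. -/
def addMeasure : Measure 𝕜 := (deg 𝕜 : ℝ≥0∞) • (volume : Measure 𝕜)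

/-- The multiplicative Haar measure `dx / |x|` on `𝕜ˣ`. -/
def mulMeasure : Measure 𝕜ˣ :=
  ((addMeasure 𝕜).withDensity fun x => ENNReal.ofReal (nabs x)⁻¹).comap Units.val

end Field

/-! ### The group `GL₂(𝕜)`, its maximal compact subgroup and its shells -/

section Group

variable (𝕜 : Type*) [RCLike 𝕜]

/-- The standard maximal compact subgroup, that is `O(2)` or `U(2)`. -/
abbrev MaxCompact : Type _ := Matrix.unitaryGroup (Fin 2) 𝕜

instance : MeasurableSpace (MaxCompact 𝕜) := borel _

instance : BorelSpace (MaxCompact 𝕜) := ⟨rfl⟩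

instance : CompactSpace (MaxCompact 𝕜) := by
  apply isCompact_iff_compactSpace.mp
  have hc : IsCompact (Set.pi Set.univ fun _ : Fin 2 =>
      Set.pi Set.univ fun _ : Fin 2 => Metric.closedBall (0 : 𝕜) 1) :=
    isCompact_univ_pi fun _ => isCompact_univ_pi fun _ => isCompact_closedBall _ _
  have hcl : IsClosed (Matrix.unitaryGroup (Fin 2) 𝕜 : Set (Matrix (Fin 2) (Fin 2) 𝕜)) :=
    isClosed_unitary
  refine IsCompact.of_isClosed_subset hc hcl ?_
  intro U hU i _ j _
  simpa using entry_norm_bound_of_unitary hU i j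

/-- The Haar measure of total mass one on the maximal compact subgroup. -/
def compactMeasure : Measure (MaxCompact 𝕜) := Measure.haarMeasure ⊤

variable {𝕜}

/-- A unitary matrix as an element of `GL₂`. -/
def ofCompact (k : MaxCompact 𝕜) : GL (Fin 2) 𝕜 := Unitary.toUnits k

/-- The matrix `(a x; 0 b)`. -/
def upper (a b : 𝕜ˣ) (x : 𝕜) : GL (Fin 2) 𝕜 :=
  Matrix.GeneralLinearGroup.mkOfDetNeZero !![(a : 𝕜), x; 0, (b : 𝕜)]
    (by simp [Matrix.det_fin_two_of])

/-- The scalar matrix of a positive real number. -/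
def realScalar (r : ℝ) (hr : 0 < r) : GL (Fin 2) 𝕜 :=
  upper (Units.mk0 (r : 𝕜) (by exact_mod_cast hr.ne'))
    (Units.mk0 (r : 𝕜) (by exact_mod_cast hr.ne')) 0

lemma nabs_units_pos (y : 𝕜ˣ) : 0 < nabs (y : 𝕜) :=
  pow_pos (norm_pos_iff.mpr y.ne_zero) _

/-- The element `|y|^(-1/(2[𝕜:ℝ])) (y x; 0 1) k` of `GL₂(𝕜)¹ = {g : |det g| = 1}`. -/
def iwasawaPoint (p : 𝕜ˣ × 𝕜 × MaxCompact 𝕜) : GL (Fin 2) 𝕜 :=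
  realScalar (nabs (p.1 : 𝕜) ^ (-(1 / (2 * (deg 𝕜 : ℝ)))))
      (Real.rpow_pos_of_pos (nabs_units_pos p.1) _) *
    upper p.1 1 p.2.1 * ofCompact p.2.2

variable (𝕜) in
/-- The measure `(dy^× / |y|) dx dk`, which describes the Haar measure of `GL₂(𝕜)¹` through
`iwasawaPoint`. -/
def iwasawaMeasure [MeasurableSpace 𝕜] [BorelSpace 𝕜] : Measure (𝕜ˣ × 𝕜 × MaxCompact 𝕜) :=
  ((mulMeasure 𝕜).withDensity fun y => ENNReal.ofReal (nabs (y : 𝕜))⁻¹).prod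
    ((addMeasure 𝕜).prod (compactMeasure 𝕜))

/-- The Gaussian-type function `exp (-π [𝕜:ℝ] tr (g^* g)) |det g|^(1/2)`. -/
def gaussian (g : GL (Fin 2) 𝕜) : ℝ :=
  Real.exp (-Real.pi * deg 𝕜 * ∑ i, ∑ j, ‖g.1 i j‖ ^ 2) * nabs g.1.det ^ (1 / 2 : ℝ)

end Group

/-! ### Smooth functions on `GL₂(𝕜)`, unitary representations, smooth vectors -/

section Smooth

variable {𝕜 : Type*} [RCLike 𝕜]

/-- Extension by zero of a function on `GL₂(𝕜)` to the real vector space of all matrices, in which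
`GL₂(𝕜)` is open. -/
def extend {V : Type*} [Zero V] (f : GL (Fin 2) 𝕜 → V) (A : Fin 2 → Fin 2 → 𝕜) : V :=
  open Classical in if h : IsUnit (Matrix.of A) then f h.unit else 0

variable (𝕜) in
/-- The open set of invertible matrices. -/
def invertibles : Set (Fin 2 → Fin 2 → 𝕜) := {A | IsUnit (Matrix.of A)}

/-- Smoothness (over the reals) of a vector-valued function on `GL₂(𝕜)`. -/
def IsSmooth {V : Type*} [NormedAddCommGroup V] [NormedSpace ℝ V] (f : GL (Fin 2) 𝕜 → V) : Prop :=
  ContDiffOn ℝ ∞ (extend f) (invertibles 𝕜)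

variable {H : Type*} [NormedAddCommGroup H] [InnerProductSpace ℂ H]

/-- Unitary representation: a homomorphism into the unitary group with continuous orbit maps. -/
def IsUnitaryRep (π : GL (Fin 2) 𝕜 →* (H ≃ₗᵢ[ℂ] H)) : Prop :=
  ∀ v : H, Continuous fun g => π g v

/-- Topological irreducibility: `H` is nonzero and has no proper nonzero closed invariant
subspace. -/
def IsIrreducibleRep (π : GL (Fin 2) 𝕜 →* (H ≃ₗᵢ[ℂ] H)) : Prop :=
  Nontrivial H ∧ ∀ S : Submodule ℂ H, IsClosed (S : Set H) →
    (∀ g, ∀ v ∈ S, π g v ∈ S) → S = ⊥ ∨ S = ⊤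

/-- There is a nonzero vector fixed by the maximal compact subgroup. -/
def IsSpherical (π : GL (Fin 2) 𝕜 →* (H ≃ₗᵢ[ℂ] H)) : Prop :=
  ∃ v : H, v ≠ 0 ∧ ∀ k : MaxCompact 𝕜, π (ofCompact k) v = v

/-- The space of smooth vectors. -/
def smoothVectors (π : GL (Fin 2) 𝕜 →* (H ≃ₗᵢ[ℂ] H)) : Submodule ℂ H where
  carrier := {v | IsSmooth fun g => π g v}
  zero_mem' := by
    have : extend (fun g => π g (0 : H)) = fun _ => 0 := by
      funext A; simp [extend]
    simp only [Set.mem_ofPred_eq, IsSmooth, this]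
    exact contDiffOn_const
  add_mem' := by
    intro v w hv hw
    have : extend (fun g => π g (v + w))
        = fun A => extend (fun g => π g v) A + extend (fun g => π g w) A := by
      funext A; by_cases h : IsUnit (Matrix.of A) <;> simp [extend, h]
    simp only [Set.mem_ofPred_eq, IsSmooth, this] at *
    exact hv.add hw
  smul_mem' := by
    intro c v hv
    have : extend (fun g => π g (c • v)) = fun A => c • extend (fun g => π g v) A := by
      funext A; by_cases h : IsUnit (Matrix.of A) <;> simp [extend, h]
    simp only [Set.mem_ofPred_eq, IsSmooth, this] at *
    exact contDiffOn_const.smul hv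

lemma smooth_translate (π : GL (Fin 2) 𝕜 →* (H ≃ₗᵢ[ℂ] H)) (g : GL (Fin 2) 𝕜) {v : H}
    (hv : v ∈ smoothVectors π) : π g v ∈ smoothVectors π := by
  have hv' : ContDiffOn ℝ ∞ (extend fun h => π h v) (invertibles 𝕜) := hv
  change ContDiffOn ℝ ∞ (extend fun h => π h (π g v)) (invertibles 𝕜)
  let R : (Fin 2 → Fin 2 → 𝕜) → (Fin 2 → Fin 2 → 𝕜) := fun A i j => ∑ l, A i l * g.1 l j
  have hR : ContDiff ℝ ∞ R := by fun_prop
  have hRof : ∀ A, Matrix.of (R A) = Matrix.of A * g.1 := by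
    intro A; ext i j; simp [R, Matrix.mul_apply]
  refine (hv'.comp hR.contDiffOn ?_).congr ?_
  · intro A hA
    change IsUnit (Matrix.of (R A))
    rw [hRof]
    exact IsUnit.mul hA g.isUnit
  · intro A hA
    have hA' : IsUnit (Matrix.of A) := hA
    have hRA : IsUnit (Matrix.of (R A)) := by rw [hRof]; exact hA'.mul g.isUnit
    have hu : hRA.unit = hA'.unit * g := by
      ext1; simpa using hRof A
    simp [extend, hA', hRA, hu]

/-- The action of `GL₂(𝕜)` on the smooth vectors. -/
def smoothAct (π : GL (Fin 2) 𝕜 →* (H ≃ₗᵢ[ℂ] H)) (g : GL (Fin 2) 𝕜) (v : smoothVectors π) :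
    smoothVectors π := ⟨π g v, smooth_translate π g v.2⟩

/-- Continuity of a linear functional for the usual Fréchet topology on the smooth vectors, which
is given by the norms of all derivatives at the identity of the orbit maps. -/
def IsContinuousFunctional (π : GL (Fin 2) 𝕜 →* (H ≃ₗᵢ[ℂ] H)) (f : smoothVectors π → ℂ) : Prop :=
  ∃ (N : ℕ) (C : ℝ), ∀ v : smoothVectors π, ‖f v‖ ≤ C * ∑ j ∈ Finset.range (N + 1),
    ‖iteratedFDeriv ℝ j (extend fun g => π g (v : H)) (fun i l => if i = l then 1 else 0)‖

end Smooth

/-! ### Whittaker model, principal series, `L`-function, newforms -/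

section Whittaker

variable {𝕜 : Type*} [RCLike 𝕜] {H : Type*} [NormedAddCommGroup H] [InnerProductSpace ℂ H]

/-- Continuous Whittaker functionals on the smooth vectors, for the character `stdChar`. -/
def IsWhittakerFunctional (π : GL (Fin 2) 𝕜 →* (H ≃ₗᵢ[ℂ] H)) (Λ : smoothVectors π →ₗ[ℂ] ℂ) :
    Prop :=
  IsContinuousFunctional π Λ ∧
    ∀ (x : 𝕜) (v : smoothVectors π), Λ (smoothAct π (upper 1 1 x) v) = stdChar x * Λ v

/-- The element `g ↦ Λ (π(g) v)` of the Whittaker model that corresponds to the smooth vector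
`v`. -/
def whittakerFunction (π : GL (Fin 2) 𝕜 →* (H ≃ₗᵢ[ℂ] H)) (Λ : smoothVectors π →ₗ[ℂ] ℂ)
    (v : smoothVectors π) (g : GL (Fin 2) 𝕜) : ℂ := Λ (smoothAct π g v)

/-- The (smooth) unramified principal series: smooth `f` on `GL₂(𝕜)` with
`f ((a x; 0 b) g) = |a|^ν₁ |b|^ν₂ |a / b|^(1/2) f(g)`. -/
def IsPrincipalSeriesFunction (ν₁ ν₂ : ℂ) (f : GL (Fin 2) 𝕜 → ℂ) : Prop :=
  IsSmooth f ∧ ∀ (a b : 𝕜ˣ) (x : 𝕜) (g : GL (Fin 2) 𝕜),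
    f (upper a b x * g) = (nabs (a : 𝕜) : ℂ) ^ ν₁ * (nabs (b : 𝕜) : ℂ) ^ ν₂ *
      (nabs ((a : 𝕜) / (b : 𝕜)) : ℂ) ^ (1 / 2 : ℂ) * f g

/-- `π` is equivalent to a subrepresentation of the principal series with parameters `ν₁, ν₂`:
there is an injective continuous map from the smooth vectors of `π` into it that intertwines `π`
with right translation. (By equivariance, continuity may be tested on the value at the identity.) -/
def EmbedsInPrincipalSeries (π : GL (Fin 2) 𝕜 →* (H ≃ₗᵢ[ℂ] H)) (ν₁ ν₂ : ℂ) : Prop :=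
  ∃ T : smoothVectors π →ₗ[ℂ] (GL (Fin 2) 𝕜 → ℂ), Function.Injective T ∧
    (∀ v, IsPrincipalSeriesFunction ν₁ ν₂ (T v)) ∧
    (∀ g h v, T (smoothAct π g v) h = T v (h * g)) ∧
    IsContinuousFunctional π fun v => T v 1

/-- `L` is the `L`-function `s ↦ L(s, π)` of the spherical representation `π`: it is the product
of the Gamma factors of the two unramified quasicharacters from which `π` is induced. -/
def IsLFunction (π : GL (Fin 2) 𝕜 →* (H ≃ₗᵢ[ℂ] H)) (L : ℂ → ℂ) : Prop :=
  ∃ ν₁ ν₂ : ℂ, EmbedsInPrincipalSeries π ν₁ ν₂ ∧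
    ∀ s, L s = gammaFactor 𝕜 (s + ν₁) * gammaFactor 𝕜 (s + ν₂)

/-- An element `W` of the Whittaker model of a representation with `L`-function `L` is the
spherical Whittaker newform: it is right invariant under the maximal compact subgroup, and for
`Re s` large its zeta integral `∫ W (diag(m, 1)) |m|^(s - 1/2) dm^×` converges absolutely and
equals `L s`. -/
def IsSphericalNewform [MeasurableSpace 𝕜] [BorelSpace 𝕜] (L : ℂ → ℂ) (W : GL (Fin 2) 𝕜 → ℂ) :
    Prop :=
  (∀ (g : GL (Fin 2) 𝕜) (k : MaxCompact 𝕜), W (g * ofCompact k) = W g) ∧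
    ∃ σ : ℝ, ∀ s : ℂ, σ < s.re →
      Integrable (fun m : 𝕜ˣ => W (upper m 1 0) * (nabs (m : 𝕜) : ℂ) ^ (s - 1 / 2))
        (mulMeasure 𝕜) ∧
      ∫ m : 𝕜ˣ, W (upper m 1 0) * (nabs (m : 𝕜) : ℂ) ^ (s - 1 / 2) ∂(mulMeasure 𝕜) = L s

end Whittaker

/-! ### The distributions `𝕎_h` and the operators `π(𝕎_h)` -/

section Operator

variable {𝕜 : Type*} [RCLike 𝕜]

/-- The radius `r = |m|^(1/(2[𝕜:ℝ]))`, for which `|det (r g¹)| = |m|` if `|det g¹| = 1`. -/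
def radius (m : 𝕜ˣ) : ℝ := nabs (m : 𝕜) ^ (1 / (2 * (deg 𝕜 : ℝ)))

lemma radius_pos (m : 𝕜ˣ) : 0 < radius m := Real.rpow_pos_of_pos (nabs_units_pos m) _

/-- The distribution `δ_r`, namely `f ↦ ∫ f(r g¹) dg¹` over `GL₂(𝕜)¹`. -/
def shellDelta [MeasurableSpace 𝕜] [BorelSpace 𝕜] {V : Type*} [NormedAddCommGroup V]
    [NormedSpace ℝ V] (r : ℝ) (hr : 0 < r) (f : GL (Fin 2) 𝕜 → V) : V :=
  ∫ p, f (realScalar r hr * iwasawaPoint p) ∂(iwasawaMeasure 𝕜)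

/-- Absolute convergence of `δ_r(f)`. -/
def ShellIntegrable [MeasurableSpace 𝕜] [BorelSpace 𝕜] {V : Type*} [NormedAddCommGroup V]
    (r : ℝ) (hr : 0 < r) (f : GL (Fin 2) 𝕜 → V) : Prop :=
  Integrable (fun p => f (realScalar r hr * iwasawaPoint p)) (iwasawaMeasure 𝕜)

variable (𝕜) in
/-- The constant in front of the distribution `𝕎_h`: it is `1/2` over the reals and `1/(2π²)` over
the complex numbers. The power of `π` is there because, for the measure `dx^×` used here, the
integral of `exp(-π [𝕜:ℝ] ‖x‖²) |x|^s dx^×` is `π^([𝕜:ℝ]-1)` times the Gamma factor at `s`. -/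
def heckeConst : ℝ := 1 / (2 * Real.pi ^ (2 * (deg 𝕜 - 1)))

variable {V : Type*} [NormedAddCommGroup V] [NormedSpace ℂ V]

/-- The function `g ↦ F(g) φ(z g)`. Integrating `φ` against `F(z⁻¹ g) δ_r(z⁻¹ g)` means applying
`δ_r` to this function. -/
def twisted (z : 𝕜ˣ) (φ : GL (Fin 2) 𝕜 → V) (g : GL (Fin 2) 𝕜) : V :=
  (gaussian g : ℂ) • φ (upper z z 0 * g)

/-- The distribution `𝕎_h(g) = c ψ(t) |m|^(1/2) (F δ_r)(z⁻¹ g)`, with `r = |m|^(1/(2[𝕜:ℝ]))`, for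
`h = (1 t; 0 1) (z m 0; 0 z) k`, evaluated at the (vector-valued) test function `φ`. -/
def heckeDistribution [MeasurableSpace 𝕜] [BorelSpace 𝕜] (t : 𝕜) (m z : 𝕜ˣ)
    (φ : GL (Fin 2) 𝕜 → V) : V :=
  (heckeConst 𝕜 * stdChar t * (nabs (m : 𝕜) ^ (1 / 2 : ℝ) : ℝ) : ℂ) •
    shellDelta (radius m) (radius_pos m) (twisted z φ)

variable {H : Type*} [NormedAddCommGroup H] [InnerProductSpace ℂ H]

/-- Absolute convergence of the integral `∫ 𝕎_h(g) π(g) v dg`. -/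
def HeckeConverges [MeasurableSpace 𝕜] [BorelSpace 𝕜] (π : GL (Fin 2) 𝕜 →* (H ≃ₗᵢ[ℂ] H))
    (m z : 𝕜ˣ) (v : H) : Prop :=
  ShellIntegrable (radius m) (radius_pos m) (twisted z fun g => π g v)

/-- The operator `π(𝕎_h)`, namely `v ↦ ∫ 𝕎_h(g) π(g) v dg`, for
`h = (1 t; 0 1) (z m 0; 0 z) k`. -/
def heckeOperator [MeasurableSpace 𝕜] [BorelSpace 𝕜] (π : GL (Fin 2) 𝕜 →* (H ≃ₗᵢ[ℂ] H))
    (t : 𝕜) (m z : 𝕜ˣ) (v : H) : H :=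
  heckeDistribution t m z fun g => π g v

end Operator

end ArchWhittaker

end

noncomputable section

namespace ArchWhittaker

/-! ### Differentiation under an integral over a compact space -/

section CompactIntegral

variable {K : Type*} [TopologicalSpace K] [CompactSpace K] [MeasurableSpace K]
  [OpensMeasurableSpace K] {μ : Measure K} [IsFiniteMeasure μ]

/-! Write K for the maximal compact subgroup and S_m for the integral of F(g)π(g) over the shell
|det g| = |m| (`shellOperator`). Up to a constant and the central translation π(z), the operator
π(𝕎_h) is S_m. Since F is bi-invariant under K, S_m is unchanged when preceded by the projection
onto K-fixed vectors (`shellOperator_average`). As the shell measure is left K-invariant, S_m also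
takes values in K-fixed vectors (`isFixed_shellOperator`). The fixed vectors form the line of w, so
S_m vanishes on the orthogonal complement of w and acts on w by a scalar. Only that scalar remains
to be computed.

One-dimensionality comes from the principal series: by the Iwasawa decomposition a smooth fixed
vector is determined by the value of its function at 1, and irreducibility passes from smooth to
arbitrary fixed vectors (`exists_average_span`). That w itself is fixed needs an argument, because
injectivity of the Whittaker map is not assumed (`isFixed_of_whittakerFunction`). It uses that a
continuous functional commutes with averaging over K, which follows by factoring the functional
through finite jets and differentiating under the integral.

For the scalar, let f be the principal series function of w. The coefficient ⟨w, π(g)w⟩ is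
proportional to the average of f(kg) over K. Left invariance of the shell measure undoes this
average, and the scalar becomes the shell integral of F·f/f(1). In Iwasawa coordinates the unipotent
integral is Gaussian and the remaining one is a K-Bessel function of log|m| (`shell_integral`,
`shellOperator_of_isFixed`). On the other side, the Mellin transform of the same Bessel function is
a product of two Gamma functions, which matches L(s, π) exactly thanks to the constant in 𝕎_h
(`gammaFactor_mul`). Fourier inversion therefore identifies W(diag(m, 1)) with that Bessel function
(`whittakerFunction_diagonal`). The factor ψ(t) and the central character agree on both sides.

Left invariance of the shell measure is proved by hand in Iwasawa coordinates, through the Bruhat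
decomposition (`preservesIwasawa`). -/

lemma integrable_of_continuous_compact {F : Type*} [NormedAddCommGroup F]
    {f : K → F} (hf : Continuous f) : Integrable f μ :=
  hf.integrable_of_hasCompactSupport (HasCompactSupport.of_compactSpace f)

variable {E F : Type*} [NormedAddCommGroup E] [NormedSpace ℝ E] [FiniteDimensional ℝ E]
  [NormedAddCommGroup F] [NormedSpace ℝ F]

/-- The derivative is bounded on the product of the compact space with a small closed ball, so a
constant dominates it and is integrable for a finite measure. -/
lemma hasFDerivAt_integral_compact {U : Set E} (hU : IsOpen U) {Φ : K → E → F}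
    {Φ' : K → E → E →L[ℝ] F}
    (hc : ∀ x ∈ U, Continuous fun k => Φ k x)
    (hc' : ContinuousOn (fun p : K × E => Φ' p.1 p.2) (Set.univ ×ˢ U))
    (hd : ∀ k, ∀ x ∈ U, HasFDerivAt (Φ k) (Φ' k x) x) {x : E} (hx : x ∈ U) :
    HasFDerivAt (fun y => ∫ k, Φ k y ∂μ) (∫ k, Φ' k x ∂μ) x := by
  have : ProperSpace E := FiniteDimensional.proper ℝ E
  obtain ⟨ε, hε, hεU⟩ := Metric.nhds_basis_closedBall.mem_iff.mp (hU.mem_nhds hx)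
  have hcomp : IsCompact ((Set.univ : Set K) ×ˢ Metric.closedBall x ε) :=
    isCompact_univ.prod (isCompact_closedBall _ _)
  obtain ⟨C, hC⟩ := hcomp.exists_bound_of_continuousOn
    (hc'.mono (Set.prod_mono_right hεU))
  refine hasFDerivAt_integral_of_dominated_of_fderiv_le (s := Metric.closedBall x ε)
    (bound := fun _ => C) (F := fun y k => Φ k y) (F' := fun y k => Φ' k y)
    (Metric.closedBall_mem_nhds x hε) ?_ ?_ ?_ ?_ (integrable_const C) ?_
  · filter_upwards [hU.mem_nhds hx] with y hy
    exact (integrable_of_continuous_compact (hc y hy)).1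
  · exact integrable_of_continuous_compact (hc x hx)
  · refine (integrable_of_continuous_compact ?_).1
    exact hc'.comp_continuous (f := fun k => (k, x)) (by fun_prop) fun k => ⟨trivial, hx⟩
  · exact .of_forall fun k y hy => hC (k, y) ⟨trivial, hy⟩
  · exact .of_forall fun k y hy => hd k y (hεU hy)

variable [CompleteSpace F]

/-- Each `f ∘ R k` has an explicit Taylor series, jointly continuous in `k` and the point, and
currying commutes with the integral. Keeping the series explicit, rather than mere smoothness, is
what later gives the jet of an average. -/
lemma hasFTaylorSeriesUpToOn_integral_comp {U : Set E} (hU : IsOpen U) {f : E → F}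
    (hf : ContDiffOn ℝ ∞ f U) {R : K → E →L[ℝ] E} (hR : Continuous R)
    (hRU : ∀ k, ∀ x ∈ U, R k x ∈ U) :
    HasFTaylorSeriesUpToOn ∞ (fun x => ∫ k, f (R k x) ∂μ)
      (fun x j => ∫ k, (iteratedFDeriv ℝ j f (R k x)).compContinuousLinearMap
        (fun _ => R k) ∂μ) U := by
  have hft : HasFTaylorSeriesUpToOn ∞ f (fun x j => iteratedFDeriv ℝ j f x) U :=
    (hf.ftaylorSeriesWithin hU.uniqueDiffOn).congr_series fun m _ =>
      iteratedFDerivWithin_of_isOpen m hU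
  have hRc : Continuous fun p : K × E => R p.1 p.2 :=
    (hR.comp continuous_fst).clm_apply continuous_snd
  have hk : ∀ k, HasFTaylorSeriesUpToOn ∞ (fun x => f (R k x))
      (fun x j => (iteratedFDeriv ℝ j f (R k x)).compContinuousLinearMap (fun _ => R k)) U :=
    fun k => (hft.compContinuousLinearMap (R k)).mono fun x hx => hRU k x hx
  have hcont : ∀ j : ℕ, ContinuousOn (fun p : K × E =>
      (iteratedFDeriv ℝ j f (R p.1 p.2)).compContinuousLinearMap (fun _ => R p.1))
      (Set.univ ×ˢ U) := by
    intro j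
    have h1 : ContinuousOn (fun p : K × E => iteratedFDeriv ℝ j f (R p.1 p.2))
        (Set.univ ×ˢ U) :=
      (hft.cont j (by exact_mod_cast le_top)).comp hRc.continuousOn
        fun p hp => hRU _ _ hp.2
    have h2 : Continuous fun p : K × E =>
        ContinuousMultilinearMap.compContinuousLinearMapContinuousMultilinear ℝ
          (fun _ : Fin j => E) (fun _ : Fin j => E) F (fun _ => R p.1) := by
      refine (ContinuousMultilinearMap.coe_continuous _).comp ?_
      exact continuous_pi fun _ => hR.comp continuous_fst
    exact h2.continuousOn.clm_apply h1
  have hfix : ∀ j : ℕ, ∀ x ∈ U, Continuous fun k =>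
      (iteratedFDeriv ℝ j f (R k x)).compContinuousLinearMap (fun _ => R k) :=
    fun j x hx => (hcont j).comp_continuous
      (f := fun k => (k, x)) (by fun_prop) fun k => ⟨trivial, hx⟩
  have hder : ∀ m : ℕ, ∀ x ∈ U, HasFDerivAt
      (fun x => ∫ k, (iteratedFDeriv ℝ m f (R k x)).compContinuousLinearMap
        (fun _ => R k) ∂μ)
      (∫ k, (iteratedFDeriv ℝ m.succ f (R k x)).compContinuousLinearMap
        (fun _ => R k) ∂μ).curryLeft x := by
    intro m x hx
    have := hasFDerivAt_integral_compact (μ := μ) hU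
      (Φ := fun k x => (iteratedFDeriv ℝ m f (R k x)).compContinuousLinearMap
        (fun _ => R k))
      (Φ' := fun k x => ((iteratedFDeriv ℝ m.succ f (R k x)).compContinuousLinearMap
        (fun _ => R k)).curryLeft) (hfix m)
      ((continuousMultilinearCurryLeftEquiv ℝ (fun _ : Fin m.succ => E)
        F).continuous.comp_continuousOn (hcont m.succ))
      (fun k x hx => ((hk k).fderivWithin m (by exact_mod_cast WithTop.coe_lt_top _)
        x hx).hasFDerivAt (hU.mem_nhds hx)) hx
    let e : (E [×m.succ]→L[ℝ] F) →L[ℝ] (E →L[ℝ] E [×m]→L[ℝ] F) :=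
      (continuousMultilinearCurryLeftEquiv ℝ (fun _ : Fin m.succ => E)
        F).toContinuousLinearEquiv.toContinuousLinearMap
    exact this.congr_fderiv (ContinuousLinearMap.integral_comp_comm (𝕜 := ℝ) (μ := μ) (E := E [×m.succ]→L[ℝ] F)
      (Fₗ := E →L[ℝ] E [×m]→L[ℝ] F) e (integrable_of_continuous_compact (hfix _ x hx)))
  refine ⟨?_, fun m _ x hx => (hder m x hx).hasFDerivWithinAt,
    fun m _ x hx => (hder m x hx).continuousAt.continuousWithinAt⟩
  intro x hx
  have := ((continuousMultilinearCurryFin0 ℝ E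
    F).toContinuousLinearEquiv.toContinuousLinearMap.integral_comp_comm
        (integrable_of_continuous_compact (μ := μ) (hfix 0 x hx))).symm
  exact this

lemma contDiffOn_integral_comp {U : Set E} (hU : IsOpen U) {f : E → F}
    (hf : ContDiffOn ℝ ∞ f U) {R : K → E →L[ℝ] E} (hR : Continuous R)
    (hRU : ∀ k, ∀ x ∈ U, R k x ∈ U) :
    ContDiffOn ℝ ∞ (fun x => ∫ k, f (R k x) ∂μ) U :=
  (hasFTaylorSeriesUpToOn_integral_comp hU hf hR hRU).contDiffOn

lemma iteratedFDeriv_integral_comp {U : Set E} (hU : IsOpen U) {f : E → F}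
    (hf : ContDiffOn ℝ ∞ f U) {R : K → E →L[ℝ] E} (hR : Continuous R)
    (hRU : ∀ k, ∀ x ∈ U, R k x ∈ U) (j : ℕ) {x : E} (hx : x ∈ U) :
    iteratedFDeriv ℝ j (fun x => ∫ k, f (R k x) ∂μ) x =
      ∫ k, (iteratedFDeriv ℝ j f (R k x)).compContinuousLinearMap (fun _ => R k) ∂μ := by
  rw [(hasFTaylorSeriesUpToOn_integral_comp (μ := μ) hU hf hR
    hRU).eq_iteratedFDerivWithin_of_uniqueDiffOn (by exact_mod_cast le_top)
    hU.uniqueDiffOn hx, iteratedFDerivWithin_of_isOpen j hU hx]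

end CompactIntegral

/-! ### Topology of the group and of the maximal compact subgroup -/

section Topology

variable {𝕜 : Type*} [RCLike 𝕜]

lemma isUnit_of_iff_det {A : Fin 2 → Fin 2 → 𝕜} :
    A ∈ invertibles 𝕜 ↔ (Matrix.of A).det ≠ 0 := by
  rw [invertibles, Set.mem_ofPred_eq, Matrix.isUnit_iff_isUnit_det, isUnit_iff_ne_zero]

lemma isOpen_invertibles : IsOpen (invertibles 𝕜) := by
  have : invertibles 𝕜 = {A | A 0 0 * A 1 1 - A 0 1 * A 1 0 ≠ 0} := by
    ext A
    rw [isUnit_of_iff_det, Matrix.det_fin_two]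
    rfl
  rw [this]
  exact isOpen_ne_fun (by fun_prop) (by fun_prop)

lemma mem_invertibles (g : GL (Fin 2) 𝕜) : (fun i j => g.1 i j) ∈ invertibles 𝕜 := g.isUnit

lemma continuous_entries : Continuous fun (g : GL (Fin 2) 𝕜) (i j : Fin 2) => g.1 i j :=
  Units.continuous_val (M := Matrix (Fin 2) (Fin 2) 𝕜)

lemma continuous_ofCompact : Continuous (ofCompact : MaxCompact 𝕜 → GL (Fin 2) 𝕜) := by
  rw [Units.continuous_iff]
  refine ⟨continuous_subtype_val, ?_⟩
  change Continuous fun k : MaxCompact 𝕜 => star (k : Matrix (Fin 2) (Fin 2) 𝕜)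
  fun_prop

lemma ofCompact_mul (k l : MaxCompact 𝕜) : ofCompact (k * l) = ofCompact k * ofCompact l :=
  map_mul Unitary.toUnits k l

lemma ofCompact_one : ofCompact (1 : MaxCompact 𝕜) = 1 := map_one Unitary.toUnits

instance : SecondCountableTopology (Matrix (Fin 2) (Fin 2) 𝕜) :=
  inferInstanceAs (SecondCountableTopology (Fin 2 → Fin 2 → 𝕜))

instance : SecondCountableTopology (MaxCompact 𝕜) :=
  inferInstanceAs (SecondCountableTopology
    (Matrix.unitaryGroup (Fin 2) 𝕜 : Set (Matrix (Fin 2) (Fin 2) 𝕜)))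

instance : IsProbabilityMeasure (compactMeasure 𝕜) :=
  ⟨by simpa [compactMeasure] using
    Measure.haarMeasure_self (K₀ := (⊤ : TopologicalSpace.PositiveCompacts (MaxCompact 𝕜)))⟩

instance : (compactMeasure 𝕜).IsMulLeftInvariant := by
  unfold compactMeasure; infer_instance

/-- Right multiplication by a matrix, as a real linear map. -/
def rightMul (B : Matrix (Fin 2) (Fin 2) 𝕜) : (Fin 2 → Fin 2 → 𝕜) →L[ℝ] (Fin 2 → Fin 2 → 𝕜) :=
  LinearMap.toContinuousLinearMap
    { toFun := fun A i j => ∑ l, A i l * B l j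
      map_add' := fun A A' => by ext; simp [add_mul, Finset.sum_add_distrib]
      map_smul' := fun c A => by ext; simp }

lemma rightMul_apply (B : Matrix (Fin 2) (Fin 2) 𝕜) (A : Fin 2 → Fin 2 → 𝕜) (i j : Fin 2) :
    rightMul B A i j = ∑ l, A i l * B l j := rfl

lemma of_rightMul (B : Matrix (Fin 2) (Fin 2) 𝕜) (A : Fin 2 → Fin 2 → 𝕜) :
    Matrix.of (rightMul B A) = Matrix.of A * B := by
  ext i j; simp [rightMul_apply, Matrix.mul_apply]

lemma continuous_rightMul :
    Continuous (rightMul : Matrix (Fin 2) (Fin 2) 𝕜 → _ →L[ℝ] (Fin 2 → Fin 2 → 𝕜)) := by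
  rw [continuous_clm_apply]
  intro A
  refine continuous_pi fun i => continuous_pi fun j => ?_
  simp only [rightMul_apply]
  fun_prop

lemma rightMul_mem_iff (g : GL (Fin 2) 𝕜) {A : Fin 2 → Fin 2 → 𝕜} :
    rightMul g.1 A ∈ invertibles 𝕜 ↔ A ∈ invertibles 𝕜 := by
  change IsUnit (Matrix.of (rightMul g.1 A)) ↔ IsUnit (Matrix.of A)
  rw [of_rightMul]
  exact g.isUnit_mul_units _

lemma extend_rightMul {V : Type*} [Zero V] (f : GL (Fin 2) 𝕜 → V) (g : GL (Fin 2) 𝕜)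
    (A : Fin 2 → Fin 2 → 𝕜) :
    extend f (rightMul g.1 A) = extend (fun h => f (h * g)) A := by
  by_cases hA : IsUnit (Matrix.of A)
  · have hRA : IsUnit (Matrix.of (rightMul g.1 A)) := (rightMul_mem_iff g).mpr hA
    have hu : hRA.unit = hA.unit * g := by
      ext1; simpa using of_rightMul g.1 A
    simp [extend, hA, hRA, hu]
  · have hRA : ¬ IsUnit (Matrix.of (rightMul g.1 A)) := fun h => hA ((rightMul_mem_iff g).mp h)
    simp [extend, hA, hRA]

end Topology

/-! ### Jets of orbit maps at the identity -/

section Jet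

variable {𝕜 : Type*} [RCLike 𝕜] {H : Type*} [NormedAddCommGroup H] [InnerProductSpace ℂ H]

/-- The derivatives up to order `N` at the identity of the orbit map of `v`. -/
def jet (π : GL (Fin 2) 𝕜 →* (H ≃ₗᵢ[ℂ] H)) (N : ℕ) (v : H) (j : Fin (N + 1)) :
    (Fin 2 → Fin 2 → 𝕜) [×j]→L[ℝ] H :=
  iteratedFDeriv ℝ j (extend fun g => π g v) (fun i l => if i = l then 1 else 0)

variable (π : GL (Fin 2) 𝕜 →* (H ≃ₗᵢ[ℂ] H))

lemma extend_add_orbit (v w : H) : extend (fun g => π g (v + w)) =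
    extend (fun g => π g v) + extend (fun g => π g w) := by
  funext A; by_cases h : IsUnit (Matrix.of A) <;> simp [extend, h]

lemma extend_smul_orbit (c : ℂ) (v : H) : extend (fun g => π g (c • v)) =
    c • extend (fun g => π g v) := by
  funext A; by_cases h : IsUnit (Matrix.of A) <;> simp [extend, h]

lemma one_mem_invertibles : (fun i l => if i = l then 1 else 0) ∈ invertibles 𝕜 := by
  convert mem_invertibles (1 : GL (Fin 2) 𝕜) using 1
  funext i l
  simp [Matrix.one_apply]

lemma contDiffAt_one {v : H} (hv : v ∈ smoothVectors π) (j : ℕ) :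
    ContDiffAt ℝ j (extend fun g => π g v) (fun i l => if i = l then 1 else 0) := by
  have h : ContDiffOn ℝ ∞ (extend fun g => π g v) (invertibles 𝕜) := hv
  exact (h.contDiffAt (isOpen_invertibles.mem_nhds one_mem_invertibles)).of_le
    (by exact_mod_cast le_top)

/-- The jet of a smooth vector, as a linear map. -/
def jetMap (N : ℕ) : smoothVectors π →ₗ[ℂ]
    (∀ j : Fin (N + 1), (Fin 2 → Fin 2 → 𝕜) [×j]→L[ℝ] H) where
  toFun v := jet π N v
  map_add' v w := by
    funext j
    simp only [jet, Submodule.coe_add, extend_add_orbit, Pi.add_apply]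
    exact iteratedFDeriv_add_apply (contDiffAt_one π v.2 _) (contDiffAt_one π w.2 _)
  map_smul' c v := by
    funext j
    simp only [jet, Submodule.coe_smul, extend_smul_orbit, Pi.smul_apply, RingHom.id_apply]
    exact iteratedFDeriv_const_smul_apply (contDiffAt_one π v.2 _)

/-- The bound makes `Λ` vanish on the kernel of `J`, so it descends to a bounded functional on the
range, which Hahn–Banach extends. -/
lemma exists_strongDual_factor {V B : Type*} [AddCommGroup V] [Module ℂ V]
    [NormedAddCommGroup B] [NormedSpace ℂ B] (J : V →ₗ[ℂ] B) (Λ : V →ₗ[ℂ] ℂ) {C : ℝ}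
    (hJ : ∀ v, ‖Λ v‖ ≤ C * ‖J v‖) : ∃ Λ' : B →L[ℂ] ℂ, ∀ v, Λ v = Λ' (J v) := by
  have hker : LinearMap.ker J ≤ LinearMap.ker Λ := fun v hv => by
    have h := hJ v
    rw [LinearMap.mem_ker.mp hv, norm_zero, mul_zero] at h
    exact norm_le_zero_iff.mp h
  let l := ((LinearMap.ker J).liftQ Λ hker).comp J.quotKerEquivRange.symm.toLinearMap
  have hl : ∀ v, l ⟨J v, v, rfl⟩ = Λ v := fun v => by
    have : J.quotKerEquivRange.symm ⟨J v, v, rfl⟩ = Submodule.Quotient.mk v :=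
      J.quotKerEquivRange_symm_apply_image v _
    change (LinearMap.ker J).liftQ Λ hker (J.quotKerEquivRange.symm ⟨J v, v, rfl⟩) = Λ v
    rw [this]
    rfl
  let f : StrongDual ℂ (LinearMap.range J) := l.mkContinuous C fun y => by
    obtain ⟨_, v, rfl⟩ := y
    rw [hl]
    exact hJ v
  obtain ⟨Λ', h', -⟩ := exists_extension_norm_eq (LinearMap.range J) f
  exact ⟨Λ', fun v => ((h' ⟨J v, v, rfl⟩).trans (hl v)).symm⟩

/-- Jets live in a normed space, so continuity and integration of orbits under `Λ` reduce to those
of jets, without putting a topology on the smooth vectors. -/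
lemma exists_factor_jet {Λ : smoothVectors π →ₗ[ℂ] ℂ} (hΛ : IsContinuousFunctional π Λ) :
    ∃ (N : ℕ) (Λ' : (∀ j : Fin (N + 1), (Fin 2 → Fin 2 → 𝕜) [×j]→L[ℝ] H) →L[ℂ] ℂ),
      ∀ v : smoothVectors π, Λ v = Λ' (jet π N v) := by
  obtain ⟨N, C, hC⟩ := hΛ
  refine ⟨N, ?_⟩
  set J := jetMap π N
  have hJ : ∀ v, ‖Λ v‖ ≤ |C| * (N + 1) * ‖J v‖ := by
    intro v
    refine (hC v).trans ?_
    rw [mul_assoc]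
    have h1 : ∑ j ∈ Finset.range (N + 1), ‖iteratedFDeriv ℝ j (extend fun g => π g (v : H))
        (fun i l => if i = l then 1 else 0)‖ ≤ (N + 1) * ‖J v‖ := by
      rw [Finset.sum_range]
      calc _ ≤ ∑ _j : Fin (N + 1), ‖J v‖ := Finset.sum_le_sum fun j _ => norm_le_pi_norm (J v) j
        _ = _ := by simp
    exact (mul_le_mul_of_nonneg_right (le_abs_self C)
      (Finset.sum_nonneg fun _ _ => norm_nonneg _)).trans
      (mul_le_mul_of_nonneg_left h1 (abs_nonneg C))
  exact exists_strongDual_factor J Λ hJ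

/-- The orbit map of `π g v` is that of `v` composed with right multiplication by `g`, a linear map
carrying 1 to `g`; the chain rule has no correction terms. -/
lemma jet_translate {v : H} (hv : v ∈ smoothVectors π) (N : ℕ) (g : GL (Fin 2) 𝕜)
    (j : Fin (N + 1)) :
    jet π N (π g v) j = (iteratedFDeriv ℝ j (extend fun g => π g v)
      (fun i l => g.1 i l)).compContinuousLinearMap (fun _ => rightMul g.1) := by
  have h : ContDiffOn ℝ ∞ (extend fun g => π g v) (invertibles 𝕜) := hv
  have hpre : rightMul g.1 ⁻¹' invertibles 𝕜 = invertibles 𝕜 :=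
    Set.ext fun A => rightMul_mem_iff g
  have hone : rightMul g.1 (fun i l => if i = l then 1 else 0) = fun i l => g.1 i l := by
    funext i l; simp [rightMul_apply]
  have hfun : (extend fun h => π h (π g v)) = (extend fun h => π h v) ∘ rightMul g.1 := by
    funext A
    simp [extend_rightMul]
  have := (rightMul g.1).iteratedFDerivWithin_comp_right h isOpen_invertibles.uniqueDiffOn
    (by rw [hpre]; exact isOpen_invertibles.uniqueDiffOn) (x := fun i l => if i = l then 1 else 0)
    (by rw [hone]; exact mem_invertibles g) (i := j) (by exact_mod_cast le_top)
  rw [hpre, iteratedFDerivWithin_of_isOpen _ isOpen_invertibles one_mem_invertibles,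
    iteratedFDerivWithin_of_isOpen _ isOpen_invertibles (by rw [hone]; exact mem_invertibles g),
    hone, ← hfun] at this
  exact this

lemma continuous_jet {v : H} (hv : v ∈ smoothVectors π) (N : ℕ) :
    Continuous fun g => jet π N (π g v) := by
  refine continuous_pi fun j => ?_
  simp only [jet_translate π hv]
  have h : ContDiffOn ℝ ∞ (extend fun g => π g v) (invertibles 𝕜) := hv
  have h1 : Continuous fun g : GL (Fin 2) 𝕜 =>
      iteratedFDeriv ℝ j (extend fun g => π g v) (fun i l => g.1 i l) := by
    refine ContinuousOn.comp_continuous ?_ continuous_entries mem_invertibles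
    exact (h.continuousOn_iteratedFDerivWithin (m := j) (by exact_mod_cast le_top)
      isOpen_invertibles.uniqueDiffOn).congr
      fun x hx => (iteratedFDerivWithin_of_isOpen _ isOpen_invertibles hx).symm
  have h2 : Continuous fun g : GL (Fin 2) 𝕜 =>
      ContinuousMultilinearMap.compContinuousLinearMapContinuousMultilinear ℝ
        (fun _ : Fin j => (Fin 2 → Fin 2 → 𝕜)) (fun _ : Fin j => (Fin 2 → Fin 2 → 𝕜)) H
        (fun _ => rightMul g.1) := by
    refine (ContinuousMultilinearMap.coe_continuous _).comp ?_
    exact continuous_pi fun _ => continuous_rightMul.comp Units.continuous_val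
  exact h2.clm_apply h1

lemma IsContinuousFunctional.continuous_orbit {Λ : smoothVectors π →ₗ[ℂ] ℂ}
    (hΛ : IsContinuousFunctional π Λ) (v : smoothVectors π) :
    Continuous fun g => Λ (smoothAct π g v) := by
  obtain ⟨N, Λ', h⟩ := exists_factor_jet π hΛ
  simp only [h, smoothAct]
  exact Λ'.continuous.comp (continuous_jet π v.2 N)

/-! ### Averages over the maximal compact subgroup -/

variable [CompleteSpace H]

/-- The average of `v` over the maximal compact subgroup. -/
def average (v : H) : H := ∫ k, π (ofCompact k) v ∂(compactMeasure 𝕜)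

lemma orbit_eq_integral {v : H} (hv : Continuous fun g => π g v) (g : GL (Fin 2) 𝕜) :
    π g (average π v) = ∫ k, π (g * ofCompact k) v ∂(compactMeasure 𝕜) := by
  have hi : Integrable (fun k => π (ofCompact k) v) (compactMeasure 𝕜) :=
    integrable_of_continuous_compact (hv.comp continuous_ofCompact)
  have := ((π g).toContinuousLinearEquiv.toContinuousLinearMap.integral_comp_comm hi).symm
  simp only [map_mul]
  exact this

lemma extend_average {v : H} (hv : Continuous fun g => π g v) (g : GL (Fin 2) 𝕜) :
    (extend fun h => π h (π g (average π v))) = fun A => ∫ k : MaxCompact 𝕜,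
      extend (fun h => π h v) (rightMul (g * ofCompact k).1 A) ∂(compactMeasure 𝕜) := by
  funext A
  simp only [extend_rightMul]
  by_cases hA : IsUnit (Matrix.of A)
  · have h := orbit_eq_integral π hv (hA.unit * g)
    rw [map_mul] at h
    simp only [extend, hA, dif_pos, ← mul_assoc]
    exact h
  · simp [extend, hA]

lemma continuous_rightMul_mul_ofCompact (g : GL (Fin 2) 𝕜) :
    Continuous fun k : MaxCompact 𝕜 => rightMul (g * ofCompact k).1 :=
  continuous_rightMul.comp
    (Units.continuous_val.comp (continuous_const.mul continuous_ofCompact))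

lemma average_mem_smoothVectors (hπ : IsUnitaryRep π) {v : H} (hv : v ∈ smoothVectors π) :
    average π v ∈ smoothVectors π := by
  have h := extend_average π (hπ v) 1
  have h1 : π 1 (average π v) = average π v := by rw [map_one]; rfl
  rw [h1] at h
  change ContDiffOn ℝ ∞ (extend fun g => π g (average π v)) (invertibles 𝕜)
  rw [h]
  exact contDiffOn_integral_comp isOpen_invertibles hv (continuous_rightMul_mul_ofCompact 1)
    fun k A hA => (rightMul_mem_iff _).mpr hA

/-- Near the identity the orbit map of the average is an integral over K of orbit maps precomposed
with linear maps, so derivatives of every order pass inside. -/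
lemma jet_average (hπ : IsUnitaryRep π) {v : H} (hv : v ∈ smoothVectors π) (N : ℕ)
    (g : GL (Fin 2) 𝕜) : jet π N (π g (average π v)) =
      ∫ k, jet π N (π (g * ofCompact k) v) ∂(compactMeasure 𝕜) := by
  funext j
  have hc : Continuous fun k : MaxCompact 𝕜 => jet π N (π (g * ofCompact k) v) :=
    (continuous_jet π hv N).comp (continuous_const.mul continuous_ofCompact)
  have hi : ∀ j, Integrable (fun k => jet π N (π (g * ofCompact k) v) j) (compactMeasure 𝕜) :=
    fun j => integrable_of_continuous_compact ((continuous_apply j).comp hc)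
  rw [eval_integral hi, jet, extend_average π (hπ v)]
  refine (iteratedFDeriv_integral_comp isOpen_invertibles hv
    (continuous_rightMul_mul_ofCompact g)
    (fun k A hA => (rightMul_mem_iff _).mpr hA) j one_mem_invertibles).trans ?_
  congr 1 with k : 1
  rw [jet_translate π hv]
  congr 2
  funext i l; simp [rightMul_apply]

/-- Continuous functionals commute with averages. -/
lemma IsContinuousFunctional.map_average {Λ : smoothVectors π →ₗ[ℂ] ℂ}
    (hΛ : IsContinuousFunctional π Λ) (hπ : IsUnitaryRep π) (v : smoothVectors π)
    (g : GL (Fin 2) 𝕜) :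
    Λ (smoothAct π g ⟨average π (v : H), average_mem_smoothVectors π hπ v.2⟩) =
      ∫ k, Λ (smoothAct π (g * ofCompact k) v) ∂(compactMeasure 𝕜) := by
  obtain ⟨N, Λ', h⟩ := exists_factor_jet π hΛ
  simp only [h, smoothAct]
  rw [jet_average π hπ v.2]
  exact (Λ'.integral_comp_comm (integrable_of_continuous_compact
    ((continuous_jet π v.2 N).comp (continuous_const.mul continuous_ofCompact)))).symm

end Jet

/-! ### Iwasawa decomposition -/

section Iwasawa

variable {𝕜 : Type*} [RCLike 𝕜]

open scoped ComplexConjugate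

/-- The special unitary matrix with bottom row `(c, d)`. -/
def rotation (c d : 𝕜) (h : ‖c‖ ^ 2 + ‖d‖ ^ 2 = 1) : MaxCompact 𝕜 :=
  ⟨!![conj d, -conj c; c, d], by
    have h' : c * conj c + d * conj d = 1 := by
      rw [RCLike.mul_conj, RCLike.mul_conj]; exact_mod_cast h
    rw [Matrix.mem_unitaryGroup_iff]
    ext i j
    fin_cases i <;> fin_cases j <;>
      simp [Matrix.mul_apply, Fin.sum_univ_two, Matrix.star_eq_conjTranspose]
    · linear_combination h'
    · ring
    · ring
    · exact h'⟩

lemma coe_ofCompact (k : MaxCompact 𝕜) :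
    ((ofCompact k : GL (Fin 2) 𝕜) : Matrix (Fin 2) (Fin 2) 𝕜) = k := rfl

lemma coe_upper (a b : 𝕜ˣ) (x : 𝕜) :
    ((upper a b x : GL (Fin 2) 𝕜) : Matrix (Fin 2) (Fin 2) 𝕜) = !![(a : 𝕜), x; 0, (b : 𝕜)] := rfl

lemma upper_mul (a b c d : 𝕜ˣ) (x y : 𝕜) :
    upper a b x * upper c d y = upper (a * c) (b * d) (a * y + x * d) := by
  ext1
  simp [coe_upper]

/-- The bottom row of `g`, divided by its Euclidean norm `ρ`, is completed to the special unitary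
matrix `k`. Then `g k⁻¹` has bottom row `(0, ρ)`, and its determinant fixes the other diagonal
entry. -/
lemma exists_upper_mul_ofCompact (g : GL (Fin 2) 𝕜) :
    ∃ (a b : 𝕜ˣ) (x : 𝕜) (k : MaxCompact 𝕜), g = upper a b x * ofCompact k := by
  set α := g.1 0 0
  set β := g.1 0 1
  set c := g.1 1 0
  set d := g.1 1 1
  have hdet : α * d - β * c ≠ 0 := by
    have := ((Matrix.isUnit_iff_isUnit_det _).mp g.isUnit).ne_zero
    rwa [Matrix.det_fin_two] at this
  have hpos : 0 < ‖c‖ ^ 2 + ‖d‖ ^ 2 := by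
    by_contra hn
    have hc : ‖c‖ ^ 2 = 0 := by nlinarith [sq_nonneg ‖c‖, sq_nonneg ‖d‖]
    have hd : ‖d‖ ^ 2 = 0 := by nlinarith [sq_nonneg ‖c‖, sq_nonneg ‖d‖]
    simp only [ne_eq, OfNat.ofNat_ne_zero, not_false_eq_true, pow_eq_zero_iff, norm_eq_zero]
      at hc hd
    simp [hc, hd] at hdet
  set ρ := √(‖c‖ ^ 2 + ‖d‖ ^ 2)
  have hρ : 0 < ρ := Real.sqrt_pos.mpr hpos
  have hρ2 : ρ ^ 2 = ‖c‖ ^ 2 + ‖d‖ ^ 2 := Real.sq_sqrt hpos.le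
  have hρ0 : (ρ : 𝕜) ≠ 0 := by exact_mod_cast hρ.ne'
  have hcd : c * conj c + d * conj d = (ρ : 𝕜) ^ 2 := by
    rw [RCLike.mul_conj, RCLike.mul_conj]; exact_mod_cast hρ2.symm
  have hunit : ‖c / (ρ : 𝕜)‖ ^ 2 + ‖d / (ρ : 𝕜)‖ ^ 2 = 1 := by
    rw [norm_div, norm_div, RCLike.norm_ofReal, abs_of_pos hρ, div_pow, div_pow, ← add_div, hρ2,
      div_self hpos.ne']
  refine ⟨Units.mk0 ((α * d - β * c) / ρ) (div_ne_zero hdet hρ0), Units.mk0 (ρ : 𝕜) hρ0,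
    (α * conj c + β * conj d) / ρ, rotation _ _ hunit, ?_⟩
  ext1
  rw [Units.val_mul, coe_upper, coe_ofCompact]
  change g.1 = _ * !![conj (d / (ρ : 𝕜)), -conj (c / (ρ : 𝕜)); c / (ρ : 𝕜), d / (ρ : 𝕜)]
  rw [Matrix.eta_fin_two g.1, Matrix.mul_fin_two]
  simp only [Units.val_mk0, map_div₀, RCLike.conj_ofReal, zero_mul, zero_add]
  change !![α, β; c, d] = _
  congr 1
  ext i j
  fin_cases i <;> fin_cases j <;> simp <;> field_simp
  · linear_combination (-α) * hcd
  · linear_combination (-β) * hcd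

end Iwasawa

/-! ### Vectors fixed by the maximal compact subgroup -/

section Fixed

variable {𝕜 : Type*} [RCLike 𝕜] {H : Type*} [NormedAddCommGroup H] [InnerProductSpace ℂ H]
  (π : GL (Fin 2) 𝕜 →* (H ≃ₗᵢ[ℂ] H))

/-- Being fixed by the maximal compact subgroup. -/
def IsFixed (v : H) : Prop := ∀ k : MaxCompact 𝕜, π (ofCompact k) v = v

variable {π}

lemma IsFixed.sub_smul {v w : H} (hv : IsFixed π v) (hw : IsFixed π w) (a b : ℂ) :
    IsFixed π (a • v - b • w) := fun k => by
  rw [map_sub, map_smul, map_smul, hv k, hw k]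

lemma inner_orbit (g : GL (Fin 2) 𝕜) (v w : H) : ⟪π g v, w⟫_ℂ = ⟪v, π g⁻¹ w⟫_ℂ := by
  rw [← (π g⁻¹).inner_map_map (π g v) w]
  congr 1
  change (π g⁻¹ * π g) v = v
  rw [← map_mul, inv_mul_cancel, map_one]
  rfl

/-- The orthogonal complement of the span of the orbit of `v` is closed and invariant. If all
coefficients vanished, it would contain `u`, hence be everything, and `v` would be orthogonal to
itself. -/
lemma exists_inner_orbit_ne_zero (hirr : IsIrreducibleRep π) {u v : H} (hu : u ≠ 0)
    (hv : v ≠ 0) : ∃ g, ⟪u, π g v⟫_ℂ ≠ 0 := by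
  by_contra! h
  have hinv : ∀ g, ∀ x ∈ (Submodule.span ℂ (Set.range fun g => π g v))ᗮ,
      π g x ∈ (Submodule.span ℂ (Set.range fun g => π g v))ᗮ := by
    intro g x hx
    rw [Submodule.mem_orthogonal] at hx ⊢
    intro y hy
    have hyx : ⟪y, π g x⟫_ℂ = ⟪π g⁻¹ y, x⟫_ℂ := by rw [inner_orbit, inv_inv]
    rw [hyx]
    refine hx _ ?_
    clear hyx hx
    induction hy using Submodule.span_induction with
    | mem x hx =>
      obtain ⟨g', rfl⟩ := hx
      exact Submodule.subset_span ⟨g⁻¹ * g', by simp⟩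
    | zero => simp
    | add x y _ _ hx hy => rw [map_add]; exact add_mem hx hy
    | smul a x _ hx => rw [map_smul]; exact Submodule.smul_mem _ _ hx
  rcases hirr.2 (Submodule.span ℂ (Set.range fun g => π g v))ᗮ
    (Submodule.isClosed_orthogonal _) hinv with hS | hS
  · refine hu ?_
    rw [← Submodule.mem_bot ℂ, ← hS, Submodule.mem_orthogonal']
    intro y hy
    induction hy using Submodule.span_induction with
    | mem x hx => obtain ⟨g, rfl⟩ := hx; exact h g
    | zero => simp
    | add x y _ _ hx hy => rw [inner_add_right, hx, hy, add_zero]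
    | smul a x _ hx => rw [inner_smul_right, hx, mul_zero]
  · have hvS : v ∈ (Submodule.span ℂ (Set.range fun g => π g v))ᗮ := hS ▸ Submodule.mem_top
    have := (Submodule.mem_orthogonal _ _).mp hvS v
      (Submodule.subset_span ⟨1, by simp⟩)
    exact hv (inner_self_eq_zero.mp this)

/-- The function `T v` is left equivariant under upper triangular matrices and right K-invariant, so
Iwasawa determines it from its value at 1. -/
lemma eq_zero_of_fixed {ν₁ ν₂ : ℂ} {T : smoothVectors π →ₗ[ℂ] (GL (Fin 2) 𝕜 → ℂ)}
    (hinj : Function.Injective T) (hps : ∀ v, IsPrincipalSeriesFunction ν₁ ν₂ (T v))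
    (heq : ∀ g h v, T (smoothAct π g v) h = T v (h * g)) {v : smoothVectors π}
    (hv : IsFixed π (v : H)) (h1 : T v 1 = 0) : v = 0 := by
  refine hinj ?_
  rw [map_zero]
  funext g
  obtain ⟨a, b, x, k, rfl⟩ := exists_upper_mul_ofCompact g
  rw [(hps v).2, ← one_mul (ofCompact k), ← heq]
  have : smoothAct π (ofCompact k) v = v := Subtype.ext (hv k)
  rw [this, h1, mul_zero, Pi.zero_apply]

variable [CompleteSpace H]

lemma average_of_isFixed {v : H} (hv : IsFixed π v) : average π v = v := by
  simp [average, hv _]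

lemma isFixed_average (hπ : IsUnitaryRep π) (v : H) : IsFixed π (average π v) := fun k => by
  rw [orbit_eq_integral π (hπ v)]
  simp only [← ofCompact_mul]
  exact integral_mul_left_eq_self (fun l => π (ofCompact l) v) k

lemma inner_average (hπ : IsUnitaryRep π) {u : H} (hu : IsFixed π u) (v : H) :
    ⟪u, average π v⟫_ℂ = ⟪u, v⟫_ℂ := by
  have hi : Integrable (fun k => π (ofCompact k) v) (compactMeasure 𝕜) :=
    integrable_of_continuous_compact ((hπ v).comp continuous_ofCompact)
  rw [average, ← integral_inner hi]
  have : ∀ k : MaxCompact 𝕜, ⟪u, π (ofCompact k) v⟫_ℂ = ⟪u, v⟫_ℂ := fun k => by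
    conv_lhs => rw [← hu k]
    exact (π (ofCompact k)).inner_map_map u v
  simp [this]

/-- Averages of translates of a nonzero smooth vector span the space of fixed vectors. -/
lemma exists_average_span (hπ : IsUnitaryRep π) (hirr : IsIrreducibleRep π)
    (hsph : IsSpherical π) {ν₁ ν₂ : ℂ} (hemb : EmbedsInPrincipalSeries π ν₁ ν₂)
    {w : H} (hw : w ∈ smoothVectors π) (hw0 : w ≠ 0) :
    ∃ g, ∀ x, IsFixed π x → ∃ c : ℂ, x = c • average π (π g w) := by
  obtain ⟨T, hinj, hps, heq, -⟩ := hemb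
  have hsm : ∀ g, average π (π g w) ∈ smoothVectors π := fun g =>
    average_mem_smoothVectors π hπ (smooth_translate π g hw)
  obtain ⟨s, hs0, hs⟩ := hsph
  obtain ⟨g, hg⟩ := exists_inner_orbit_ne_zero hirr hs0 hw0
  rw [← inner_average hπ hs] at hg
  set u := average π (π g w) with hu
  have hu0 : u ≠ 0 := fun h => hg (by rw [h, inner_zero_right])
  have huf : IsFixed π u := isFixed_average hπ _
  have hmul : ∀ g', ∃ c : ℂ, average π (π g' w) = c • u := by
    intro g'
    let U : smoothVectors π := ⟨u, hsm g⟩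
    let V : smoothVectors π := ⟨average π (π g' w), hsm g'⟩
    have hU : T U 1 ≠ 0 := fun h =>
      hu0 (congrArg Subtype.val (eq_zero_of_fixed hinj hps heq (v := U) huf h))
    have hz : T U 1 • V - T V 1 • U = 0 := by
      refine eq_zero_of_fixed hinj hps heq
        ((isFixed_average hπ (π g' w)).sub_smul huf (T U 1) (T V 1)) ?_
      -- The combination was chosen so that its value at 1 cancels.
      simp [mul_comm]
    refine ⟨(T U 1)⁻¹ * T V 1, ?_⟩
    have hz' : T U 1 • average π (π g' w) = T V 1 • u := sub_eq_zero.mp (congrArg Subtype.val hz)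
    rw [mul_smul, ← hz', smul_smul, inv_mul_cancel₀ hU, one_smul]
  refine ⟨g, fun x hx => ?_⟩
  -- A fixed `x` need not be smooth, so the principal series gives no hold on it. Its component `y`
  -- orthogonal to `u` is fixed, so every ⟨y, π(g')w⟩ equals the pairing of `y` with an average,
  -- which is a multiple of ⟨y, u⟩ = 0. Irreducibility then excludes `y ≠ 0`.
  refine ⟨⟪u, x⟫_ℂ / ⟪u, u⟫_ℂ, ?_⟩
  have huu : ⟪u, u⟫_ℂ ≠ 0 := inner_self_ne_zero.mpr hu0
  by_contra hne
  set y := (1 : ℂ) • x - (⟪u, x⟫_ℂ / ⟪u, u⟫_ℂ) • u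
  have hy : IsFixed π y := hx.sub_smul huf _ _
  have hy0 : y ≠ 0 := fun h => hne (by simpa [y, sub_eq_zero] using h)
  have hyu : ⟪y, u⟫_ℂ = 0 := by
    rw [← inner_conj_symm, inner_sub_right, inner_smul_right, inner_smul_right, one_mul,
      div_mul_cancel₀ _ huu, sub_self, map_zero]
  obtain ⟨g', hg'⟩ := exists_inner_orbit_ne_zero hirr hy0 hw0
  obtain ⟨c, hc⟩ := hmul g'
  rw [← inner_average hπ hy, hc, inner_smul_right, hyu, mul_zero] at hg'
  exact hg' rfl

/-- A smooth vector whose Whittaker function is nonzero and right invariant under the maximal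
compact subgroup is fixed by that subgroup. -/
lemma isFixed_of_whittakerFunction (hπ : IsUnitaryRep π) (hirr : IsIrreducibleRep π)
    (hsph : IsSpherical π) {ν₁ ν₂ : ℂ} (hemb : EmbedsInPrincipalSeries π ν₁ ν₂)
    {Λ : smoothVectors π →ₗ[ℂ] ℂ} (hΛ : IsContinuousFunctional π Λ) {w : smoothVectors π}
    (hK : ∀ (g : GL (Fin 2) 𝕜) (k : MaxCompact 𝕜),
      whittakerFunction π Λ w (g * ofCompact k) = whittakerFunction π Λ w g)
    (h0 : whittakerFunction π Λ w ≠ 0) : IsFixed π (w : H) := by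
  have hsm : ∀ v : smoothVectors π, average π (v : H) ∈ smoothVectors π := fun v =>
    average_mem_smoothVectors π hπ v.2
  have hact : ∀ g h (v : smoothVectors π),
      smoothAct π g (smoothAct π h v) = smoothAct π (g * h) v := fun g h v => by
    apply Subtype.ext; simp [smoothAct]
  have hav : ∀ (v : smoothVectors π) g, whittakerFunction π Λ ⟨_, hsm v⟩ g =
      ∫ k, whittakerFunction π Λ v (g * ofCompact k) ∂(compactMeasure 𝕜) := by
    exact fun v g => hΛ.map_average π hπ v g
  -- The component of `w` killed by averaging. Its Whittaker function vanishes, since right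
  -- K-invariance makes the function of `w` equal to its own average.
  set n : smoothVectors π := w - ⟨_, hsm w⟩
  have hn : ∀ g, whittakerFunction π Λ n g = 0 := by
    intro g
    have h1 : whittakerFunction π Λ n g =
        whittakerFunction π Λ w g - whittakerFunction π Λ ⟨_, hsm w⟩ g := by
      have : smoothAct π g n = smoothAct π g w - smoothAct π g ⟨_, hsm w⟩ := by
        apply Subtype.ext; simp [smoothAct, n]
      rw [whittakerFunction, this, map_sub]; rfl
    rw [h1, hav]
    simp [hK]
  by_cases hn0 : (n : H) = 0
  · have hwa : (w : H) = average π (w : H) := sub_eq_zero.mp hn0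
    rw [hwa]
    exact isFixed_average hπ _
  -- If `n ≠ 0`, the average of some translate of `n` spans the fixed vectors. Its Whittaker
  -- function is zero, hence so is that of the average of `w`, which is that of `w`: a
  -- contradiction.
  obtain ⟨g, hg⟩ := exists_average_span hπ hirr hsph hemb n.2 hn0
  obtain ⟨c, hc⟩ := hg (average π (w : H)) (isFixed_average hπ _)
  refine absurd (funext fun h => ?_) h0
  have h1 : whittakerFunction π Λ w h = whittakerFunction π Λ ⟨_, hsm w⟩ h := by
    rw [hav]; simp [hK]
  have h2 : (⟨_, hsm w⟩ : smoothVectors π) = c • ⟨_, hsm (smoothAct π g n)⟩ := Subtype.ext hc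
  have h3 : whittakerFunction π Λ (c • ⟨_, hsm (smoothAct π g n)⟩) h =
      c * whittakerFunction π Λ ⟨_, hsm (smoothAct π g n)⟩ h := by
    have : smoothAct π h (c • ⟨_, hsm (smoothAct π g n)⟩) =
        c • smoothAct π h ⟨_, hsm (smoothAct π g n)⟩ := by
      apply Subtype.ext; simp [smoothAct]
    rw [whittakerFunction, this, map_smul]; rfl
  rw [h1, h2, h3, hav]
  have h4 : ∀ k : MaxCompact 𝕜,
      whittakerFunction π Λ (smoothAct π g n) (h * ofCompact k) = 0 := fun k => by
    rw [whittakerFunction, hact]; exact hn _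
  simp [h4]

end Fixed

/-! ### Change of variables -/

section ChangeOfVariables

variable {E : Type*} [NormedAddCommGroup E] [NormedSpace ℝ E] [FiniteDimensional ℝ E]

/-- A similitude of ratio `r` maps the unit ball onto the ball of radius `r`; comparing volumes
gives the determinant for any norm, Euclidean or not. -/
lemma abs_det_of_norm_scale (L : E →L[ℝ] E) {r : ℝ} (hr : 0 < r) (h : ∀ v, ‖L v‖ = r * ‖v‖) :
    |L.det| = r ^ Module.finrank ℝ E := by
  rcases subsingleton_or_nontrivial E with hE | hE
  · simp [Module.finrank_zero_of_subsingleton, ContinuousLinearMap.det,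
      LinearMap.det_eq_one_of_subsingleton]
  borelize E
  let μ : Measure E := Measure.addHaar
  have hinj : Function.Injective L.toLinearMap := by
    rw [← LinearMap.ker_eq_bot, LinearMap.ker_eq_bot']
    intro v hv
    have := h v
    rw [show L v = 0 from hv, norm_zero] at this
    exact norm_eq_zero.mp ((mul_eq_zero.mp this.symm).resolve_left hr.ne')
  have hsurj := LinearMap.injective_iff_surjective.mp hinj
  have himg : L '' Metric.ball 0 1 = Metric.ball 0 r := by
    ext w
    constructor
    · rintro ⟨v, hv, rfl⟩
      rw [mem_ball_zero_iff] at hv ⊢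
      rw [h]
      exact mul_lt_of_lt_one_right hr hv
    · intro hw
      obtain ⟨v, rfl⟩ := hsurj w
      refine ⟨v, ?_, rfl⟩
      rw [mem_ball_zero_iff] at hw ⊢
      change ‖L v‖ < r at hw
      rw [h] at hw
      exact (mul_lt_iff_lt_one_right hr).mp hw
  have h1 := Measure.addHaar_image_continuousLinearMap μ L (Metric.ball 0 1)
  rw [himg, Measure.addHaar_ball μ 0 hr.le,
    ENNReal.mul_left_inj (Metric.measure_ball_pos μ 0 one_pos).ne' measure_ball_lt_top.ne,
    ENNReal.ofReal_eq_ofReal_iff (by positivity) (abs_nonneg _)] at h1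
  exact h1.symm

lemma measurePreserving_withDensity_of_det [MeasurableSpace E] [BorelSpace E] (m : Measure E)
    [m.IsAddHaarMeasure] {S : Set E} (hS : MeasurableSet S) (hS0 : m Sᶜ = 0) {τ : E → E}
    (hτ : Measurable τ) {τ' : E → E →L[ℝ] E} (hd : ∀ x ∈ S, HasFDerivAt τ (τ' x) x)
    (hinj : Set.InjOn τ S) (himg : τ '' S = S) {ρ : E → ℝ≥0∞} (hρ : Measurable ρ)
    (h : ∀ x ∈ S, ρ x = ENNReal.ofReal |(τ' x).det| * ρ (τ x)) :
    MeasurePreserving τ (m.withDensity ρ) (m.withDensity ρ) := by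
  have hr : m.restrict S = m := Measure.restrict_eq_self_of_ae_mem
    (by rwa [ae_iff])
  refine ⟨hτ, Measure.ext_of_lintegral _ fun f hf => ?_⟩
  rw [lintegral_map hf hτ, ← Function.comp_def,
    lintegral_withDensity_eq_lintegral_mul _ hρ (hf.comp hτ), lintegral_withDensity_eq_lintegral_mul _ hρ hf]
  have := lintegral_image_eq_lintegral_abs_det_fderiv_mul m hS
    (fun x hx => (hd x hx).hasFDerivWithinAt) hinj (ρ * f)
  rw [himg] at this
  conv_rhs => rw [← hr, this]
  conv_lhs => rw [← hr]
  refine setLIntegral_congr_fun hS fun x hx => ?_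
  simp only [Pi.mul_apply, h x hx, Function.comp_apply, mul_assoc]

end ChangeOfVariables

/-! ### Measures on the multiplicative group -/

section Measures

variable {𝕜 : Type*} [RCLike 𝕜]

lemma deg_pos : 0 < deg 𝕜 := Module.finrank_pos

instance : SecondCountableTopology 𝕜ˣ := Units.isEmbedding_val₀.secondCountableTopology

lemma nabs_nonneg (x : 𝕜) : 0 ≤ nabs x := pow_nonneg (norm_nonneg _) _

lemma continuous_nabs : Continuous (nabs : 𝕜 → ℝ) := by
  unfold nabs; fun_prop

lemma finrank_plane : Module.finrank ℝ (𝕜 × 𝕜) = 2 * deg 𝕜 := by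
  rw [Module.finrank_prod, deg, two_mul]

/-- Inversion in the plane `𝕜 × 𝕜` with its Euclidean structure. -/
def planeInversion (q : 𝕜 × 𝕜) : 𝕜 × 𝕜 := (‖q.1‖ ^ 2 + ‖q.2‖ ^ 2)⁻¹ • q

/-- The derivative of a Euclidean inversion is known, but only in an inner product space; `WithLp 2`
supplies that structure in place of the sup norm on the product. -/
lemma planeInversion_eq (q : 𝕜 × 𝕜) : planeInversion q = WithLp.ofLp
    (EuclideanGeometry.inversion (0 : WithLp 2 (𝕜 × 𝕜)) 1 (WithLp.toLp 2 q)) := by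
  have : dist (WithLp.toLp 2 q) 0 ^ 2 = ‖q.1‖ ^ 2 + ‖q.2‖ ^ 2 := by
    rw [dist_zero_right, WithLp.prod_norm_sq_eq_of_L2]; rfl
  rw [planeInversion, EuclideanGeometry.inversion, div_pow, this]
  simp

variable [MeasurableSpace 𝕜] [BorelSpace 𝕜]

instance : BorelSpace 𝕜ˣ :=
  ⟨(Units.isEmbedding_val₀ (G₀ := 𝕜)).isInducing.eq_induced ▸ by
    rw [borel_comap, ← BorelSpace.measurable_eq (α := 𝕜)]; rfl⟩

lemma measurableEmbedding_val : MeasurableEmbedding (Units.val : 𝕜ˣ → 𝕜) :=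
  (Units.isOpenEmbedding_val (R := 𝕜)).measurableEmbedding

instance : (addMeasure 𝕜).IsAddHaarMeasure :=
  Measure.IsAddHaarMeasure.smul _ (by exact_mod_cast deg_pos.ne') (by simp)

lemma map_val_mulMeasure : (mulMeasure 𝕜).map Units.val =
    (addMeasure 𝕜).withDensity fun x => ENNReal.ofReal (nabs x)⁻¹ := by
  have hrange : Set.range (Units.val : 𝕜ˣ → 𝕜) = {0}ᶜ := by
    ext x
    simp only [Set.mem_range, Set.mem_compl_iff, Set.mem_singleton_iff]
    exact ⟨fun ⟨u, hu⟩ => hu ▸ u.ne_zero, fun hx => ⟨Units.mk0 x hx, rfl⟩⟩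
  rw [mulMeasure, measurableEmbedding_val.map_comap, hrange]
  refine Measure.restrict_eq_self_of_ae_mem ?_
  have h : ∀ᵐ x ∂(addMeasure 𝕜), x ∈ ({0}ᶜ : Set 𝕜) := by
    rw [ae_iff]
    simp
  exact (withDensity_absolutelyContinuous _ _).ae_le h

instance : SigmaFinite (mulMeasure 𝕜) := by
  refine SigmaFinite.of_map _ measurableEmbedding_val.measurable.aemeasurable ?_
  rw [map_val_mulMeasure]
  infer_instance

variable (𝕜) in
/-- The first two factors of the measure on the space of Iwasawa coordinates. -/
def planeMeasure : Measure (𝕜ˣ × 𝕜) :=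
  ((mulMeasure 𝕜).withDensity fun y => ENNReal.ofReal (nabs (y : 𝕜))⁻¹).prod (addMeasure 𝕜)

instance : SFinite (planeMeasure 𝕜) := by unfold planeMeasure; infer_instance

/-- The density of the invariant measure on the affine plane. -/
def planeDensity (q : 𝕜 × 𝕜) : ℝ≥0∞ := ENNReal.ofReal ((nabs q.1)⁻¹ ^ 2)

lemma measurable_planeDensity : Measurable (planeDensity : 𝕜 × 𝕜 → ℝ≥0∞) :=
  (((continuous_nabs.measurable.comp measurable_fst).inv).pow_const 2).ennreal_ofReal

/-- One factor 1/|y| comes from dy^× and the other from the weight in the Iwasawa measure, giving dy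
dx/|y|². -/
lemma map_planeMeasure : (planeMeasure 𝕜).map (Prod.map Units.val id) =
    ((addMeasure 𝕜).prod (addMeasure 𝕜)).withDensity planeDensity := by
  have hm : Measurable fun x : 𝕜 => ENNReal.ofReal (nabs x)⁻¹ :=
    continuous_nabs.measurable.inv.ennreal_ofReal
  have hm2 : Measurable fun x : 𝕜 => ENNReal.ofReal ((nabs x)⁻¹ ^ 2) :=
    (continuous_nabs.measurable.inv.pow_const 2).ennreal_ofReal
  have h1 : ((mulMeasure 𝕜).withDensity fun y => ENNReal.ofReal (nabs (y : 𝕜))⁻¹).map Units.val =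
      (addMeasure 𝕜).withDensity fun x => ENNReal.ofReal ((nabs x)⁻¹ ^ 2) := by
    refine Measure.ext_of_lintegral _ fun f hf => ?_
    rw [lintegral_map hf measurableEmbedding_val.measurable]
    refine (lintegral_withDensity_eq_lintegral_mul _
        (hm.comp measurableEmbedding_val.measurable)
        (hf.comp measurableEmbedding_val.measurable)).trans ?_
    have h2 := lintegral_map (μ := mulMeasure 𝕜) (hm.mul hf) measurableEmbedding_val.measurable
    refine h2.symm.trans ?_
    rw [map_val_mulMeasure, lintegral_withDensity_eq_lintegral_mul _ hm (hm.mul hf),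
      lintegral_withDensity_eq_lintegral_mul _ hm2 hf]
    congr 1 with x
    simp only [Pi.mul_apply]
    rw [← mul_assoc, ← ENNReal.ofReal_mul (inv_nonneg.mpr (nabs_nonneg x)), sq]
  rw [planeMeasure, ← Measure.map_prod_map _ _ measurableEmbedding_val.measurable measurable_id, h1,
    Measure.map_id]
  exact prod_withDensity_left hm2

lemma measurePreserving_plane {τ : 𝕜ˣ × 𝕜 → 𝕜ˣ × 𝕜} (hτ : Measurable τ) {τ' : 𝕜 × 𝕜 → 𝕜 × 𝕜}
    (h : ∀ q, Prod.map Units.val id (τ q) = τ' (Prod.map Units.val id q))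
    (hτ' : MeasurePreserving τ' (((addMeasure 𝕜).prod (addMeasure 𝕜)).withDensity planeDensity)
      (((addMeasure 𝕜).prod (addMeasure 𝕜)).withDensity planeDensity)) :
    MeasurePreserving τ (planeMeasure 𝕜) (planeMeasure 𝕜) := by
  have he : MeasurableEmbedding (Prod.map Units.val id : 𝕜ˣ × 𝕜 → 𝕜 × 𝕜) :=
    measurableEmbedding_val.prodMap MeasurableEmbedding.id
  refine ⟨hτ, ?_⟩
  rw [← he.comap_map (Measure.map τ (planeMeasure 𝕜)), Measure.map_map he.measurable hτ,
    show Prod.map Units.val id ∘ τ = τ' ∘ Prod.map Units.val id from funext h,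
    ← Measure.map_map hτ'.measurable he.measurable, map_planeMeasure, hτ'.map_eq,
    ← map_planeMeasure, he.comap_map]

lemma measurableSet_plane : MeasurableSet {q : 𝕜 × 𝕜 | q.1 ≠ 0} :=
  measurable_fst (measurableSet_singleton 0).compl

lemma null_plane_compl : ((addMeasure 𝕜).prod (addMeasure 𝕜)) {q : 𝕜 × 𝕜 | q.1 ≠ 0}ᶜ = 0 := by
  have : {q : 𝕜 × 𝕜 | q.1 ≠ 0}ᶜ = {0} ×ˢ Set.univ := by
    ext q; simp
  rw [this, Measure.prod_prod, measure_singleton, zero_mul]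

/-- The Jacobian |c|² on the plane cancels against the change of |y|⁻² under y ↦ cy. -/
lemma measurePreserving_affine (c : 𝕜ˣ) (d : 𝕜) :
    MeasurePreserving (fun q : 𝕜ˣ × 𝕜 => (c * q.1, (c : 𝕜) * q.2 + d))
      (planeMeasure 𝕜) (planeMeasure 𝕜) := by
  have hc0 : (c : 𝕜) ≠ 0 := c.ne_zero
  have hmeas : Measurable fun q : 𝕜ˣ × 𝕜 => (c * q.1, (c : 𝕜) * q.2 + d) := by
    refine Continuous.measurable ?_
    fun_prop
  let L : 𝕜 × 𝕜 →L[ℝ] 𝕜 × 𝕜 := (c : 𝕜) • ContinuousLinearMap.id ℝ (𝕜 × 𝕜)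
  have hL : |L.det| = ‖(c : 𝕜)‖ ^ (2 * deg 𝕜) := by
    rw [abs_det_of_norm_scale L (norm_pos_iff.mpr hc0), finrank_plane]
    intro v
    simp [L, norm_smul]
  refine measurePreserving_plane hmeas (τ' := fun q => L q + (0, d)) ?_ ?_
  · intro q; ext <;> simp [L]
  refine measurePreserving_withDensity_of_det _ measurableSet_plane null_plane_compl
    (by fun_prop) (τ' := fun _ => L) (fun x _ => L.hasFDerivAt.add_const _) ?_ ?_
    measurable_planeDensity ?_
  · intro p _ q _ hpq
    have := add_right_cancel hpq
    exact smul_right_injective _ hc0 this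
  · ext q
    constructor
    · rintro ⟨p, hp, rfl⟩
      simpa [L, hc0] using hp
    · intro hq
      refine ⟨((c : 𝕜)⁻¹ * q.1, (c : 𝕜)⁻¹ * (q.2 - d)), ?_, ?_⟩
      · simpa [hc0] using hq
      · ext <;> simp [L, hc0]
  · intro q hq
    have hq0 : ‖q.1‖ ≠ 0 := norm_ne_zero_iff.mpr hq
    have hc0' : ‖(c : 𝕜)‖ ≠ 0 := norm_ne_zero_iff.mpr hc0
    rw [hL, planeDensity, planeDensity, ← ENNReal.ofReal_mul (by positivity)]
    congr 1
    simp only [L, nabs, _root_.smul_apply, ContinuousLinearMap.id_apply,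
      Prod.fst_add, Prod.smul_fst, smul_eq_mul, add_zero, norm_mul]
    field_simp
    ring

/-- With D = ‖y‖² + ‖x‖² and n the degree, the derivative is D⁻¹ times a reflection, so its Jacobian
is D^(-2n). The density at the image is D^(2n)|y|⁻², and the two powers cancel. -/
lemma measurePreserving_planeInversion : MeasurePreserving (planeInversion : 𝕜 × 𝕜 → 𝕜 × 𝕜)
    (((addMeasure 𝕜).prod (addMeasure 𝕜)).withDensity planeDensity)
    (((addMeasure 𝕜).prod (addMeasure 𝕜)).withDensity planeDensity) := by
  let e := WithLp.prodContinuousLinearEquiv 2 ℝ 𝕜 𝕜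
  let L : 𝕜 × 𝕜 → WithLp 2 (𝕜 × 𝕜) →L[ℝ] WithLp 2 (𝕜 × 𝕜) := fun q =>
    (1 / dist (WithLp.toLp 2 q) 0) ^ 2 •
      ((ℝ ∙ (WithLp.toLp 2 q - 0))ᗮ.reflection : WithLp 2 (𝕜 × 𝕜) →L[ℝ] WithLp 2 (𝕜 × 𝕜))
  have hdist : ∀ q : 𝕜 × 𝕜, dist (WithLp.toLp 2 q) 0 ^ 2 = ‖q.1‖ ^ 2 + ‖q.2‖ ^ 2 := fun q => by
    rw [dist_zero_right, WithLp.prod_norm_sq_eq_of_L2]; rfl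
  have hinvol : ∀ q : 𝕜 × 𝕜, planeInversion (planeInversion q) = q := fun q => by
    rw [planeInversion_eq, planeInversion_eq, WithLp.toLp_ofLp,
      EuclideanGeometry.inversion_inversion _ one_ne_zero]
  have hmaps : ∀ q ∈ {q : 𝕜 × 𝕜 | q.1 ≠ 0}, planeInversion q ∈ {q : 𝕜 × 𝕜 | q.1 ≠ 0} := by
    intro q hq
    have hq0 : 0 < ‖q.1‖ := norm_pos_iff.mpr hq
    exact smul_ne_zero (by positivity) hq
  refine measurePreserving_withDensity_of_det _ measurableSet_plane null_plane_compl ?_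
    (τ' := fun q => (e : WithLp 2 (𝕜 × 𝕜) →L[ℝ] 𝕜 × 𝕜) ∘L L q ∘L
      (e.symm : 𝕜 × 𝕜 →L[ℝ] WithLp 2 (𝕜 × 𝕜))) ?_ ?_ ?_ measurable_planeDensity ?_
  · unfold planeInversion; fun_prop
  · intro q hq
    have hq' : WithLp.toLp 2 q ≠ 0 := fun h => hq (by
      have := congrArg (fun v : WithLp 2 (𝕜 × 𝕜) => v.fst) h
      exact this)
    have h1 := EuclideanGeometry.hasFDerivAt_inversion (R := 1) hq'
    have h2 : planeInversion = fun q : 𝕜 × 𝕜 =>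
        e (EuclideanGeometry.inversion (0 : WithLp 2 (𝕜 × 𝕜)) 1 (e.symm q)) :=
      funext fun q => planeInversion_eq q
    rw [h2]
    exact e.hasFDerivAt.comp q (h1.comp q e.symm.hasFDerivAt)
  · exact fun p _ q _ h => by rw [← hinvol p, h, hinvol]
  · exact Set.Subset.antisymm (Set.image_subset_iff.mpr hmaps)
      fun q hq => ⟨planeInversion q, hmaps q hq, hinvol q⟩
  · intro q hq
    have hq0 : 0 < ‖q.1‖ := norm_pos_iff.mpr hq
    have hD : 0 < ‖q.1‖ ^ 2 + ‖q.2‖ ^ 2 := by positivity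
    have hdet : |((e : WithLp 2 (𝕜 × 𝕜) →L[ℝ] 𝕜 × 𝕜) ∘L L q ∘L
      (e.symm : 𝕜 × 𝕜 →L[ℝ] WithLp 2 (𝕜 × 𝕜))).det| =
        ((‖q.1‖ ^ 2 + ‖q.2‖ ^ 2)⁻¹) ^ (2 * deg 𝕜) := by
      have h1 : ((e : WithLp 2 (𝕜 × 𝕜) →L[ℝ] 𝕜 × 𝕜) ∘L L q ∘L
          (e.symm : 𝕜 × 𝕜 →L[ℝ] WithLp 2 (𝕜 × 𝕜))).det = (L q).det :=
        LinearMap.det_conj (L q).toLinearMap e.toLinearEquiv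
      rw [h1, abs_det_of_norm_scale (L q) (inv_pos.mpr hD), ← finrank_plane]
      · rw [(WithLp.linearEquiv 2 ℝ (𝕜 × 𝕜)).finrank_eq]
      · intro v
        simp only [L, _root_.smul_apply, norm_smul]
        congr 1
        · rw [div_pow, hdist, one_pow, one_div, Real.norm_of_nonneg (inv_nonneg.mpr hD.le)]
        · exact LinearIsometryEquiv.norm_map _ v
    rw [hdet, planeDensity, planeDensity, ← ENNReal.ofReal_mul (by positivity)]
    congr 1
    simp only [planeInversion, nabs, Prod.smul_fst, norm_smul, norm_inv,
      Real.norm_of_nonneg hD.le]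
    rw [inv_pow, mul_pow, mul_inv, mul_comm 2, pow_mul]
    have : ((‖q.1‖ ^ 2 + ‖q.2‖ ^ 2)⁻¹ ^ deg 𝕜) ≠ 0 := by positivity
    generalize (‖q.1‖ ^ 2 + ‖q.2‖ ^ 2)⁻¹ ^ deg 𝕜 = a at this
    field_simp

end Measures

/-! ### Left invariance in Iwasawa coordinates -/

section Invariance

variable {𝕜 : Type*} [RCLike 𝕜]

open scoped ComplexConjugate

lemma nabs_rpow (y : 𝕜) (s : ℝ) : nabs y ^ (s / (2 * (deg 𝕜 : ℝ))) = √‖y‖ ^ s := by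
  have hd : (deg 𝕜 : ℝ) ≠ 0 := by exact_mod_cast deg_pos.ne'
  rw [nabs, ← Real.rpow_natCast, ← Real.rpow_mul (norm_nonneg _), Real.sqrt_eq_rpow,
    ← Real.rpow_mul (norm_nonneg _)]
  congr 1
  field_simp

lemma sqrt_norm_pos (y : 𝕜ˣ) : 0 < √‖(y : 𝕜)‖ := Real.sqrt_pos.mpr (norm_pos_iff.mpr y.ne_zero)

lemma radius_eq (m : 𝕜ˣ) : radius m = √‖(m : 𝕜)‖ := by
  rw [radius, nabs_rpow, Real.rpow_one]

lemma coe_realScalar (r : ℝ) (hr : 0 < r) :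
    ((realScalar r hr : GL (Fin 2) 𝕜) : Matrix (Fin 2) (Fin 2) 𝕜) = (r : 𝕜) • 1 := by
  rw [realScalar, coe_upper]
  ext i j
  fin_cases i <;> fin_cases j <;> simp

lemma coe_iwasawaPoint (p : 𝕜ˣ × 𝕜 × MaxCompact 𝕜) :
    ((iwasawaPoint p : GL (Fin 2) 𝕜) : Matrix (Fin 2) (Fin 2) 𝕜) =
      (((√‖(p.1 : 𝕜)‖)⁻¹ : ℝ) : 𝕜) • (!![(p.1 : 𝕜), p.2.1; 0, 1] * p.2.2.1) := by
  rw [iwasawaPoint, Units.val_mul, Units.val_mul, coe_realScalar, coe_upper, coe_ofCompact,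
    ← neg_div, nabs_rpow, Real.rpow_neg_one]
  simp only [Units.val_one, smul_mul_assoc, one_mul]

lemma continuous_iwasawaPoint : Continuous (iwasawaPoint : 𝕜ˣ × 𝕜 × MaxCompact 𝕜 → _) := by
  have hsq : Continuous fun p : 𝕜ˣ × 𝕜 × MaxCompact 𝕜 => √‖(p.1 : 𝕜)‖ :=
    (Units.continuous_val.comp continuous_fst).norm.sqrt
  have hval : Continuous fun p : 𝕜ˣ × 𝕜 × MaxCompact 𝕜 => (iwasawaPoint p).1 := by
    simp only [coe_iwasawaPoint]
    have h1 : Continuous fun p : 𝕜ˣ × 𝕜 × MaxCompact 𝕜 => (((√‖(p.1 : 𝕜)‖)⁻¹ : ℝ) : 𝕜) :=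
      RCLike.continuous_ofReal.comp (hsq.inv₀ fun p => (sqrt_norm_pos p.1).ne')
    have h2 : Continuous fun p : 𝕜ˣ × 𝕜 × MaxCompact 𝕜 => !![(p.1 : 𝕜), p.2.1; 0, 1] := by
      refine continuous_matrix fun i j => ?_
      fin_cases i <;> fin_cases j <;> simp <;> fun_prop
    have h3 : Continuous fun p : 𝕜ˣ × 𝕜 × MaxCompact 𝕜 => p.2.2.1 := by fun_prop
    exact h1.smul (h2.mul h3)
  rw [Units.continuous_iff]
  refine ⟨hval, ?_⟩
  have hdet : ∀ p : 𝕜ˣ × 𝕜 × MaxCompact 𝕜, (iwasawaPoint p).1.det ≠ 0 := fun p =>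
    ((Matrix.isUnit_iff_isUnit_det _).mp (iwasawaPoint p).isUnit).ne_zero
  have : (fun p : 𝕜ˣ × 𝕜 × MaxCompact 𝕜 => ((iwasawaPoint p)⁻¹ : GL (Fin 2) 𝕜).1) =
      fun p => ((iwasawaPoint p).1.det)⁻¹ • (iwasawaPoint p).1.adjugate := by
    funext p
    rw [Matrix.coe_units_inv, Matrix.inv_def, Ring.inverse_eq_inv']
  rw [this]
  exact (hval.matrix_det.inv₀ hdet).smul hval.matrix_adjugate

lemma norm_det_compact (k : MaxCompact 𝕜) : ‖k.1.det‖ = 1 :=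
  CStarRing.norm_of_mem_unitary (Matrix.det_of_mem_unitary k.2)

lemma norm_det_iwasawaPoint (p : 𝕜ˣ × 𝕜 × MaxCompact 𝕜) : ‖(iwasawaPoint p).1.det‖ = 1 := by
  have hp := sqrt_norm_pos p.1
  rw [coe_iwasawaPoint, Matrix.det_smul, Matrix.det_mul, norm_mul, norm_mul, norm_det_compact,
    Matrix.det_fin_two_of, norm_pow, RCLike.norm_ofReal, abs_of_pos (inv_pos.mpr hp), inv_pow]
  simp only [Fintype.card_fin, Real.sq_sqrt (norm_nonneg _), mul_one, mul_zero, sub_zero]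
  exact inv_mul_cancel₀ (norm_ne_zero_iff.mpr p.1.ne_zero)

variable [MeasurableSpace 𝕜] [BorelSpace 𝕜]

/-- Left translation by `g` acts on Iwasawa coordinates, up to a scalar, through a transformation
that preserves the measure. -/
def PreservesIwasawa (g : GL (Fin 2) 𝕜) : Prop :=
  ∃ σ : 𝕜ˣ × 𝕜 × MaxCompact 𝕜 → 𝕜ˣ × 𝕜 × MaxCompact 𝕜,
    MeasurePreserving σ (iwasawaMeasure 𝕜) (iwasawaMeasure 𝕜) ∧
    ∃ (ρ : ℝ) (hρ : 0 < ρ), ∀ p, g * iwasawaPoint p = realScalar ρ hρ * iwasawaPoint (σ p)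

/-- Positive real scalars are central, so the two scaling factors simply multiply; it then suffices
to treat generators. -/
lemma PreservesIwasawa.mul {g h : GL (Fin 2) 𝕜} (hg : PreservesIwasawa g)
    (hh : PreservesIwasawa h) : PreservesIwasawa (g * h) := by
  obtain ⟨σ, hσ, ρ, hρ, h1⟩ := hg
  obtain ⟨σ', hσ', ρ', hρ', h2⟩ := hh
  refine ⟨σ ∘ σ', hσ.comp hσ', ρ' * ρ, mul_pos hρ' hρ, fun p => ?_⟩
  have hcomm : g * realScalar ρ' hρ' = realScalar ρ' hρ' * g := by
    ext1; simp [coe_realScalar]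
  have hmul : (realScalar (ρ' * ρ) (mul_pos hρ' hρ) : GL (Fin 2) 𝕜) =
      realScalar ρ' hρ' * realScalar ρ hρ := by
    ext1; simp [coe_realScalar, mul_smul, smul_comm ρ]
  rw [mul_assoc, h2, ← mul_assoc, hcomm, mul_assoc, h1, hmul, mul_assoc, Function.comp_apply]

/-- In coordinates, left translation is a skew product: `τ` acts on the plane, and over each point
`q` the compact coordinate is multiplied on the left by `κ q`, which preserves Haar measure. The
square roots compensate the normalizations |det| = 1 before and after the move. -/
lemma preservesIwasawa_of_plane {g : GL (Fin 2) 𝕜} {τ : 𝕜ˣ × 𝕜 → 𝕜ˣ × 𝕜}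
    (hτ : MeasurePreserving τ (planeMeasure 𝕜) (planeMeasure 𝕜)) {κ : 𝕜ˣ × 𝕜 → MaxCompact 𝕜}
    (hκ : Measurable κ) {ρ : ℝ} (hρ : 0 < ρ)
    (h : ∀ q, g.1 * !![(q.1 : 𝕜), q.2; 0, 1] =
      ((ρ * √‖(q.1 : 𝕜)‖ * (√‖((τ q).1 : 𝕜)‖)⁻¹ : ℝ) : 𝕜) •
        (!![((τ q).1 : 𝕜), (τ q).2; 0, 1] * (κ q).1)) : PreservesIwasawa g := by
  have hsk : MeasurePreserving (fun p : (𝕜ˣ × 𝕜) × MaxCompact 𝕜 => (τ p.1, κ p.1 * p.2))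
      ((planeMeasure 𝕜).prod (compactMeasure 𝕜)) ((planeMeasure 𝕜).prod (compactMeasure 𝕜)) :=
    hτ.skew_product (g := fun q k => κ q * k)
      ((hκ.comp measurable_fst).mul measurable_snd)
      (.of_forall fun q => map_mul_left_eq_self _ (κ q))
  have hassoc : MeasurePreserving MeasurableEquiv.prodAssoc
      ((planeMeasure 𝕜).prod (compactMeasure 𝕜)) (iwasawaMeasure 𝕜) :=
    measurePreserving_prodAssoc _ _ _
  refine ⟨_, (hassoc.comp hsk).comp (hassoc.symm _), ρ, hρ, fun p => ?_⟩
  ext1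
  have hq := h (p.1, p.2.1)
  have hpos := (sqrt_norm_pos p.1).ne'
  rw [Units.val_mul, Units.val_mul, coe_iwasawaPoint, coe_iwasawaPoint, coe_realScalar,
    mul_smul_comm, ← mul_assoc, hq, smul_mul_assoc, smul_smul, smul_one_mul, smul_smul]
  simp only [MeasurableEquiv.prodAssoc, Function.comp_apply, mul_assoc]
  congr 1
  push_cast
  have : ((√‖(p.1 : 𝕜)‖ : ℝ) : 𝕜) ≠ 0 := by exact_mod_cast hpos
  field_simp
  rfl

/-- Dividing out the lower right entry `b` leaves an affine map of the plane; the phase of `b` is a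
unitary scalar absorbed by K, and its norm goes into the scaling. -/
lemma preservesIwasawa_upper (a b : 𝕜ˣ) (x : 𝕜) : PreservesIwasawa (upper a b x) := by
  have hb : 0 < ‖(b : 𝕜)‖ := norm_pos_iff.mpr b.ne_zero
  have hb' : ((‖(b : 𝕜)‖ : ℝ) : 𝕜) ≠ 0 := by exact_mod_cast hb.ne'
  have hu : ((b : 𝕜) / (‖(b : 𝕜)‖ : ℝ)) * conj ((b : 𝕜) / (‖(b : 𝕜)‖ : ℝ)) = 1 := by
    rw [RCLike.mul_conj, norm_div, RCLike.norm_ofReal, abs_of_pos hb, div_self hb.ne']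
    simp
  let k : MaxCompact 𝕜 := ⟨((b : 𝕜) / (‖(b : 𝕜)‖ : ℝ)) • 1, by
    rw [Matrix.mem_unitaryGroup_iff, star_smul, star_one, smul_mul_smul_comm, mul_one]
    change (_ * conj _ : 𝕜) • _ = _
    rw [hu, one_smul]⟩
  refine preservesIwasawa_of_plane (measurePreserving_affine (a * b⁻¹) ((b : 𝕜)⁻¹ * x))
    (κ := fun _ => k) measurable_const (ρ := √‖(a : 𝕜)‖ * √‖(b : 𝕜)‖)
    (mul_pos (sqrt_norm_pos a) (sqrt_norm_pos b)) fun q => ?_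
  have hscal : √‖(a : 𝕜)‖ * √‖(b : 𝕜)‖ * √‖(q.1 : 𝕜)‖ *
      (√‖((a * b⁻¹ * q.1 : 𝕜ˣ) : 𝕜)‖)⁻¹ = ‖(b : 𝕜)‖ := by
    have ha := (sqrt_norm_pos a).ne'
    have hb := (sqrt_norm_pos b).ne'
    have hq := (sqrt_norm_pos q.1).ne'
    simp only [Units.val_mul, Units.val_inv_eq_inv_val, norm_mul, norm_inv,
      Real.sqrt_mul (mul_nonneg (norm_nonneg (a : 𝕜)) (inv_nonneg.mpr (norm_nonneg (b : 𝕜)))),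
      Real.sqrt_mul (norm_nonneg (a : 𝕜)), Real.sqrt_inv]
    field_simp
    exact Real.sq_sqrt (norm_nonneg _)
  simp only
  rw [hscal]
  simp only [coe_upper, k, Algebra.mul_smul_comm, mul_one, smul_smul,
    mul_div_cancel₀ _ hb', Units.val_mul, Units.val_inv_eq_inv_val]
  ext i j
  fin_cases i <;> fin_cases j <;> simp <;> field_simp

/-- The product of the Weyl element and (y x; 0 1) has bottom row (y, x), so its Iwasawa
decomposition is √D (y/D, -x̄/D; 0, 1) times a rotation, where D = ‖y‖² + ‖x‖². The plane thus moves
by the inversion followed by x ↦ -x̄. -/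
lemma preservesIwasawa_weyl :
    PreservesIwasawa (ofCompact (rotation (1 : 𝕜) 0 (by simp))) := by
  let D : 𝕜ˣ × 𝕜 → ℝ := fun q => ‖(q.1 : 𝕜)‖ ^ 2 + ‖q.2‖ ^ 2
  have hD : ∀ q, 0 < D q := fun q => by
    have : 0 < ‖(q.1 : 𝕜)‖ := norm_pos_iff.mpr q.1.ne_zero
    positivity
  have hDc : Continuous D :=
    ((Units.continuous_val.comp continuous_fst).norm.pow 2).add (continuous_snd.norm.pow 2)
  have hD0 : ∀ q, ((D q : ℝ) : 𝕜) ≠ 0 := fun q => by exact_mod_cast (hD q).ne'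
  let d : 𝕜ˣ × 𝕜 → 𝕜ˣ := fun q => Units.mk0 ((D q : ℝ) : 𝕜) (hD0 q)
  have hdc : Continuous d := by
    rw [Units.isEmbedding_val₀.continuous_iff]
    exact RCLike.continuous_ofReal.comp hDc
  let ι : 𝕜ˣ × 𝕜 → 𝕜ˣ × 𝕜 := fun q => ((d q)⁻¹ * q.1, ((D q : ℝ) : 𝕜)⁻¹ * q.2)
  have hι : MeasurePreserving ι (planeMeasure 𝕜) (planeMeasure 𝕜) := by
    refine measurePreserving_plane ?_ (fun q => ?_) measurePreserving_planeInversion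
    · have : Continuous fun q => ((D q : ℝ) : 𝕜)⁻¹ :=
        (RCLike.continuous_ofReal.comp hDc).inv₀ hD0
      exact ((hdc.inv.mul continuous_fst).prodMk (this.mul continuous_snd)).measurable
    · ext <;> simp [ι, d, planeInversion, RCLike.real_smul_eq_coe_mul, D]
  have hconj : MeasurePreserving (fun q : 𝕜ˣ × 𝕜 => (q.1, -conj q.2))
      (planeMeasure 𝕜) (planeMeasure 𝕜) := by
    have h1 : MeasurePreserving (fun x : 𝕜 => -conj x) (addMeasure 𝕜) (addMeasure 𝕜) := by
      have h2 : MeasurePreserving (fun x : 𝕜 => -conj x) volume volume :=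
        ((RCLike.conjLIE (K := 𝕜)).trans (LinearIsometryEquiv.neg ℝ)).measurePreserving
      exact h2.smul_measure _
    exact (MeasurePreserving.id _).prod h1
  have hsq : ∀ q, 0 < √(D q) := fun q => Real.sqrt_pos.mpr (hD q)
  have hnorm : ∀ q : 𝕜ˣ × 𝕜, ‖(q.1 : 𝕜) / ((√(D q) : ℝ) : 𝕜)‖ ^ 2 +
      ‖q.2 / ((√(D q) : ℝ) : 𝕜)‖ ^ 2 = 1 := fun q => by
    rw [norm_div, norm_div, RCLike.norm_ofReal, abs_of_pos (hsq q), div_pow, div_pow, ← add_div,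
      Real.sq_sqrt (hD q).le, div_self (hD q).ne']
  have hsqc : Continuous fun q => ((√(D q) : ℝ) : 𝕜) :=
    RCLike.continuous_ofReal.comp hDc.sqrt
  have hsq0 : ∀ q, ((√(D q) : ℝ) : 𝕜) ≠ 0 := fun q => by exact_mod_cast (hsq q).ne'
  refine preservesIwasawa_of_plane (hconj.comp hι) (κ := fun q => rotation _ _ (hnorm q)) ?_
    one_pos fun q => ?_
  · refine Continuous.measurable (Continuous.subtype_mk ?_ _)
    have h1 : Continuous fun q : 𝕜ˣ × 𝕜 => (q.1 : 𝕜) / ((√(D q) : ℝ) : 𝕜) :=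
      (Units.continuous_val.comp continuous_fst).div hsqc hsq0
    have h2 : Continuous fun q : 𝕜ˣ × 𝕜 => q.2 / ((√(D q) : ℝ) : 𝕜) :=
      continuous_snd.div hsqc hsq0
    refine continuous_matrix fun i j => ?_
    fin_cases i <;> fin_cases j <;> simp only [Fin.zero_eta, Fin.mk_one]
    · exact RCLike.continuous_conj.comp h2
    · exact (RCLike.continuous_conj.comp h1).neg
    · exact h1
    · exact h2
  have hscal : 1 * √‖(q.1 : 𝕜)‖ * (√‖((((d q)⁻¹ * q.1 : 𝕜ˣ)) : 𝕜)‖)⁻¹ = √(D q) := by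
    have hq := (sqrt_norm_pos q.1).ne'
    simp only [d, Units.val_mul, Units.val_inv_eq_inv_val, Units.val_mk0, norm_mul, norm_inv,
      RCLike.norm_ofReal, abs_of_pos (hD q)]
    rw [Real.sqrt_mul (inv_nonneg.mpr (hD q).le), Real.sqrt_inv]
    field_simp
  have hDD : ((D q : ℝ) : 𝕜) = (q.1 : 𝕜) * conj (q.1 : 𝕜) + q.2 * conj q.2 := by
    rw [RCLike.mul_conj, RCLike.mul_conj]; simp [D]
  have hDs : ((D q : ℝ) : 𝕜) = ((√(D q) : ℝ) : 𝕜) ^ 2 := by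
    exact_mod_cast (Real.sq_sqrt (hD q).le).symm
  simp only [Function.comp_apply, ι, hscal]
  have hs := hsq0 q
  rw [hDs] at hDD
  simp only [d, Units.val_mul, Units.val_inv_eq_inv_val, Units.val_mk0, hDs, coe_ofCompact,
    rotation]
  have hcs : conj ((√(D q) : ℝ) : 𝕜) = ((√(D q) : ℝ) : 𝕜) := RCLike.conj_ofReal _
  generalize ((√(D q) : ℝ) : 𝕜) = s at hs hDD hcs
  ext i j
  fin_cases i <;> fin_cases j <;> simp [hcs] <;> field_simp
  · simp
  · linear_combination (-1) * hDD

/-- By Bruhat, `g` is either upper triangular or a product of the Weyl element with upper triangular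
matrices on both sides. -/
lemma preservesIwasawa (g : GL (Fin 2) 𝕜) : PreservesIwasawa g := by
  set α := g.1 0 0
  set β := g.1 0 1
  set c := g.1 1 0
  set d := g.1 1 1
  have hdet : α * d - β * c ≠ 0 := by
    have := ((Matrix.isUnit_iff_isUnit_det _).mp g.isUnit).ne_zero
    rwa [Matrix.det_fin_two] at this
  by_cases hc : c = 0
  · have hα : α ≠ 0 := fun h => hdet (by simp [hc, h])
    have hd : d ≠ 0 := fun h => hdet (by simp [hc, h])
    have : g = upper (Units.mk0 α hα) (Units.mk0 d hd) β := by
      ext1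
      rw [Matrix.eta_fin_two g.1, coe_upper, ← hc]
      rfl
    rw [this]
    exact preservesIwasawa_upper _ _ _
  · let e : 𝕜ˣ := Units.mk0 ((α * d - β * c) / c) (div_ne_zero hdet hc)
    let γ : 𝕜ˣ := Units.mk0 c hc
    have : g = upper e 1 (α / c) * ofCompact (rotation (1 : 𝕜) 0 (by simp)) * upper γ 1 d := by
      ext1
      rw [Matrix.eta_fin_two g.1, Units.val_mul, Units.val_mul, coe_upper, coe_upper,
        coe_ofCompact]
      change !![α, β; c, d] = !![(α * d - β * c) / c, α / c; 0, 1] *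
        !![conj (0 : 𝕜), -conj (1 : 𝕜); 1, 0] * !![c, d; 0, 1]
      rw [Matrix.mul_fin_two, Matrix.mul_fin_two]
      ext i j
      fin_cases i <;> fin_cases j <;> simp <;> field_simp
      ring
    rw [this]
    exact ((preservesIwasawa_upper _ _ _).mul preservesIwasawa_weyl).mul
      (preservesIwasawa_upper _ _ _)

/-- Left translation by the maximal compact subgroup is realized by a transformation of Iwasawa
coordinates that preserves the measure. -/
lemma exists_measurePreserving_ofCompact_mul (k : MaxCompact 𝕜) :
    ∃ σ : 𝕜ˣ × 𝕜 × MaxCompact 𝕜 → 𝕜ˣ × 𝕜 × MaxCompact 𝕜,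
      MeasurePreserving σ (iwasawaMeasure 𝕜) (iwasawaMeasure 𝕜) ∧
      ∀ p, ofCompact k * iwasawaPoint p = iwasawaPoint (σ p) := by
  obtain ⟨σ, hσ, ρ, hρ, h⟩ := preservesIwasawa (ofCompact k)
  refine ⟨σ, hσ, fun p => ?_⟩
  have hn := congrArg (fun g : GL (Fin 2) 𝕜 => ‖g.1.det‖) (h p)
  simp only [Units.val_mul, Matrix.det_mul, norm_mul, norm_det_iwasawaPoint, coe_ofCompact,
    norm_det_compact, coe_realScalar, Matrix.det_smul, Matrix.det_one, mul_one, norm_pow,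
    RCLike.norm_ofReal, abs_of_pos hρ, Fintype.card_fin] at hn
  -- Comparing absolute determinants gives ρ² = 1, and ρ is positive.
  have hρ1 : ρ = 1 := by nlinarith
  rw [h p]
  ext1
  simp [coe_realScalar, hρ1]

end Invariance

/-! ### The Gaussian -/

section Gaussian

variable {𝕜 : Type*} [RCLike 𝕜]

/-- In trace form the invariance under unitary matrices on either side is visible, the left one by
cyclicity. -/
lemma sum_norm_sq_eq_trace (M : Matrix (Fin 2) (Fin 2) 𝕜) :
    ∑ i, ∑ j, ‖M i j‖ ^ 2 = RCLike.re (M * M.conjTranspose).trace := by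
  have h : ∀ z : 𝕜, RCLike.re (z * starRingEnd 𝕜 z) = ‖z‖ ^ 2 := fun z => by
    rw [RCLike.mul_conj, ← RCLike.ofReal_pow, RCLike.ofReal_re]
  simp only [Fin.sum_univ_two, Matrix.trace, Matrix.diag_apply, Matrix.mul_apply,
    Matrix.conjTranspose_apply, map_add, ← starRingEnd_apply, h]

lemma gaussian_mul_ofCompact (g : GL (Fin 2) 𝕜) (k : MaxCompact 𝕜) :
    gaussian (g * ofCompact k) = gaussian g := by
  have hk : k.1 * k.1.conjTranspose = 1 := Matrix.mem_unitaryGroup_iff.mp k.2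
  have h2 : nabs (g.1 * k.1).det = nabs g.1.det := by
    rw [nabs, nabs, Matrix.det_mul, norm_mul, norm_det_compact, mul_one]
  rw [gaussian, gaussian, Units.val_mul, coe_ofCompact, h2, sum_norm_sq_eq_trace,
    sum_norm_sq_eq_trace, Matrix.conjTranspose_mul, Matrix.mul_assoc, ← Matrix.mul_assoc k.1, hk,
    Matrix.one_mul]

lemma gaussian_ofCompact_mul (k : MaxCompact 𝕜) (g : GL (Fin 2) 𝕜) :
    gaussian (ofCompact k * g) = gaussian g := by
  have hk : k.1.conjTranspose * k.1 = 1 := Matrix.mem_unitaryGroup_iff'.mp k.2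
  have h2 : nabs (k.1 * g.1).det = nabs g.1.det := by
    rw [nabs, nabs, Matrix.det_mul, norm_mul, norm_det_compact, one_mul]
  rw [gaussian, gaussian, Units.val_mul, coe_ofCompact, h2, sum_norm_sq_eq_trace,
    sum_norm_sq_eq_trace, Matrix.conjTranspose_mul, Matrix.trace_mul_comm,
    Matrix.mul_assoc, ← Matrix.mul_assoc k.1.conjTranspose, hk, Matrix.one_mul,
    Matrix.trace_mul_comm]

lemma continuous_gaussian : Continuous (gaussian : GL (Fin 2) 𝕜 → ℝ) := by
  have hval : Continuous fun g : GL (Fin 2) 𝕜 => g.1 := Units.continuous_val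
  have hentry : ∀ i j, Continuous fun g : GL (Fin 2) 𝕜 => g.1 i j := fun i j =>
    hval.matrix_elem i j
  refine Continuous.mul ?_ ?_
  · fun_prop
  · exact (continuous_nabs.comp hval.matrix_det).rpow_const fun _ => Or.inr (by norm_num)

/-- The squared entries of the shell point sum to ‖m‖(‖y‖ + ‖y‖⁻¹ + ‖x‖²/‖y‖), which separates the
Gaussian in x from the Bessel-type factor in y. -/
lemma gaussian_iwasawaPoint (m : 𝕜ˣ) (p : 𝕜ˣ × 𝕜 × MaxCompact 𝕜) :
    gaussian (realScalar (radius m) (radius_pos m) * iwasawaPoint p) =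
      nabs (m : 𝕜) ^ (1 / 2 : ℝ) * Real.exp (-(Real.pi * deg 𝕜 * ‖(m : 𝕜)‖ *
        (‖(p.1 : 𝕜)‖ + ‖(p.1 : 𝕜)‖⁻¹))) *
        Real.exp (-(Real.pi * deg 𝕜 * ‖(m : 𝕜)‖ / ‖(p.1 : 𝕜)‖) * ‖p.2.1‖ ^ 2) := by
  have hy : 0 < ‖(p.1 : 𝕜)‖ := norm_pos_iff.mpr p.1.ne_zero
  have hp := sqrt_norm_pos p.1
  have h1 : gaussian (realScalar (radius m) (radius_pos m) * iwasawaPoint p) =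
      gaussian (realScalar (radius m) (radius_pos m) * iwasawaPoint (p.1, p.2.1, 1)) := by
    rw [← gaussian_mul_ofCompact (realScalar _ _ * iwasawaPoint (p.1, p.2.1, 1)) p.2.2]
    congr 1
    rw [iwasawaPoint, iwasawaPoint, ofCompact_one, mul_one]
    simp only [mul_assoc]
  have hdet : ‖(realScalar (radius m) (radius_pos m) * iwasawaPoint (p.1, p.2.1, 1)).1.det‖ =
      ‖(m : 𝕜)‖ := by
    rw [Units.val_mul, Matrix.det_mul, norm_mul, norm_det_iwasawaPoint, coe_realScalar,
      Matrix.det_smul, radius_eq]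
    simp
  rw [h1, gaussian, nabs, hdet, mul_assoc (nabs _ ^ _), ← Real.exp_add, mul_comm, nabs]
  congr 2
  rw [Units.val_mul, coe_realScalar, coe_iwasawaPoint, radius_eq]
  simp only [Fin.sum_univ_two, Submonoid.coe_one, mul_one, smul_mul_assoc, one_mul,
    Matrix.smul_apply, smul_eq_mul, norm_mul, RCLike.norm_ofReal, mul_pow, sq_abs, inv_pow,
    Real.sq_sqrt (norm_nonneg _)]
  simp
  field_simp
  ring

end Gaussian

/-! ### Logarithmic coordinates on the multiplicative group -/

section Logarithm

lemma lintegral_fun_norm {E : Type*} [NormedAddCommGroup E] [NormedSpace ℝ E]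
    [FiniteDimensional ℝ E] [Nontrivial E] [MeasurableSpace E] [BorelSpace E] (μ : Measure E)
    [μ.IsAddHaarMeasure] {f : ℝ → ℝ≥0∞} (hf : Measurable f) :
    ∫⁻ x, f ‖x‖ ∂μ = (Module.finrank ℝ E * μ (Metric.ball 0 1)) *
      ∫⁻ r in Set.Ioi (0 : ℝ), ENNReal.ofReal (r ^ (Module.finrank ℝ E - 1)) * f r := by
  have hs : Measurable fun r : Set.Ioi (0 : ℝ) => f r := hf.comp measurable_subtype_coe
  calc ∫⁻ x, f ‖x‖ ∂μ = ∫⁻ x : ({(0)}ᶜ : Set E), f ‖x.1‖ ∂(μ.comap (↑)) := by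
        rw [lintegral_subtype_comap (measurableSet_singleton _).compl fun x : E => f ‖x‖,
          restrict_compl_singleton]
    _ = ∫⁻ x : Metric.sphere (0 : E) 1 × Set.Ioi (0 : ℝ), f x.2
          ∂μ.toSphere.prod (.volumeIoiPow (Module.finrank ℝ E - 1)) := by
        simpa using μ.measurePreserving_homeomorphUnitSphereProd.lintegral_comp_emb
          (Homeomorph.measurableEmbedding _) (fun x => f x.2)
    _ = μ.toSphere Set.univ *
          ∫⁻ r : Set.Ioi (0 : ℝ), f r ∂.volumeIoiPow (Module.finrank ℝ E - 1) := by
        refine (lintegral_prod _ (hs.comp measurable_snd).aemeasurable).trans ?_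
        simp [mul_comm]
    _ = _ := by
        rw [μ.toSphere_apply_univ, Measure.volumeIoiPow,
          lintegral_withDensity_eq_lintegral_mul _ (by fun_prop) hs,
          ← lintegral_subtype_comap measurableSet_Ioi]
        rfl

lemma lintegral_Ioi_eq_lintegral_exp (f : ℝ → ℝ≥0∞) :
    ∫⁻ r in Set.Ioi (0 : ℝ), f r = ∫⁻ x, ENNReal.ofReal (Real.exp x) * f (Real.exp x) := by
  have := lintegral_image_eq_lintegral_abs_deriv_mul MeasurableSet.univ
    (fun x _ => (Real.hasDerivAt_exp x).hasDerivWithinAt) Real.exp_injective.injOn f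
  rw [Set.image_univ, Real.range_exp] at this
  simpa [abs_of_pos (Real.exp_pos _)] using this

variable {𝕜 : Type*} [RCLike 𝕜]

lemma deg_eq : deg 𝕜 = 1 ∨ deg 𝕜 = 2 := by
  have h1 : 0 < deg 𝕜 := deg_pos
  have h2 : deg 𝕜 ≤ 2 := RCLike.finrank_le_two 𝕜
  omega

/-- The logarithm of the norm on the multiplicative group. -/
def logNorm (y : 𝕜ˣ) : ℝ := Real.log ‖(y : 𝕜)‖

lemma exp_logNorm (y : 𝕜ˣ) : Real.exp (logNorm y) = ‖(y : 𝕜)‖ :=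
  Real.exp_log (norm_pos_iff.mpr y.ne_zero)

variable (𝕜) in
/-- The factor by which the logarithm of the norm scales the multiplicative Haar measure. -/
def logVolume : ℝ := if deg 𝕜 = 1 then 2 else 4 * Real.pi

variable (𝕜) in
lemma logVolume_pos : 0 < logVolume 𝕜 := by
  unfold logVolume
  split_ifs <;> positivity

variable [MeasurableSpace 𝕜] [BorelSpace 𝕜]

lemma measurable_logNorm : Measurable (logNorm : 𝕜ˣ → ℝ) :=
  (measurableEmbedding_val.measurable.norm).log

variable (𝕜) in
-- The dimension times the volume of the unit ball, for n times Lebesgue measure: 1·2 over the reals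
-- and 2·(2π) over the complex numbers.
lemma logVolume_eq : (deg 𝕜 : ℝ≥0∞) * addMeasure 𝕜 (Metric.ball 0 1) =
    ENNReal.ofReal (logVolume 𝕜) := by
  rw [addMeasure, Measure.smul_apply, InnerProductSpace.volume_ball, logVolume]
  have hd : Module.finrank ℝ 𝕜 = deg 𝕜 := rfl
  rw [hd]
  rcases deg_eq (𝕜 := 𝕜) with h | h
  · simp only [h, if_true, Nat.cast_one]
    rw [show (1 / 2 + 1 : ℝ) = 1 / 2 + 1 from rfl, Real.Gamma_add_one (by norm_num),
      Real.Gamma_one_half_eq]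
    simp
    field_simp
  · simp only [h]
    norm_num
    rw [← ENNReal.ofReal_pow (by positivity), Real.sq_sqrt Real.pi_pos.le, ← mul_assoc]
    norm_num

/-- In polar coordinates r^(n-1) dr / r^n = dr/r, which is Lebesgue measure in log r; the angular
integral gives the constant. -/
lemma map_logNorm_mulMeasure :
    (mulMeasure 𝕜).map logNorm = ENNReal.ofReal (logVolume 𝕜) • volume := by
  refine Measure.ext_of_lintegral _ fun f hf => ?_
  have hg : Measurable fun r : ℝ => ENNReal.ofReal (r ^ deg 𝕜)⁻¹ * f (Real.log r) := by
    fun_prop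
  rw [lintegral_map hf measurable_logNorm, lintegral_smul_measure, ← logVolume_eq]
  have h1 : ∫⁻ y : 𝕜ˣ, f (logNorm y) ∂mulMeasure 𝕜 =
      ∫⁻ x, f (Real.log ‖x‖) ∂(mulMeasure 𝕜).map Units.val :=
    (lintegral_map (hf.comp (Real.measurable_log.comp measurable_norm))
      measurableEmbedding_val.measurable).symm
  have hn : Measurable fun x : 𝕜 => ENNReal.ofReal (nabs x)⁻¹ :=
    continuous_nabs.measurable.inv.ennreal_ofReal
  rw [h1, map_val_mulMeasure]
  refine (lintegral_withDensity_eq_lintegral_mul _ hn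
    (hf.comp (Real.measurable_log.comp measurable_norm))).trans ?_
  refine (lintegral_fun_norm (addMeasure 𝕜) hg).trans ?_
  rw [lintegral_Ioi_eq_lintegral_exp, smul_eq_mul]
  congr 1
  refine lintegral_congr fun x => ?_
  rw [Real.log_exp, ← mul_assoc, ← mul_assoc, ← ENNReal.ofReal_mul (by positivity),
    ← ENNReal.ofReal_mul (by positivity), ← pow_succ',
    show Module.finrank ℝ 𝕜 - 1 + 1 = deg 𝕜 from Nat.sub_add_cancel deg_pos,
    mul_inv_cancel₀ (by positivity), ENNReal.ofReal_one, one_mul]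

lemma integrable_comp_logNorm {V : Type*} [NormedAddCommGroup V] {φ : ℝ → V}
    (hφ : AEStronglyMeasurable φ) :
    Integrable (fun y : 𝕜ˣ => φ (logNorm y)) (mulMeasure 𝕜) ↔ Integrable φ := by
  have h0 : ENNReal.ofReal (logVolume 𝕜) ≠ 0 := by simpa using logVolume_pos 𝕜
  rw [← integrable_smul_measure h0 ENNReal.ofReal_ne_top (μ := volume), ← map_logNorm_mulMeasure,
    integrable_map_measure _ measurable_logNorm.aemeasurable]
  · rfl
  · rw [map_logNorm_mulMeasure]
    exact hφ.smul_measure _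

lemma integral_comp_logNorm {V : Type*} [NormedAddCommGroup V] [NormedSpace ℝ V] {φ : ℝ → V}
    (hφ : AEStronglyMeasurable φ) :
    ∫ y : 𝕜ˣ, φ (logNorm y) ∂mulMeasure 𝕜 = logVolume 𝕜 • ∫ x, φ x := by
  have h := integral_map (μ := mulMeasure 𝕜) (f := φ) measurable_logNorm.aemeasurable
    (by rw [map_logNorm_mulMeasure]; exact hφ.smul_measure _)
  rw [← h, map_logNorm_mulMeasure, integral_smul_measure,
    ENNReal.toReal_ofReal (logVolume_pos 𝕜).le]

end Logarithm

/-! ### A Bessel integral and its Mellin transform -/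

section Bessel

lemma norm_cexp_mul_exp (α : ℂ) (x r : ℝ) :
    ‖Complex.exp (α * x) * (Real.exp r : ℝ)‖ = Real.exp (α.re * x) * Real.exp r := by
  rw [norm_mul, Complex.norm_exp, Complex.norm_real, Real.norm_of_nonneg (Real.exp_pos _).le,
    Complex.re_mul_ofReal]

lemma integrable_exp_mul_exp_neg_exp {α : ℂ} (hα : 0 < α.re) {c : ℝ} (hc : 0 < c) :
    Integrable fun x : ℝ => Complex.exp (α * x) * (Real.exp (-(c * Real.exp x)) : ℝ) := by
  have h1 : IntegrableOn (fun t : ℝ => t ^ (α.re - 1) * Real.exp (-c * t ^ (1 : ℝ)))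
      (Set.Ioi 0) := integrableOn_rpow_mul_exp_neg_mul_rpow (by linarith) one_pos hc
  rw [← Real.range_exp, ← Set.image_univ, integrableOn_image_iff_integrableOn_abs_deriv_smul
    MeasurableSet.univ (fun x _ => (Real.hasDerivAt_exp x).hasDerivWithinAt)
    Real.exp_injective.injOn, integrableOn_univ] at h1
  refine h1.mono' (by fun_prop) (.of_forall fun x => ?_)
  rw [norm_cexp_mul_exp, abs_of_pos (Real.exp_pos x), smul_eq_mul, ← mul_assoc, Real.rpow_one,
    ← Real.exp_mul, ← Real.exp_add, ← Real.exp_add, ← Real.exp_add]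
  exact le_of_eq (congrArg Real.exp (by ring))

/-- Euler's integral for Gamma after the substitution t = exp x. -/
lemma integral_exp_mul_exp_neg_exp {α : ℂ} (hα : 0 < α.re) {c : ℝ} (hc : 0 < c) :
    ∫ x : ℝ, Complex.exp (α * x) * (Real.exp (-(c * Real.exp x)) : ℝ) =
      (1 / c : ℂ) ^ α * Complex.Gamma α := by
  have h1 := Complex.integral_cpow_mul_exp_neg_mul_Ioi hα hc
  rw [← Real.range_exp, ← Set.image_univ, integral_image_eq_integral_abs_deriv_smul
    MeasurableSet.univ (fun x _ => (Real.hasDerivAt_exp x).hasDerivWithinAt)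
    Real.exp_injective.injOn, setIntegral_univ] at h1
  rw [← h1]
  refine integral_congr_ae (.of_forall fun x => ?_)
  have hx : ((Real.exp x : ℝ) : ℂ) ≠ 0 := by exact_mod_cast (Real.exp_pos x).ne'
  simp only [abs_of_pos (Real.exp_pos x), Complex.real_smul]
  rw [Complex.cpow_sub _ _ hx, Complex.cpow_one, Complex.cpow_def_of_ne_zero hx,
    ← Complex.ofReal_log (Real.exp_pos x).le, Real.log_exp]
  push_cast
  rw [mul_comm α]
  have : Complex.exp (x : ℂ) ≠ 0 := Complex.exp_ne_zero _
  field_simp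

lemma map_add_sub_volume :
    (volume : Measure (ℝ × ℝ)).map (fun p => (p.1 + p.2, p.1 - p.2)) =
      ENNReal.ofReal (1 / 2) • volume := by
  let f := Matrix.toLin (Module.Basis.finTwoProd ℝ) (Module.Basis.finTwoProd ℝ) !![1, 1; 1, -1]
  have hdet : LinearMap.det f = -2 := by
    rw [LinearMap.det_toLin, Matrix.det_fin_two_of]; norm_num
  have h := Measure.map_linearMap_addHaar_eq_smul_addHaar (volume : Measure (ℝ × ℝ)) (f := f)
    (by rw [hdet]; norm_num)
  have hf : (f : ℝ × ℝ → ℝ × ℝ) = fun p => (p.1 + p.2, p.1 - p.2) := by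
    funext p
    simp [f, Matrix.toLin_finTwoProd_apply, sub_eq_add_neg]
  rw [hf, hdet] at h
  rw [h]
  norm_num

/-- The integrand of the Bessel integral together with a Mellin kernel. -/
def besselKernel (c : ℝ) (b : ℂ) (x y : ℝ) : ℂ :=
  Complex.exp (b * y) * (Real.exp (-(c * (Real.exp (x + y) + Real.exp (x - y)))) : ℝ)

/-- The Bessel integral `∫ exp (b y - 2 c exp x cosh y) dy`. -/
def bessel (c : ℝ) (b : ℂ) (x : ℝ) : ℂ := ∫ y, besselKernel c b x y

/-- In the variables x + y and x - y the double integrand splits into two Gamma integrands; this is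
why the Mellin transform of the Bessel function is a product of Gammas. The Jacobian accounts for
the factor 1/2 in the next results. -/
lemma exp_mul_besselKernel (c : ℝ) (a b : ℂ) (x y : ℝ) :
    Complex.exp (a * x) * besselKernel c b x y =
      (Complex.exp ((a + b) / 2 * (x + y : ℝ)) * (Real.exp (-(c * Real.exp (x + y))) : ℝ)) *
      (Complex.exp ((a - b) / 2 * (x - y : ℝ)) * (Real.exp (-(c * Real.exp (x - y))) : ℝ)) := by
  rw [besselKernel, mul_add, neg_add, Real.exp_add (-(c * Real.exp (x + y))), Complex.ofReal_mul,
    mul_mul_mul_comm, ← mul_assoc, ← Complex.exp_add, ← Complex.exp_add,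
    show a * x + b * y = (a + b) / 2 * (x + y : ℝ) + (a - b) / 2 * (x - y : ℝ) by
      push_cast; ring]

variable {c : ℝ} {a b : ℂ}

lemma integrable_exp_mul_besselKernel (hc : 0 < c) (h1 : 0 < (a + b).re) (h2 : 0 < (a - b).re) :
    Integrable (fun p : ℝ × ℝ => Complex.exp (a * p.1) * besselKernel c b p.1 p.2) := by
  have h1' : 0 < ((a + b) / 2).re := by simpa using h1
  have h2' : 0 < ((a - b) / 2).re := by simpa using h2
  have hF := (integrable_exp_mul_exp_neg_exp h1' hc).mul_prod
    (integrable_exp_mul_exp_neg_exp h2' hc)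
  rw [← Measure.volume_eq_prod] at hF
  have h := hF.smul_measure (c := ENNReal.ofReal (1 / 2)) ENNReal.ofReal_ne_top
  rw [← map_add_sub_volume] at h
  simp only [exp_mul_besselKernel]
  exact h.comp_measurable (by fun_prop)

lemma integral_exp_mul_besselKernel (hc : 0 < c) (h1 : 0 < (a + b).re) (h2 : 0 < (a - b).re) :
    ∫ p : ℝ × ℝ, Complex.exp (a * p.1) * besselKernel c b p.1 p.2 =
      1 / 2 * (1 / c : ℂ) ^ a * Complex.Gamma ((a + b) / 2) * Complex.Gamma ((a - b) / 2) := by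
  have h1' : 0 < ((a + b) / 2).re := by simpa using h1
  have h2' : 0 < ((a - b) / 2).re := by simpa using h2
  have hF := integral_prod_mul (μ := (volume : Measure ℝ)) (ν := (volume : Measure ℝ))
    (fun x : ℝ => Complex.exp ((a + b) / 2 * x) * (Real.exp (-(c * Real.exp x)) : ℝ))
    (fun x : ℝ => Complex.exp ((a - b) / 2 * x) * (Real.exp (-(c * Real.exp x)) : ℝ))
  rw [integral_exp_mul_exp_neg_exp h1' hc, integral_exp_mul_exp_neg_exp h2' hc,
    ← Measure.volume_eq_prod] at hF
  have hc' : (1 / c : ℂ) ≠ 0 := by simpa using hc.ne'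
  simp only [exp_mul_besselKernel]
  have h := integral_map (μ := (volume : Measure (ℝ × ℝ))) (φ := fun p => (p.1 + p.2, p.1 - p.2))
    (by fun_prop) (f := fun p : ℝ × ℝ =>
      (Complex.exp ((a + b) / 2 * p.1) * (Real.exp (-(c * Real.exp p.1)) : ℝ)) *
      (Complex.exp ((a - b) / 2 * p.2) * (Real.exp (-(c * Real.exp p.2)) : ℝ))) (by fun_prop)
  rw [map_add_sub_volume, integral_smul_measure, hF] at h
  rw [← h, ENNReal.toReal_ofReal (by norm_num), Complex.real_smul,
    show (1 / c : ℂ) ^ a = (1 / c : ℂ) ^ ((a + b) / 2) * (1 / c : ℂ) ^ ((a - b) / 2) by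
      rw [← Complex.cpow_add _ _ hc']; ring_nf]
  push_cast
  ring

lemma norm_besselKernel (c : ℝ) (b : ℂ) (x y : ℝ) : ‖besselKernel c b x y‖ =
    Real.exp (b.re * y) * Real.exp (-(c * (Real.exp (x + y) + Real.exp (x - y)))) :=
  norm_cexp_mul_exp _ _ _

lemma norm_besselKernel_antitone (hc : 0 < c) {x x' : ℝ} (h : x ≤ x') (y : ℝ) :
    ‖besselKernel c b x' y‖ ≤ ‖besselKernel c b x y‖ := by
  rw [norm_besselKernel, norm_besselKernel]
  gcongr

/-- Fubini yields integrability only for almost every `x`; since the kernel's norm decreases in `x`,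
one good `x'` to the left of `x` suffices. The exponent |Re b| + 1 keeps both a ± b in the right
half-plane. -/
lemma integrable_besselKernel (hc : 0 < c) (b : ℂ) (x : ℝ) : Integrable (besselKernel c b x) := by
  have h := integrable_exp_mul_besselKernel (a := ((|b.re| + 1 : ℝ) : ℂ)) (b := b) hc
    (by simp; linarith [neg_abs_le b.re]) (by simp; linarith [le_abs_self b.re])
  rw [Measure.volume_eq_prod] at h
  obtain ⟨x', hx', hint⟩ : ∃ x' ∈ Set.Iio x, Integrable
      fun y => Complex.exp (((|b.re| + 1 : ℝ) : ℂ) * x') * besselKernel c b x' y := by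
    by_contra! hno
    have h0 : volume (Set.Iio x) = 0 := measure_mono_null hno (ae_iff.mp h.prod_right_ae)
    simp at h0
  rw [integrable_const_mul_iff (isUnit_iff_ne_zero.mpr (Complex.exp_ne_zero _))] at hint
  exact hint.norm.mono' (by unfold besselKernel; fun_prop)
    (.of_forall (norm_besselKernel_antitone hc (le_of_lt hx')))

lemma continuous_bessel (hc : 0 < c) (b : ℂ) : Continuous (bessel c b) := by
  rw [continuous_iff_continuousAt]
  intro x
  refine continuousAt_of_dominated (bound := fun y => ‖besselKernel c b (x - 1) y‖)
    (.of_forall fun x' => (integrable_besselKernel hc b x').aestronglyMeasurable) ?_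
    (integrable_besselKernel hc b (x - 1)).norm (.of_forall fun y => ?_)
  · filter_upwards [Ioi_mem_nhds (sub_one_lt x)] with x' hx'
    exact .of_forall (norm_besselKernel_antitone hc (le_of_lt hx'))
  · unfold besselKernel
    fun_prop

lemma integrable_exp_mul_bessel (hc : 0 < c) (h1 : 0 < (a + b).re) (h2 : 0 < (a - b).re) :
    Integrable fun x : ℝ => Complex.exp (a * x) * bessel c b x := by
  have h := integrable_exp_mul_besselKernel hc h1 h2
  rw [Measure.volume_eq_prod] at h
  simpa only [integral_const_mul] using! h.integral_prod_left

lemma integral_exp_mul_bessel (hc : 0 < c) (h1 : 0 < (a + b).re) (h2 : 0 < (a - b).re) :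
    ∫ x : ℝ, Complex.exp (a * x) * bessel c b x =
      1 / 2 * (1 / c : ℂ) ^ a * Complex.Gamma ((a + b) / 2) * Complex.Gamma ((a - b) / 2) := by
  have h := integrable_exp_mul_besselKernel hc h1 h2
  rw [← integral_exp_mul_besselKernel hc h1 h2, Measure.volume_eq_prod, integral_prod]
  · simp only [integral_const_mul, bessel]
  · rwa [Measure.volume_eq_prod] at h

end Bessel

/-! ### Uniqueness for the two-sided Laplace transform -/

open FourierTransform in
-- On one vertical line the Laplace transform is the Fourier transform of exp(σx)D(x). If it
-- vanishes, Fourier inversion applies trivially, and continuity gives vanishing at every point.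
lemma eq_zero_of_laplace_eq_zero {D : ℝ → ℂ} (hD : Continuous D) {σ : ℝ}
    (hint : Integrable fun x : ℝ => Complex.exp (σ * x) * D x)
    (h0 : ∀ z : ℂ, z.re = σ → ∫ x : ℝ, Complex.exp (z * x) * D x = 0) (x : ℝ) : D x = 0 := by
  have hF : 𝓕 (fun x : ℝ => Complex.exp (σ * x) * D x) = 0 := by
    funext ξ
    rw [Real.fourier_real_eq_integral_exp_smul]
    refine Eq.trans ?_ (h0 (σ + (-2 * Real.pi * ξ : ℝ) * Complex.I) (by simp))
    refine integral_congr_ae (.of_forall fun x => ?_)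
    simp only [smul_eq_mul, ← mul_assoc, ← Complex.exp_add]
    congr 2
    push_cast
    ring
  have h := congrFun (Continuous.fourierInv_fourier_eq (by fun_prop) hint
    (by rw [hF]; exact integrable_zero _ _ _)) x
  rw [hF] at h
  have h2 : (𝓕⁻ (0 : ℝ → ℂ)) x = 0 := by
    rw [Real.fourierInv_eq]; simp
  rw [h2] at h
  exact (mul_eq_zero.mp h.symm).resolve_left (Complex.exp_ne_zero _)

/-! ### The integrals over the shells -/

section Shell

variable {𝕜 : Type*} [RCLike 𝕜]

lemma nabs_eq_exp (y : 𝕜ˣ) : nabs (y : 𝕜) = Real.exp (deg 𝕜 * logNorm y) := by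
  rw [Real.exp_nat_mul, exp_logNorm, nabs]

lemma nabs_rpow_eq_exp (y : 𝕜ˣ) (s : ℝ) :
    nabs (y : 𝕜) ^ s = Real.exp (deg 𝕜 * s * logNorm y) := by
  rw [nabs_eq_exp, ← Real.exp_mul]
  ring_nf

lemma nabs_cpow_eq_exp (y : 𝕜ˣ) (s : ℂ) :
    (nabs (y : 𝕜) : ℂ) ^ s = Complex.exp (deg 𝕜 * s * logNorm y) := by
  rw [nabs_eq_exp, Complex.cpow_def_of_ne_zero (by exact_mod_cast (Real.exp_pos _).ne'),
    ← Complex.ofReal_log (Real.exp_pos _).le, Real.log_exp]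
  push_cast
  ring_nf

lemma gaussian_iwasawaPoint_eq_exp (m : 𝕜ˣ) (p : 𝕜ˣ × 𝕜 × MaxCompact 𝕜) :
    gaussian (realScalar (radius m) (radius_pos m) * iwasawaPoint p) =
      Real.exp (deg 𝕜 / 2 * logNorm m) *
      Real.exp (-(Real.pi * deg 𝕜 * (Real.exp (logNorm m + logNorm p.1) +
        Real.exp (logNorm m - logNorm p.1)))) *
      Real.exp (-(Real.pi * deg 𝕜 * Real.exp (logNorm m - logNorm p.1)) * ‖p.2.1‖ ^ 2) := by
  rw [gaussian_iwasawaPoint, nabs_rpow_eq_exp, Real.exp_add (logNorm m), Real.exp_sub,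
    exp_logNorm, exp_logNorm]
  congr 1
  · congr 2 <;> ring
  · congr 1; ring

lemma continuous_logNorm : Continuous (logNorm : 𝕜ˣ → ℝ) :=
  Units.continuous_val.norm.log fun y => norm_ne_zero_iff.mpr y.ne_zero

lemma continuous_gaussian_shell (m : 𝕜ˣ) : Continuous fun p : 𝕜ˣ × 𝕜 × MaxCompact 𝕜 =>
    gaussian (realScalar (radius m) (radius_pos m) * iwasawaPoint p) :=
  continuous_gaussian.comp (continuous_const.mul continuous_iwasawaPoint)

variable [MeasurableSpace 𝕜] [BorelSpace 𝕜]

lemma integrable_exp_neg_mul_norm_sq {b : ℝ} (hb : 0 < b) :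
    Integrable (fun x : 𝕜 => Real.exp (-b * ‖x‖ ^ 2)) (addMeasure 𝕜) := by
  have h : Integrable (fun x : 𝕜 => Real.exp (-b * ‖x‖ ^ 2)) := by
    by_contra h
    have h1 := GaussianFourier.integral_rexp_neg_mul_sq_norm (V := 𝕜) hb
    rw [integral_undef h] at h1
    have : 0 < (Real.pi / b) ^ (Module.finrank ℝ 𝕜 / 2 : ℝ) := by positivity
    exact this.ne h1
  exact h.smul_measure (by simp)

lemma integral_exp_neg_mul_norm_sq (u : ℝ) :
    ∫ x : 𝕜, Real.exp (-(Real.pi * deg 𝕜 * Real.exp u) * ‖x‖ ^ 2) ∂addMeasure 𝕜 =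
      Real.exp (-(deg 𝕜 / 2 * u)) := by
  have hd : (0 : ℝ) < deg 𝕜 := by exact_mod_cast deg_pos
  rw [addMeasure, integral_smul_measure,
    GaussianFourier.integral_rexp_neg_mul_sq_norm (by positivity)]
  have h : Real.pi / (Real.pi * deg 𝕜 * Real.exp u) = (deg 𝕜 : ℝ)⁻¹ * Real.exp (-u) := by
    rw [Real.exp_neg]
    field_simp
  rw [h, Real.mul_rpow (by positivity) (by positivity), ← Real.exp_mul, smul_eq_mul, ← mul_assoc]
  have h2 : Module.finrank ℝ 𝕜 = deg 𝕜 := rfl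
  rw [h2]
  -- The normalization of the additive measure: n · n^(-n/2) = 1 for both n = 1 and n = 2.
  have h3 : ((deg 𝕜 : ℝ≥0∞).toReal) * (deg 𝕜 : ℝ)⁻¹ ^ ((deg 𝕜 : ℝ) / 2) = 1 := by
    rcases deg_eq (𝕜 := 𝕜) with h | h <;> rw [h] <;> norm_num
  rw [h3, one_mul]
  congr 1
  ring

/-- The shell integral of the Gaussian against a quasicharacter of the diagonal coordinate. -/
lemma shell_integral (m : 𝕜ˣ) (s : ℂ) :
    Integrable (fun p : 𝕜ˣ × 𝕜 × MaxCompact 𝕜 =>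
      (gaussian (realScalar (radius m) (radius_pos m) * iwasawaPoint p) : ℂ) *
        (nabs (p.1 : 𝕜) : ℂ) ^ (s + 1 / 2)) (iwasawaMeasure 𝕜) ∧
    ∫ p : 𝕜ˣ × 𝕜 × MaxCompact 𝕜,
      (gaussian (realScalar (radius m) (radius_pos m) * iwasawaPoint p) : ℂ) *
        (nabs (p.1 : 𝕜) : ℂ) ^ (s + 1 / 2) ∂iwasawaMeasure 𝕜 =
      logVolume 𝕜 * bessel (Real.pi * deg 𝕜) (deg 𝕜 * s) (logNorm m) := by
  have hd : (0 : ℝ) < deg 𝕜 := by exact_mod_cast deg_pos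
  have hc : 0 < Real.pi * deg 𝕜 := by positivity
  set G : 𝕜ˣ × 𝕜 × MaxCompact 𝕜 → ℂ := fun p =>
      (gaussian (realScalar (radius m) (radius_pos m) * iwasawaPoint p) : ℂ) *
        (nabs (p.1 : 𝕜) : ℂ) ^ (s + 1 / 2) with hG
  have hGc : Continuous G := by
    simp only [hG, nabs_cpow_eq_exp]
    exact (Complex.continuous_ofReal.comp (continuous_gaussian_shell m)).mul
      (Complex.continuous_exp.comp (continuous_const.mul
        (Complex.continuous_ofReal.comp (continuous_logNorm.comp continuous_fst))))
  let A : ℝ → ℂ := fun y => Complex.exp (deg 𝕜 / 2 * logNorm m) *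
    Complex.exp (deg 𝕜 * (s + 1 / 2) * y) *
    (Real.exp (-(Real.pi * deg 𝕜 * (Real.exp (logNorm m + y) + Real.exp (logNorm m - y)))) : ℝ)
  have hGA : ∀ y x k, G (y, x, k) = A (logNorm y) *
      (Real.exp (-(Real.pi * deg 𝕜 * Real.exp (logNorm m - logNorm y)) * ‖x‖ ^ 2) : ℝ) := by
    intro y x k
    simp only [hG, A, gaussian_iwasawaPoint_eq_exp, nabs_cpow_eq_exp]
    push_cast
    ring
  have hsec : ∀ y, ∫ q : 𝕜 × MaxCompact 𝕜, G (y, q) ∂(addMeasure 𝕜).prod (compactMeasure 𝕜) =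
      A (logNorm y) * (Real.exp (-(deg 𝕜 / 2 * (logNorm m - logNorm y))) : ℝ) := by
    intro y
    simp only [hGA]
    refine (integral_fun_fst (fun x : 𝕜 => A (logNorm y) *
      (Real.exp (-(Real.pi * deg 𝕜 * Real.exp (logNorm m - logNorm y)) * ‖x‖ ^ 2) : ℝ))).trans ?_
    rw [integral_const_mul, integral_complex_ofReal, integral_exp_neg_mul_norm_sq]
    simp
  have hsecn : ∀ y, ∫ q : 𝕜 × MaxCompact 𝕜, ‖G (y, q)‖ ∂(addMeasure 𝕜).prod (compactMeasure 𝕜) =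
      ‖A (logNorm y) * (Real.exp (-(deg 𝕜 / 2 * (logNorm m - logNorm y))) : ℝ)‖ := by
    intro y
    simp only [hGA, norm_mul, Complex.norm_real, Real.norm_eq_abs, Real.abs_exp]
    refine (integral_fun_fst (fun x : 𝕜 => ‖A (logNorm y)‖ *
      Real.exp (-(Real.pi * deg 𝕜 * Real.exp (logNorm m - logNorm y)) * ‖x‖ ^ 2))).trans ?_
    rw [integral_const_mul, integral_exp_neg_mul_norm_sq]
    simp
  have hAc : Continuous A := by fun_prop
  -- With n the degree, the factors exp(±(n/2) log‖m‖) from the determinant and the unipotent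
  -- integral cancel. The shift by 1/2 in the exponent, the unipotent integral and the weight |y|⁻¹
  -- contribute n/2 + n/2 - n = 0 to the exponent of y, leaving exactly the Bessel kernel.
  have hsmul : ∀ y : 𝕜ˣ, (ENNReal.ofReal (nabs (y : 𝕜))⁻¹).toReal •
      (A (logNorm y) * (Real.exp (-(deg 𝕜 / 2 * (logNorm m - logNorm y))) : ℝ)) =
      besselKernel (Real.pi * deg 𝕜) (deg 𝕜 * s) (logNorm m) (logNorm y) := by
    intro y
    rw [ENNReal.toReal_ofReal (inv_nonneg.mpr (nabs_nonneg _)), nabs_eq_exp, ← Real.exp_neg,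
      besselKernel, Complex.real_smul]
    simp only [A]
    rw [← mul_assoc, ← mul_assoc, ← Complex.exp_add, Complex.ofReal_exp (-(deg 𝕜 * logNorm y)),
      ← Complex.exp_add, mul_right_comm, Complex.ofReal_exp (-(deg 𝕜 / 2 * _)), ← Complex.exp_add]
    congr 2
    push_cast
    ring
  have hK := integrable_besselKernel hc (deg 𝕜 * s) (logNorm m)
  have hmeas : Measurable fun y : 𝕜ˣ => ENNReal.ofReal (nabs (y : 𝕜))⁻¹ :=
    (continuous_nabs.measurable.comp measurableEmbedding_val.measurable).inv.ennreal_ofReal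
  have hsecint : Integrable (fun y : 𝕜ˣ => A (logNorm y) *
      (Real.exp (-(deg 𝕜 / 2 * (logNorm m - logNorm y))) : ℝ))
      ((mulMeasure 𝕜).withDensity fun y => ENNReal.ofReal (nabs (y : 𝕜))⁻¹) := by
    rw [integrable_withDensity_iff_integrable_smul' hmeas (.of_forall fun _ => ENNReal.ofReal_lt_top)]
    simp only [hsmul]
    exact (integrable_comp_logNorm hK.aestronglyMeasurable).mpr hK
  have hint : Integrable G (iwasawaMeasure 𝕜) := by
    rw [iwasawaMeasure, integrable_prod_iff hGc.aestronglyMeasurable]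
    refine ⟨.of_forall fun y => ?_, ?_⟩
    · simp only [hGA]
      exact (((integrable_exp_neg_mul_norm_sq (by positivity)).ofReal (𝕜 := ℂ)).const_mul
        (A (logNorm y))).comp_fst (compactMeasure 𝕜)
    · simp only [hsecn]
      exact hsecint.norm
  refine ⟨hint, ?_⟩
  rw [iwasawaMeasure] at hint ⊢
  rw [integral_prod _ hint]
  simp only [hsec]
  rw [integral_withDensity_eq_integral_toReal_smul hmeas
    (.of_forall fun _ => ENNReal.ofReal_lt_top)]
  simp only [hsmul]
  rw [integral_comp_logNorm hK.aestronglyMeasurable, bessel, Complex.real_smul]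

lemma integrable_gaussian_shell (m : 𝕜ˣ) : Integrable (fun p : 𝕜ˣ × 𝕜 × MaxCompact 𝕜 =>
    gaussian (realScalar (radius m) (radius_pos m) * iwasawaPoint p)) (iwasawaMeasure 𝕜) := by
  -- At s = -1/2 the quasicharacter |y|^(s + 1/2) is trivial.
  have h := (shell_integral m (-1 / 2)).1.re
  have h0 : (-1 / 2 + 1 / 2 : ℂ) = 0 := by norm_num
  simp only [h0, Complex.cpow_zero, mul_one] at h
  exact h

end Shell

/-! ### The spherical Whittaker function on the diagonal torus -/

section Diagonal

variable {𝕜 : Type*} [RCLike 𝕜]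

lemma gammaFactor_ne_zero {s : ℂ} (hs : 0 < s.re) : gammaFactor 𝕜 s ≠ 0 := by
  unfold gammaFactor
  split_ifs
  · exact Complex.Gammaℝ_ne_zero_of_re_pos hs
  · rw [Complex.Gammaℂ_def]
    have : Complex.Gamma s ≠ 0 := Complex.Gamma_ne_zero_of_re_pos hs
    have h2 : (2 * Real.pi : ℂ) ^ (-s) ≠ 0 := by
      simp [Complex.cpow_eq_zero_iff, Real.pi_ne_zero]
    simp [this, h2]

variable (𝕜) in
-- This fixes the constant of 𝕎_h: one `logVolume` arises from the shell integral, one from the zeta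
-- integral, and 1/2 from the Bessel transform. Over the reals (1/2)·2²·(1/2) = 1; over the complex
-- numbers (1/(2π²))·(4π)²·(1/2) = 4, the product of the two leading 2's of the Gamma factors.
lemma gammaFactor_mul (s₁ s₂ : ℂ) : gammaFactor 𝕜 s₁ * gammaFactor 𝕜 s₂ =
    heckeConst 𝕜 * logVolume 𝕜 ^ 2 * (1 / 2 * (1 / (Real.pi * deg 𝕜 : ℝ) : ℂ) ^
      (deg 𝕜 * (s₁ + s₂) / 2) * Complex.Gamma (deg 𝕜 * s₁ / 2) *
      Complex.Gamma (deg 𝕜 * s₂ / 2)) := by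
  have hpi : (Real.pi : ℂ) ≠ 0 := by exact_mod_cast Real.pi_ne_zero
  rcases deg_eq (𝕜 := 𝕜) with h | h
  · simp only [gammaFactor, heckeConst, logVolume, h, if_true, Complex.Gammaℝ_def]
    have : (1 / (Real.pi * (1 : ℕ) : ℝ) : ℂ) ^ ((1 : ℕ) * (s₁ + s₂) / 2) =
        (Real.pi : ℂ) ^ (-s₁ / 2) * (Real.pi : ℂ) ^ (-s₂ / 2) := by
      rw [← Complex.cpow_add _ _ hpi, one_div, Complex.inv_cpow_ofReal_nonneg (by positivity),
        ← Complex.cpow_neg]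
      congr 1
      · simp
      · push_cast
        ring
    rw [this]
    push_cast
    norm_num
    ring
  · have h1 : deg 𝕜 ≠ 1 := by omega
    simp only [gammaFactor, heckeConst, logVolume, h, Complex.Gammaℂ_def]
    have : (1 / (Real.pi * (2 : ℕ) : ℝ) : ℂ) ^ ((2 : ℕ) * (s₁ + s₂) / 2) =
        (2 * Real.pi : ℂ) ^ (-s₁) * (2 * Real.pi : ℂ) ^ (-s₂) := by
      rw [← Complex.cpow_add _ _ (mul_ne_zero two_ne_zero hpi), one_div,
        Complex.inv_cpow_ofReal_nonneg (by positivity), ← Complex.cpow_neg]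
      congr 1
      · push_cast
        ring
      · push_cast
        ring
    rw [this]
    push_cast
    norm_num
    field_simp
    ring

variable [MeasurableSpace 𝕜] [BorelSpace 𝕜]

/-- In the variable log‖m‖ both sides have the same Laplace transform on a vertical line where
everything converges, so uniqueness applies. With a = n(s + (ν₁+ν₂)/2) and b = n(ν₁-ν₂)/2, the
combinations a ± b are n(s + ν₁) and n(s + ν₂). -/
lemma eq_bessel_of_zeta {ν₁ ν₂ : ℂ} {V : ℝ → ℂ} (hV : Continuous V) {σ : ℝ}
    (h : ∀ s : ℂ, σ < s.re →
      Integrable (fun m : 𝕜ˣ => V (logNorm m) * (nabs (m : 𝕜) : ℂ) ^ (s - 1 / 2)) (mulMeasure 𝕜) ∧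
      ∫ m : 𝕜ˣ, V (logNorm m) * (nabs (m : 𝕜) : ℂ) ^ (s - 1 / 2) ∂mulMeasure 𝕜 =
        gammaFactor 𝕜 (s + ν₁) * gammaFactor 𝕜 (s + ν₂)) (x : ℝ) :
    V x = heckeConst 𝕜 * logVolume 𝕜 * Complex.exp (deg 𝕜 * (1 / 2 + (ν₁ + ν₂) / 2) * x) *
      bessel (Real.pi * deg 𝕜) (deg 𝕜 * ((ν₁ - ν₂) / 2)) x := by
  have hd : (0 : ℝ) < deg 𝕜 := by exact_mod_cast deg_pos
  have hd' : (deg 𝕜 : ℂ) ≠ 0 := by exact_mod_cast hd.ne'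
  have hc : 0 < Real.pi * deg 𝕜 := by positivity
  -- Far enough right for the zeta integral to converge and for both Gamma arguments to have
  -- positive real part.
  obtain ⟨ρ, hρ, hρ₁, hρ₂⟩ : ∃ ρ : ℝ, σ < ρ ∧ 0 < ρ + ν₁.re ∧ 0 < ρ + ν₂.re :=
    ⟨max σ (max (-ν₁.re) (-ν₂.re)) + 1, by linarith [le_max_left σ (max (-ν₁.re) (-ν₂.re))],
      by linarith [le_max_right σ (max (-ν₁.re) (-ν₂.re)), le_max_left (-ν₁.re) (-ν₂.re)],
      by linarith [le_max_right σ (max (-ν₁.re) (-ν₂.re)), le_max_right (-ν₁.re) (-ν₂.re)]⟩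
  let B : ℝ → ℂ := fun x =>
    heckeConst 𝕜 * logVolume 𝕜 * Complex.exp (deg 𝕜 * (1 / 2 + (ν₁ + ν₂) / 2) * x) *
      bessel (Real.pi * deg 𝕜) (deg 𝕜 * ((ν₁ - ν₂) / 2)) x
  have hBc : Continuous B :=
    (Continuous.mul (by fun_prop) (by fun_prop)).mul (continuous_bessel hc _)
  have key : ∀ z : ℂ, z.re = deg 𝕜 * (ρ - 1 / 2) →
      Integrable (fun x : ℝ => Complex.exp (z * x) * (V x - B x)) ∧
      ∫ x : ℝ, Complex.exp (z * x) * (V x - B x) = 0 := by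
    intro z hz
    -- The Laplace variable is z = n(s - 1/2), because |m|^(s - 1/2) = exp(n(s - 1/2) log‖m‖).
    have hzs : z = deg 𝕜 * ((z / deg 𝕜 + 1 / 2) - 1 / 2) := by field_simp; ring
    have hsre : (z / deg 𝕜 + 1 / 2).re = ρ := by
      have : (z / (deg 𝕜 : ℂ)).re = z.re / deg 𝕜 := by
        exact_mod_cast Complex.div_ofReal_re z (deg 𝕜 : ℝ)
      rw [Complex.add_re, this, hz]
      field_simp
      norm_num
    generalize z / deg 𝕜 + 1 / 2 = s at hzs hsre
    obtain ⟨hi, hI⟩ := h s (hsre ▸ hρ)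
    simp only [nabs_cpow_eq_exp] at hi hI
    have hVm : AEStronglyMeasurable fun x : ℝ => V x * Complex.exp (deg 𝕜 * (s - 1 / 2) * x) :=
      Continuous.aestronglyMeasurable (by fun_prop)
    have hi' := (integrable_comp_logNorm (𝕜 := 𝕜) hVm).mp hi
    have hI' := (integral_comp_logNorm (𝕜 := 𝕜) hVm).symm.trans hI
    have hab : deg 𝕜 * s + deg 𝕜 * ((ν₁ + ν₂) / 2) + deg 𝕜 * ((ν₁ - ν₂) / 2) =
        deg 𝕜 * (s + ν₁) := by ring
    have hab' : deg 𝕜 * s + deg 𝕜 * ((ν₁ + ν₂) / 2) - deg 𝕜 * ((ν₁ - ν₂) / 2) =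
        deg 𝕜 * (s + ν₂) := by ring
    have h1 : 0 < (deg 𝕜 * s + deg 𝕜 * ((ν₁ + ν₂) / 2) + deg 𝕜 * ((ν₁ - ν₂) / 2)).re := by
      rw [hab, ← Complex.ofReal_natCast, Complex.re_ofReal_mul, Complex.add_re, hsre]
      positivity
    have h2 : 0 < (deg 𝕜 * s + deg 𝕜 * ((ν₁ + ν₂) / 2) - deg 𝕜 * ((ν₁ - ν₂) / 2)).re := by
      rw [hab', ← Complex.ofReal_natCast, Complex.re_ofReal_mul, Complex.add_re, hsre]
      positivity
    have hj := (integrable_exp_mul_bessel hc h1 h2).const_mul (heckeConst 𝕜 * logVolume 𝕜 : ℂ)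
    have hJ := integral_exp_mul_bessel hc h1 h2
    have hsplit : (fun x : ℝ => Complex.exp (z * x) * (V x - B x)) = fun x : ℝ =>
        V x * Complex.exp (deg 𝕜 * (s - 1 / 2) * x) - heckeConst 𝕜 * logVolume 𝕜 *
          (Complex.exp ((deg 𝕜 * s + deg 𝕜 * ((ν₁ + ν₂) / 2)) * x) *
            bessel (Real.pi * deg 𝕜) (deg 𝕜 * ((ν₁ - ν₂) / 2)) x) := by
      funext x
      have he : Complex.exp ((deg 𝕜 * s + deg 𝕜 * ((ν₁ + ν₂) / 2)) * x) =
          Complex.exp (z * x) * Complex.exp (deg 𝕜 * (1 / 2 + (ν₁ + ν₂) / 2) * x) := by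
        rw [← Complex.exp_add, hzs]
        ring_nf
      rw [he, ← hzs]
      simp only [B]
      ring
    rw [hsplit]
    refine ⟨hi'.sub hj, ?_⟩
    rw [integral_sub hi' hj, integral_const_mul, hJ, sub_eq_zero]
    have hlv : (logVolume 𝕜 : ℂ) ≠ 0 := by exact_mod_cast (logVolume_pos 𝕜).ne'
    rw [gammaFactor_mul, Complex.real_smul] at hI'
    refine mul_left_cancel₀ hlv (hI'.trans ?_)
    rw [hab, hab', show deg 𝕜 * s + deg 𝕜 * ((ν₁ + ν₂) / 2) =
      deg 𝕜 * (s + ν₁ + (s + ν₂)) / 2 by ring]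
    ring
  have h0 := eq_zero_of_laplace_eq_zero (D := fun x => V x - B x) (hV.sub hBc)
    (key _ (Complex.ofReal_re _)).1 (fun z hz => (key z hz).2) x
  exact sub_eq_zero.mp h0

end Diagonal

/-! ### The operators of integration over the shells -/

section ShellOperator

variable {𝕜 : Type*} [RCLike 𝕜]

/-- The point of the shell `|det g| = |m|` with given Iwasawa coordinates. -/
def shellPoint (m : 𝕜ˣ) (p : 𝕜ˣ × 𝕜 × MaxCompact 𝕜) : GL (Fin 2) 𝕜 :=
  realScalar (radius m) (radius_pos m) * iwasawaPoint p

lemma continuous_shellPoint (m : 𝕜ˣ) : Continuous (shellPoint m) :=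
  continuous_const.mul continuous_iwasawaPoint

lemma shellPoint_eq_mul (m y : 𝕜ˣ) (x : 𝕜) (k : MaxCompact 𝕜) :
    shellPoint m (y, x, k) = shellPoint m (y, x, 1) * ofCompact k := by
  simp only [shellPoint, iwasawaPoint, ofCompact_one, mul_one, mul_assoc]

lemma ofCompact_mul_shellPoint {k : MaxCompact 𝕜} {p q : 𝕜ˣ × 𝕜 × MaxCompact 𝕜}
    (h : ofCompact k * iwasawaPoint p = iwasawaPoint q) (m : 𝕜ˣ) :
    ofCompact k * shellPoint m p = shellPoint m q := by
  have hcomm : ofCompact k * realScalar (radius m) (radius_pos m) =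
      realScalar (radius m) (radius_pos m) * ofCompact k := by
    ext1; simp [coe_realScalar]
  rw [shellPoint, ← mul_assoc, hcomm, mul_assoc, h, shellPoint]

lemma gaussian_nonneg (g : GL (Fin 2) 𝕜) : 0 ≤ gaussian g :=
  mul_nonneg (Real.exp_pos _).le (Real.rpow_nonneg (nabs_nonneg _) _)

lemma continuous_gaussian_smul {V : Type*} [NormedAddCommGroup V] [NormedSpace ℂ V]
    {f : GL (Fin 2) 𝕜 → V} (hf : Continuous f) : Continuous fun g => (gaussian g : ℂ) • f g :=
  (Complex.continuous_ofReal.comp continuous_gaussian).smul hf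

variable [MeasurableSpace 𝕜] [BorelSpace 𝕜]

instance : SFinite (iwasawaMeasure 𝕜) := by unfold iwasawaMeasure; infer_instance

lemma integral_iwasawaMeasure {V : Type*} [NormedAddCommGroup V] [NormedSpace ℝ V]
    {f : 𝕜ˣ × 𝕜 × MaxCompact 𝕜 → V} (hf : Integrable f (iwasawaMeasure 𝕜)) :
    ∫ p, f p ∂iwasawaMeasure 𝕜 = ∫ y, ∫ x, ∫ k, f (y, x, k) ∂compactMeasure 𝕜 ∂addMeasure 𝕜
      ∂((mulMeasure 𝕜).withDensity fun y => ENNReal.ofReal (nabs (y : 𝕜))⁻¹) := by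
  rw [iwasawaMeasure] at hf ⊢
  rw [integral_prod _ hf]
  refine integral_congr_ae ?_
  filter_upwards [hf.prod_right_ae] with y hy
  exact integral_prod _ hy

lemma shell_ofCompact_mul (m : 𝕜ˣ) (k : MaxCompact 𝕜) {V : Type*} [NormedAddCommGroup V]
    [NormedSpace ℝ V] {f : GL (Fin 2) 𝕜 → V} (hf : Continuous f) :
    (Integrable (fun p => f (ofCompact k * shellPoint m p)) (iwasawaMeasure 𝕜) ↔
      Integrable (fun p => f (shellPoint m p)) (iwasawaMeasure 𝕜)) ∧
    ∫ p, f (ofCompact k * shellPoint m p) ∂iwasawaMeasure 𝕜 =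
      ∫ p, f (shellPoint m p) ∂iwasawaMeasure 𝕜 := by
  obtain ⟨σ, hσ, h⟩ := exists_measurePreserving_ofCompact_mul k
  simp only [fun p => ofCompact_mul_shellPoint (h p) m]
  have hm : AEStronglyMeasurable (fun p => f (shellPoint m p)) (iwasawaMeasure 𝕜) :=
    (hf.comp (continuous_shellPoint m)).aestronglyMeasurable
  refine ⟨hσ.integrable_comp hm, ?_⟩
  have := integral_map hσ.aemeasurable (f := fun p => f (shellPoint m p)) (by rwa [hσ.map_eq])
  rw [← this, hσ.map_eq]

variable {H : Type*} [NormedAddCommGroup H] [InnerProductSpace ℂ H]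
  (π : GL (Fin 2) 𝕜 →* (H ≃ₗᵢ[ℂ] H))

/-- Integration of an orbit map over a shell against the Gaussian. -/
def shellOperator (m : 𝕜ˣ) (v : H) : H :=
  ∫ p, (gaussian (shellPoint m p) : ℂ) • π (shellPoint m p) v ∂iwasawaMeasure 𝕜

variable {π}

lemma integrable_gaussian_smul (hπ : IsUnitaryRep π) (m : 𝕜ˣ) (v : H) :
    Integrable (fun p => (gaussian (shellPoint m p) : ℂ) • π (shellPoint m p) v)
      (iwasawaMeasure 𝕜) := by
  refine ((integrable_gaussian_shell m).mul_const ‖v‖).mono'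
    ((continuous_gaussian_smul (hπ v)).comp (continuous_shellPoint m)).aestronglyMeasurable
    (.of_forall fun p => ?_)
  rw [norm_smul, LinearIsometryEquiv.norm_map, Complex.norm_real,
    Real.norm_of_nonneg (gaussian_nonneg _)]
  rfl

lemma heckeConverges (hπ : IsUnitaryRep π) (m z : 𝕜ˣ) (v : H) : HeckeConverges π m z v := by
  have := (integrable_gaussian_smul hπ m v).norm.mono'
    (f := fun p => twisted z (fun g => π g v) (shellPoint m p)) ?_ (.of_forall fun p => ?_)
  · exact this
  · exact ((continuous_gaussian_smul ((hπ v).comp (continuous_const.mul continuous_id))).comp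
      (continuous_shellPoint m)).aestronglyMeasurable
  · simp [twisted, norm_smul]

variable [CompleteSpace H]

/-- The compact coordinate is the innermost one and the Gaussian does not depend on it, so the inner
integral already averages the vector over K. -/
lemma shellOperator_average (hπ : IsUnitaryRep π) (m : 𝕜ˣ) (v : H) :
    shellOperator π m (average π v) = shellOperator π m v := by
  rw [shellOperator, shellOperator, integral_iwasawaMeasure (integrable_gaussian_smul hπ m v),
    integral_iwasawaMeasure (integrable_gaussian_smul hπ m _)]
  congr 1 with y
  congr 1 with x
  have e : ∀ u : H, ∫ k, (gaussian (shellPoint m (y, x, k)) : ℂ) • π (shellPoint m (y, x, k)) u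
      ∂compactMeasure 𝕜 = (gaussian (shellPoint m (y, x, 1)) : ℂ) •
        ∫ k, π (shellPoint m (y, x, 1) * ofCompact k) u ∂compactMeasure 𝕜 := fun u => by
    rw [← integral_smul]
    refine integral_congr_ae (.of_forall fun k => ?_)
    simp only
    rw [shellPoint_eq_mul, gaussian_mul_ofCompact]
  rw [e, e, ← orbit_eq_integral π (hπ v), ← orbit_eq_integral π (hπ _),
    average_of_isFixed (isFixed_average hπ v)]

/-- A left translation by `k` is absorbed by the invariance of the Gaussian and of the shell
measure. -/
lemma isFixed_shellOperator (hπ : IsUnitaryRep π) (m : 𝕜ˣ) (v : H) :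
    IsFixed π (shellOperator π m v) := fun k => by
  have h := (shell_ofCompact_mul m k (continuous_gaussian_smul (hπ v))).2
  simp only [gaussian_ofCompact_mul, map_mul] at h
  have := (π (ofCompact k)).toContinuousLinearEquiv.toContinuousLinearMap.integral_comp_comm
    (integrable_gaussian_smul hπ m v)
  refine (this.symm.trans (Eq.trans ?_ h))
  simp

lemma inner_shellOperator (hπ : IsUnitaryRep π) (m : 𝕜ˣ) (u v : H) :
    ⟪u, shellOperator π m v⟫_ℂ =
      ∫ p, gaussian (shellPoint m p) * ⟪u, π (shellPoint m p) v⟫_ℂ ∂iwasawaMeasure 𝕜 := by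
  rw [shellOperator, ← integral_inner (integrable_gaussian_smul hπ m v)]
  simp only [inner_smul_right]

lemma heckeOperator_eq (hπ : IsUnitaryRep π) (t : 𝕜) (m z : 𝕜ˣ) (v : H) :
    heckeOperator π t m z v =
      (heckeConst 𝕜 * stdChar t * (nabs (m : 𝕜) ^ (1 / 2 : ℝ) : ℝ) : ℂ) •
        π (upper z z 0) (shellOperator π m v) := by
  rw [heckeOperator, heckeDistribution]
  congr 1
  have := (π (upper z z 0)).toContinuousLinearEquiv.toContinuousLinearMap.integral_comp_comm
    (integrable_gaussian_smul hπ m v)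
  refine Eq.trans ?_ this
  simp only [shellDelta, twisted, map_mul]
  simp [shellPoint]

end ShellOperator

/-! ### The scalars by which the operators act on spherical vectors -/

section Scalar

variable {𝕜 : Type*} [RCLike 𝕜]

lemma logNorm_mul (a b : 𝕜ˣ) : logNorm (a * b) = logNorm a + logNorm b := by
  rw [logNorm, Units.val_mul, norm_mul, Real.log_mul (norm_ne_zero_iff.mpr a.ne_zero)
    (norm_ne_zero_iff.mpr b.ne_zero)]
  rfl

lemma logNorm_eq_of_norm {a : 𝕜ˣ} {x : ℝ} (h : ‖(a : 𝕜)‖ = Real.exp x) : logNorm a = x := by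
  rw [logNorm, h, Real.log_exp]

lemma sqrt_norm_eq_exp (y : 𝕜ˣ) : √‖(y : 𝕜)‖ = Real.exp (logNorm y / 2) := by
  rw [Real.exp_half, exp_logNorm]

lemma exists_shellPoint_eq (m y : 𝕜ˣ) (x : 𝕜) (k : MaxCompact 𝕜) :
    ∃ (b : 𝕜ˣ) (x' : 𝕜), logNorm b = (logNorm m - logNorm y) / 2 ∧
      shellPoint m (y, x, k) = upper (b * y) b x' * ofCompact k := by
  let u : 𝕜ˣ := Units.mk0 (radius m : 𝕜) (by exact_mod_cast (radius_pos m).ne')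
  let v : 𝕜ˣ := Units.mk0 ((nabs (y : 𝕜) ^ (-(1 / (2 * (deg 𝕜 : ℝ)))) : ℝ) : 𝕜)
    (by exact_mod_cast (Real.rpow_pos_of_pos (nabs_units_pos y) _).ne')
  refine ⟨u * v, (u * v : 𝕜ˣ) * x, ?_, ?_⟩
  · refine logNorm_eq_of_norm ?_
    rw [Units.val_mul, Units.val_mk0, Units.val_mk0, norm_mul, RCLike.norm_ofReal,
      RCLike.norm_ofReal, radius_eq, ← neg_div, nabs_rpow, Real.rpow_neg_one,
      abs_of_pos (sqrt_norm_pos m), abs_of_pos (inv_pos.mpr (sqrt_norm_pos y)), sqrt_norm_eq_exp,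
      sqrt_norm_eq_exp, ← Real.exp_neg, ← Real.exp_add]
    congr 1
    ring
  · have h : shellPoint m (y, x, k) =
        upper u u 0 * (upper v v 0 * upper y 1 x * ofCompact k) := rfl
    rw [h, upper_mul, ← mul_assoc, upper_mul]
    simp [mul_assoc]

/-- The upper triangular part has diagonal (by, b) with ‖b‖ = (‖m‖/‖y‖)^(1/2), so the character is
|m|^((ν₁+ν₂)/2) |y|^((ν₁-ν₂)/2 + 1/2), precisely the exponent handled by `shell_integral`. -/
lemma principalSeries_shellPoint {ν₁ ν₂ : ℂ} {f : GL (Fin 2) 𝕜 → ℂ}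
    (hf : IsPrincipalSeriesFunction ν₁ ν₂ f) (hK : ∀ k : MaxCompact 𝕜, f (ofCompact k) = f 1)
    (m : 𝕜ˣ) (p : 𝕜ˣ × 𝕜 × MaxCompact 𝕜) :
    f (shellPoint m p) = Complex.exp (deg 𝕜 * ((ν₁ + ν₂) / 2) * logNorm m) *
      (nabs (p.1 : 𝕜) : ℂ) ^ ((ν₁ - ν₂) / 2 + 1 / 2) * f 1 := by
  obtain ⟨b, x', hb, h⟩ := exists_shellPoint_eq m p.1 p.2.1 p.2.2
  have hq : (((b * p.1 : 𝕜ˣ) : 𝕜) / (b : 𝕜)) = (p.1 : 𝕜) := by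
    rw [Units.val_mul, mul_div_cancel_left₀ _ b.ne_zero]
  rw [show p = (p.1, p.2.1, p.2.2) from rfl, h, hf.2, hK, hq, nabs_cpow_eq_exp,
    nabs_cpow_eq_exp, nabs_cpow_eq_exp, nabs_cpow_eq_exp, ← Complex.exp_add, ← Complex.exp_add,
    ← Complex.exp_add, logNorm_mul, hb]
  congr 2
  push_cast
  ring

variable [MeasurableSpace 𝕜] [BorelSpace 𝕜] {H : Type*} [NormedAddCommGroup H]
  [InnerProductSpace ℂ H] [CompleteSpace H] {π : GL (Fin 2) 𝕜 →* (H ≃ₗᵢ[ℂ] H)}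

/-- The result is a multiple of `w`, so pairing with `w` finds the scalar; the coefficient that
appears is a spherical function, the K-average of the principal series function of `w`. -/
lemma shellOperator_of_isFixed (hπ : IsUnitaryRep π) {ν₁ ν₂ : ℂ}
    (hemb : EmbedsInPrincipalSeries π ν₁ ν₂) {w : smoothVectors π} (hw : IsFixed π (w : H))
    (hw0 : w ≠ 0) (hspan : ∀ x, IsFixed π x → ∃ c : ℂ, x = c • (w : H)) (m : 𝕜ˣ) :
    shellOperator π m w = (Complex.exp (deg 𝕜 * ((ν₁ + ν₂) / 2) * logNorm m) * (logVolume 𝕜 *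
      bessel (Real.pi * deg 𝕜) (deg 𝕜 * ((ν₁ - ν₂) / 2)) (logNorm m))) • (w : H) := by
  obtain ⟨T, hinj, hps, heq, hcont⟩ := hemb
  have hf1 : T w 1 ≠ 0 := fun h => hw0 (eq_zero_of_fixed hinj hps heq hw h)
  have hfK : ∀ k : MaxCompact 𝕜, T w (ofCompact k) = T w 1 := fun k => by
    have : smoothAct π (ofCompact k) w = w := Subtype.ext (hw k)
    conv_rhs => rw [← this, heq, one_mul]
  have hfc : Continuous (T w) := by
    let ev : smoothVectors π →ₗ[ℂ] ℂ := (LinearMap.proj 1).comp T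
    have := IsContinuousFunctional.continuous_orbit π (Λ := ev) hcont w
    simpa [ev, heq] using this
  -- The average of π(g)w is c·w. Evaluating the embedding at 1, a continuous functional that
  -- commutes with averages, finds c, and pairing with the fixed vector `w` does not see the
  -- averaging.
  have hav : ∀ g, ⟪(w : H), π g w⟫_ℂ =
      (∫ k, T w (ofCompact k * g) ∂compactMeasure 𝕜) / T w 1 * ⟪(w : H), w⟫_ℂ := by
    intro g
    let ev : smoothVectors π →ₗ[ℂ] ℂ := (LinearMap.proj 1).comp T
    have h1 := IsContinuousFunctional.map_average π (Λ := ev) hcont hπ (smoothAct π g w) 1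
    obtain ⟨c, hc⟩ := hspan _ (isFixed_average hπ (π g w))
    have h2 : (⟨average π (π g w), average_mem_smoothVectors π hπ (smoothAct π g w).2⟩ :
        smoothVectors π) = c • w := Subtype.ext hc
    have h3 : ∀ v : smoothVectors π, smoothAct π 1 v = v := fun v =>
      Subtype.ext (by simp [smoothAct])
    have h4 : (c : ℂ) * T w 1 = ∫ k, T w (ofCompact k * g) ∂compactMeasure 𝕜 := by
      refine Eq.trans ?_ (h1.trans ?_)
      · rw [h3]
        change c * T w 1 = T ⟨average π (π g w), _⟩ 1
        rw [h2, map_smul]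
        rfl
      · refine integral_congr_ae (.of_forall fun k => ?_)
        change T _ 1 = _
        rw [heq, heq, one_mul, one_mul]
    rw [← inner_average hπ hw, hc, inner_smul_right, ← h4, mul_div_cancel_right₀ _ hf1]
  set F : GL (Fin 2) 𝕜 → ℂ := fun g => gaussian g * T w g with hF
  have hFc : Continuous F := continuous_gaussian_smul hfc
  obtain ⟨hsi, hsI⟩ := shell_integral m ((ν₁ - ν₂) / 2)
  have hFP : ∀ p, F (shellPoint m p) = (Complex.exp (deg 𝕜 * ((ν₁ + ν₂) / 2) * logNorm m) *
      T w 1) * ((gaussian (realScalar (radius m) (radius_pos m) * iwasawaPoint p) : ℂ) *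
        (nabs (p.1 : 𝕜) : ℂ) ^ ((ν₁ - ν₂) / 2 + 1 / 2)) := fun p => by
    simp only [hF]
    rw [principalSeries_shellPoint (hps w) hfK, shellPoint]
    ring
  have hFi : Integrable (fun p => F (shellPoint m p)) (iwasawaMeasure 𝕜) := by
    simp only [hFP]
    exact hsi.const_mul _
  have hFint : ∫ p, F (shellPoint m p) ∂iwasawaMeasure 𝕜 =
      (Complex.exp (deg 𝕜 * ((ν₁ + ν₂) / 2) * logNorm m) * (logVolume 𝕜 *
      bessel (Real.pi * deg 𝕜) (deg 𝕜 * ((ν₁ - ν₂) / 2)) (logNorm m))) * T w 1 := by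
    simp only [hFP]
    rw [integral_const_mul, hsI]
    ring
  have hprod : Integrable (fun q : (𝕜ˣ × 𝕜 × MaxCompact 𝕜) × MaxCompact 𝕜 =>
      F (ofCompact q.2 * shellPoint m q.1)) ((iwasawaMeasure 𝕜).prod (compactMeasure 𝕜)) := by
    have hc : Continuous fun q : (𝕜ˣ × 𝕜 × MaxCompact 𝕜) × MaxCompact 𝕜 =>
      F (ofCompact q.2 * shellPoint m q.1) := hFc.comp ((continuous_ofCompact.comp
        continuous_snd).mul ((continuous_shellPoint m).comp continuous_fst))
    rw [integrable_prod_iff' hc.aestronglyMeasurable]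
    refine ⟨.of_forall fun k => (shell_ofCompact_mul m k hFc).1.mpr hFi, ?_⟩
    simp only [fun k => (shell_ofCompact_mul m k hFc.norm).2]
    exact integrable_const _
  -- Fubini moves the K-integral outside, where left invariance of the shell measure makes the inner
  -- integral independent of k; the average disappears because K has mass one.
  have hswap : ∫ p, gaussian (shellPoint m p) *
      (∫ k, T w (ofCompact k * shellPoint m p) ∂compactMeasure 𝕜) ∂iwasawaMeasure 𝕜 =
      ∫ p, F (shellPoint m p) ∂iwasawaMeasure 𝕜 := by
    have h := integral_integral_swap (f := fun p k => F (ofCompact k * shellPoint m p)) hprod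
    simp only [fun k => (shell_ofCompact_mul m k hFc).2, integral_const, probReal_univ,
      one_smul] at h
    rw [← h]
    simp only [hF, gaussian_ofCompact_mul, integral_const_mul]
  obtain ⟨c, hc⟩ := hspan _ (isFixed_shellOperator hπ m (w : H))
  have hww : ⟪(w : H), w⟫_ℂ ≠ 0 := inner_self_ne_zero.mpr fun h => hw0 (Subtype.ext h)
  have hin := inner_shellOperator hπ m (w : H) w
  simp only [hav] at hin
  simp only [← mul_assoc, mul_div_assoc', integral_mul_const, integral_div, hswap, hFint] at hin
  rw [hc, inner_smul_right, mul_div_cancel_right₀ _ hf1] at hin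
  rw [hc, mul_right_cancel₀ hww hin]
  ring_nf

end Scalar

/-! ### Spherical Whittaker functions in Iwasawa coordinates -/

section Newform

variable {𝕜 : Type*} [RCLike 𝕜]

/-- The positive real number `exp x` as a unit. -/
def expUnit (x : ℝ) : 𝕜ˣ := Units.mk0 (Real.exp x : 𝕜) (by exact_mod_cast (Real.exp_pos x).ne')

/-- The phase of `m` is unitary, so a right K-invariant function on the torus depends only on
log‖m‖, as the Laplace argument requires. -/
lemma exists_upper_eq_expUnit_mul (m : 𝕜ˣ) :
    ∃ k : MaxCompact 𝕜, upper m 1 0 = upper (expUnit (logNorm m)) 1 0 * ofCompact k := by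
  have he : ((Real.exp (logNorm m) : ℝ) : 𝕜) ≠ 0 := by exact_mod_cast (Real.exp_pos _).ne'
  have hu : ‖(m : 𝕜) / (Real.exp (logNorm m) : ℝ)‖ = 1 := by
    rw [norm_div, RCLike.norm_ofReal, abs_of_pos (Real.exp_pos _), exp_logNorm,
      div_self (norm_ne_zero_iff.mpr m.ne_zero)]
  have hk : !![(m : 𝕜) / (Real.exp (logNorm m) : ℝ), 0; 0, 1] ∈
      Matrix.unitaryGroup (Fin 2) 𝕜 := by
    rw [Matrix.mem_unitaryGroup_iff]
    ext i j
    fin_cases i <;> fin_cases j <;>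
      simp [Matrix.mul_apply, Fin.sum_univ_two, Matrix.star_apply, -map_div₀]
    rw [RCLike.mul_conj, hu]
    simp
  refine ⟨⟨_, hk⟩, ?_⟩
  ext1
  rw [Units.val_mul, coe_upper, coe_upper, coe_ofCompact, expUnit]
  ext i j
  fin_cases i <;> fin_cases j <;> simp only [Matrix.mul_apply, Fin.sum_univ_two, Units.val_mk0]
  · simpa using (mul_div_cancel₀ (m : 𝕜) he).symm
  all_goals simp

lemma continuous_upper_expUnit : Continuous fun x : ℝ => (upper (expUnit x) 1 0 : GL (Fin 2) 𝕜) := by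
  have hinv : ∀ x : ℝ, (upper (expUnit x) 1 0 : GL (Fin 2) 𝕜)⁻¹ = upper (expUnit (-x)) 1 0 := by
    intro x
    rw [inv_eq_iff_mul_eq_one, upper_mul]
    ext1
    have : (expUnit x * expUnit (-x) : 𝕜ˣ) = 1 := by
      ext1
      rw [Units.val_mul, expUnit, expUnit, Units.val_mk0, Units.val_mk0, ← RCLike.ofReal_mul,
        ← Real.exp_add, add_neg_cancel, Real.exp_zero, RCLike.ofReal_one, Units.val_one]
    rw [this, coe_upper]
    simp [Matrix.one_fin_two]
  have h : Continuous fun x : ℝ => ((upper (expUnit x) 1 0 : GL (Fin 2) 𝕜) : Matrix (Fin 2) (Fin 2) 𝕜) := by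
    simp only [coe_upper]
    refine continuous_matrix fun i j => ?_
    fin_cases i <;> fin_cases j <;> simp [expUnit] <;> fun_prop
  rw [Units.continuous_iff]
  refine ⟨h, ?_⟩
  simp only [hinv]
  exact h.comp continuous_neg

variable {H : Type*} [NormedAddCommGroup H] [InnerProductSpace ℂ H]
  {π : GL (Fin 2) 𝕜 →* (H ≃ₗᵢ[ℂ] H)}

lemma smoothAct_smoothAct (g h : GL (Fin 2) 𝕜) (v : smoothVectors π) :
    smoothAct π g (smoothAct π h v) = smoothAct π (g * h) v :=
  Subtype.ext (by simp [smoothAct])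

/-- The three factors separate: the unipotent one through the equivariance of `Λ`, the central one
through its eigenvalue on `w`, and `k` because `w` is fixed. -/
lemma whittakerFunction_iwasawa {Λ : smoothVectors π →ₗ[ℂ] ℂ} (hΛ : IsWhittakerFunctional π Λ)
    {w : smoothVectors π} (hw : IsFixed π (w : H)) {z : 𝕜ˣ} {χ : ℂ}
    (hz : π (upper z z 0) w = χ • (w : H)) (t : 𝕜) (m : 𝕜ˣ) (k : MaxCompact 𝕜) :
    whittakerFunction π Λ w (upper 1 1 t * upper (z * m) z 0 * ofCompact k) =
      stdChar t * χ * whittakerFunction π Λ w (upper m 1 0) := by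
  have h1 : smoothAct π (ofCompact k) w = w := Subtype.ext (hw k)
  have h2 : smoothAct π (upper z z 0) w = χ • w := Subtype.ext hz
  have h3 : upper (z * m) z 0 = upper m 1 0 * upper z z 0 := by
    rw [upper_mul]; simp [mul_comm]
  have h4 : smoothAct π (upper m 1 0) (χ • w) = χ • smoothAct π (upper m 1 0) w :=
    Subtype.ext (by simp [smoothAct])
  rw [whittakerFunction, whittakerFunction, mul_assoc, ← smoothAct_smoothAct, hΛ.2,
    ← smoothAct_smoothAct, h1, h3, ← smoothAct_smoothAct, h2, h4, map_smul, smul_eq_mul, mul_assoc]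

lemma central_mul_comm (z : 𝕜ˣ) (g : GL (Fin 2) 𝕜) :
    upper z z 0 * g = g * upper z z 0 := by
  have : ((upper z z 0 : GL (Fin 2) 𝕜) : Matrix (Fin 2) (Fin 2) 𝕜) = (z : 𝕜) • 1 := by
    rw [coe_upper]
    ext i j
    fin_cases i <;> fin_cases j <;> simp
  ext1
  simp [this]

lemma exists_smul_of_isFixed [CompleteSpace H] (hπ : IsUnitaryRep π) (hirr : IsIrreducibleRep π)
    (hsph : IsSpherical π) {ν₁ ν₂ : ℂ} (hemb : EmbedsInPrincipalSeries π ν₁ ν₂)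
    {w : smoothVectors π} (hw : IsFixed π (w : H)) (hw0 : (w : H) ≠ 0) {x : H}
    (hx : IsFixed π x) : ∃ c : ℂ, x = c • (w : H) := by
  obtain ⟨g, hg⟩ := exists_average_span hπ hirr hsph hemb w.2 hw0
  obtain ⟨c, hc⟩ := hg x hx
  obtain ⟨d, hd⟩ := hg w hw
  have hd0 : d ≠ 0 := fun h => hw0 (by rw [hd, h, zero_smul])
  have hu : average π (π g (w : H)) = d⁻¹ • (w : H) := (eq_inv_smul_iff₀ hd0).mpr hd.symm
  exact ⟨c * d⁻¹, by rw [mul_smul, ← hu, ← hc]⟩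

variable [MeasurableSpace 𝕜] [BorelSpace 𝕜]

lemma whittakerFunction_diagonal {Λ : smoothVectors π →ₗ[ℂ] ℂ} (hΛ : IsContinuousFunctional π Λ)
    {ν₁ ν₂ : ℂ} {w : smoothVectors π} {L : ℂ → ℂ}
    (hL : ∀ s, L s = gammaFactor 𝕜 (s + ν₁) * gammaFactor 𝕜 (s + ν₂))
    (hW : IsSphericalNewform L (whittakerFunction π Λ w)) (m : 𝕜ˣ) :
    whittakerFunction π Λ w (upper m 1 0) = heckeConst 𝕜 * logVolume 𝕜 *
      Complex.exp (deg 𝕜 * (1 / 2 + (ν₁ + ν₂) / 2) * logNorm m) *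
      bessel (Real.pi * deg 𝕜) (deg 𝕜 * ((ν₁ - ν₂) / 2)) (logNorm m) := by
  obtain ⟨hK, σ, hσ⟩ := hW
  have hV : ∀ m : 𝕜ˣ, whittakerFunction π Λ w (upper m 1 0) =
      whittakerFunction π Λ w (upper (expUnit (logNorm m)) 1 0) := fun m => by
    obtain ⟨k, hk⟩ := exists_upper_eq_expUnit_mul m
    rw [hk, hK]
  rw [hV]
  refine eq_bessel_of_zeta (V := fun x => whittakerFunction π Λ w (upper (expUnit x) 1 0))
    ((hΛ.continuous_orbit π w).comp continuous_upper_expUnit) (σ := σ) (fun s hs => ?_) _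
  obtain ⟨h1, h2⟩ := hσ s hs
  rw [hL] at h2
  have hV' : (fun m : 𝕜ˣ => whittakerFunction π Λ w (upper m 1 0) *
      (nabs (m : 𝕜) : ℂ) ^ (s - 1 / 2)) = fun m : 𝕜ˣ =>
      whittakerFunction π Λ w (upper (expUnit (logNorm m)) 1 0) *
        (nabs (m : 𝕜) : ℂ) ^ (s - 1 / 2) := funext fun m => by rw [← hV m]
  rw [hV'] at h1 h2
  exact ⟨h1, h2⟩

/-- A zero function would have zero zeta integrals, but far to the right the product of Gamma
factors does not vanish. -/
lemma whittakerFunction_ne_zero {Λ : smoothVectors π →ₗ[ℂ] ℂ} {ν₁ ν₂ : ℂ} {w : smoothVectors π}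
    {L : ℂ → ℂ} (hL : ∀ s, L s = gammaFactor 𝕜 (s + ν₁) * gammaFactor 𝕜 (s + ν₂))
    (hW : IsSphericalNewform L (whittakerFunction π Λ w)) : whittakerFunction π Λ w ≠ 0 := by
  intro h0
  obtain ⟨-, σ, hσ⟩ := hW
  set ρ := max σ (max (-ν₁.re) (-ν₂.re)) + 1
  have h1 : σ < ρ := by linarith [le_max_left σ (max (-ν₁.re) (-ν₂.re))]
  have h2 := le_max_right σ (max (-ν₁.re) (-ν₂.re))
  have h := (hσ ρ (by simpa using h1)).2
  rw [hL] at h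
  simp only [h0, Pi.zero_apply, zero_mul, integral_zero] at h
  refine mul_ne_zero (gammaFactor_ne_zero ?_) (gammaFactor_ne_zero ?_) h.symm
  · rw [Complex.add_re, Complex.ofReal_re]
    linarith [le_max_left (-ν₁.re) (-ν₂.re)]
  · rw [Complex.add_re, Complex.ofReal_re]
    linarith [le_max_right (-ν₁.re) (-ν₂.re)]

variable [CompleteSpace H]

/-- The average of `v` is a multiple of `w` with the same pairing with `w` as `v`, hence zero; and
the shell operator sees only that average. -/
lemma heckeOperator_of_mem_orthogonal (hπ : IsUnitaryRep π) {w : H} (hw : IsFixed π w)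
    (hw0 : w ≠ 0) (hspan : ∀ x, IsFixed π x → ∃ c : ℂ, x = c • w) (t : 𝕜) (m z : 𝕜ˣ) {v : H}
    (hv : v ∈ (Submodule.span ℂ {w})ᗮ) : heckeOperator π t m z v = 0 := by
  obtain ⟨c, hc⟩ := hspan _ (isFixed_average hπ v)
  have h := inner_average hπ hw v
  rw [hc, inner_smul_right, Submodule.mem_orthogonal_singleton_iff_inner_right.mp hv] at h
  have hc0 : c = 0 := (mul_eq_zero.mp h).resolve_right (inner_self_ne_zero.mpr hw0)
  rw [heckeOperator_eq hπ, ← shellOperator_average hπ, hc, hc0, zero_smul]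
  simp [shellOperator]

lemma heckeOperator_of_mem_span (hπ : IsUnitaryRep π) {L : ℂ → ℂ} {ν₁ ν₂ : ℂ}
    (hemb : EmbedsInPrincipalSeries π ν₁ ν₂)
    (hL : ∀ s, L s = gammaFactor 𝕜 (s + ν₁) * gammaFactor 𝕜 (s + ν₂))
    {Λ : smoothVectors π →ₗ[ℂ] ℂ} (hΛ : IsWhittakerFunctional π Λ) {w : smoothVectors π}
    (hW : IsSphericalNewform L (whittakerFunction π Λ w)) (hw : IsFixed π (w : H)) (hw0 : w ≠ 0)
    (hspan : ∀ x, IsFixed π x → ∃ c : ℂ, x = c • (w : H)) (t : 𝕜) (m z : 𝕜ˣ)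
    (k : MaxCompact 𝕜) {v : H} (hv : v ∈ Submodule.span ℂ {(w : H)}) :
    heckeOperator π t m z v =
      whittakerFunction π Λ w (upper 1 1 t * upper (z * m) z 0 * ofCompact k) • v := by
  obtain ⟨d, rfl⟩ := Submodule.mem_span_singleton.mp hv
  have hzf : IsFixed π (π (upper z z 0) (w : H)) := fun l => by
    have h : (π (ofCompact l) * π (upper z z 0)) (w : H) =
        (π (upper z z 0) * π (ofCompact l)) (w : H) := by
      rw [← map_mul, ← map_mul, central_mul_comm]
    refine h.trans ?_
    change π (upper z z 0) (π (ofCompact l) (w : H)) = _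
    rw [hw]
  -- The central character is read off from the fixed line; no form of Schur's lemma is needed.
  obtain ⟨χ, hχ⟩ := hspan _ hzf
  have hlin : shellOperator π m (d • (w : H)) = d • shellOperator π m (w : H) := by
    rw [shellOperator, shellOperator, ← integral_smul]
    simp only [map_smul, smul_comm d]
  rw [heckeOperator_eq hπ, hlin, shellOperator_of_isFixed hπ hemb hw hw0 hspan,
    whittakerFunction_iwasawa hΛ hw hχ, whittakerFunction_diagonal hΛ.1 hL hW, map_smul,
    map_smul, hχ, smul_smul, smul_smul, smul_smul, smul_smul, nabs_rpow_eq_exp]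
  congr 1
  have : Complex.exp (deg 𝕜 * (1 / 2 + (ν₁ + ν₂) / 2) * logNorm m) =
      (Real.exp (deg 𝕜 * (1 / 2) * logNorm m) : ℝ) *
        Complex.exp (deg 𝕜 * ((ν₁ + ν₂) / 2) * logNorm m) := by
    rw [Complex.ofReal_exp, ← Complex.exp_add]
    congr 1
    push_cast
    ring
  rw [this]
  ring

end Newform

end ArchWhittaker

end

/-! ### The spherical newform as an eigenvalue of its Hecke operators -/

theorem mainTheorem4 {𝕜 : Type*} [RCLike 𝕜] [MeasurableSpace 𝕜] [BorelSpace 𝕜]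
    {H : Type*} [NormedAddCommGroup H] [InnerProductSpace ℂ H] [CompleteSpace H]
    (π : GL (Fin 2) 𝕜 →* (H ≃ₗᵢ[ℂ] H)) (hunit : ArchWhittaker.IsUnitaryRep π)
    (hirr : ArchWhittaker.IsIrreducibleRep π) (hsph : ArchWhittaker.IsSpherical π)
    (L : ℂ → ℂ) (hL : ArchWhittaker.IsLFunction π L)
    (Λ : ArchWhittaker.smoothVectors π →ₗ[ℂ] ℂ) (hΛ : ArchWhittaker.IsWhittakerFunctional π Λ)
    (w : ArchWhittaker.smoothVectors π)
    (hW : ArchWhittaker.IsSphericalNewform L (ArchWhittaker.whittakerFunction π Λ w))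
    (t : 𝕜) (m z : 𝕜ˣ) (k : ArchWhittaker.MaxCompact 𝕜) :
    (∀ v : H, ArchWhittaker.HeckeConverges π m z v) ∧
    (∀ v ∈ (Submodule.span ℂ {(w : H)})ᗮ, ArchWhittaker.heckeOperator π t m z v = 0) ∧
    (∀ v ∈ Submodule.span ℂ {(w : H)}, ArchWhittaker.heckeOperator π t m z v =
      ArchWhittaker.whittakerFunction π Λ w
        (ArchWhittaker.upper 1 1 t * ArchWhittaker.upper (z * m) z 0 *
          ArchWhittaker.ofCompact k) • v) := by
  -- The same ν₁, ν₂ govern the principal series model, hence the spherical function, and the Gamma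
  -- factors, hence the Whittaker function; this is why the two Bessel functions coincide.
  obtain ⟨ν₁, ν₂, hemb, hLs⟩ := hL
  have hW0 := ArchWhittaker.whittakerFunction_ne_zero hLs hW
  have hw0 : w ≠ 0 := by
    rintro rfl
    refine hW0 (funext fun g => ?_)
    have : ArchWhittaker.smoothAct π g (0 : ArchWhittaker.smoothVectors π) = 0 :=
      Subtype.ext (by simp [ArchWhittaker.smoothAct])
    rw [ArchWhittaker.whittakerFunction, this, map_zero, Pi.zero_apply]
  have hw0' : (w : H) ≠ 0 := fun h => hw0 (Subtype.ext h)
  have hw := ArchWhittaker.isFixed_of_whittakerFunction hunit hirr hsph hemb hΛ.1 hW.1 hW0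
  have hspan : ∀ x, ArchWhittaker.IsFixed π x → ∃ c : ℂ, x = c • (w : H) := fun x =>
    ArchWhittaker.exists_smul_of_isFixed hunit hirr hsph hemb hw hw0'
  exact ⟨ArchWhittaker.heckeConverges hunit m z,
    fun v => ArchWhittaker.heckeOperator_of_mem_orthogonal hunit hw hw0' hspan t m z,
    fun v => ArchWhittaker.heckeOperator_of_mem_span hunit hemb hLs hΛ hW hw hw0 hspan t m z k⟩
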